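/- **Setting.** Let $1\le k$, $0\le\mathcal O<P$ be integers. For each sample size $n>P$ let $Y=X\theta+u$, where $X=X_n$ is a non-stochastic $n\times P$ matrix of rank $P$, $u\sim N(0,\sigma^2I_n)$, $\theta\in\mathbb R^P$, $\sigma>0$, and assume that $Q=\lim_{n\to\infty}X'X/n$ exists and is non-singular. Let $A$ be a $k\times P$ matrix of rank $k$. For a matrix $D$ with $P$ columns, $D[p]$ and $D[\neg p]$ denote the matrices of its first $p$ and of its last $P-p$ columns; similarly $x[p]$, $x[\neg p]$ for vectors $x$ with $P$ coordinates, and $Q[p:p]$, $Q[p:\neg p]$ for the corresponding blocks of the first $p$ rows of $Q$. For $0\le p\le P$ let $\tilde\theta(p)\in\mathbb R^P$ be the restricted least-squares estimator, with first $p$ coordinates $(X[p]'X[p])^{-1}X[p]'Y$ and last $P-p$ coordinates $0$, and let $\eta_n(p)$ be its mean, with first $p$ coordinates $\theta[p]+(X[p]'X[p])^{-1}X[p]'X[\neg p]\theta[\neg p]$ and last $P-p$ coordinates $0$. Put $\xi_{n,p}^2=[(X[p]'X[p]/n)^{-1}]_{p,p}$ ($\xi_{n,p}>0$), $\hat\sigma^2=(n-P)^{-1}\|Y-X\tilde\theta(P)\|^2$,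 $T_0=T_0^*=0$ and, for $0<p\le P$, $T_p=\sqrt n\,\tilde\theta_p(p)/(\hat\sigma\xi_{n,p})$ and $T_p^*=\sqrt n\,\tilde\theta_p(p)/(\sigma\xi_{n,p})$. Let the critical values satisfy $c_{\mathcal O}=0$ and $0<c_p<\infty$ for $\mathcal O<p\le P$, and let $\hat p=\max\{p:|T_p|\ge c_p,\ 0\le p\le P\}$ and $\hat p^*=\max\{p:|T^*_p|\ge c_p,\ 0\le p\le P\}$; both lie in $\{\mathcal O,\dots,P\}$. Let $\tilde\theta=\tilde\theta(\hat p)$, $\tilde\theta^*=\tilde\theta(\hat p^*)$ and, for $t\in\mathbb R^k$, with coordinatewise inequalities, $$G_{n,\theta,\sigma}(t)=P_{n,\theta,\sigma}\big(\sqrt nA(\tilde\theta-\theta)\le t\big),\qquad G^*_{n,\theta,\sigma}(t)=P_{n,\theta,\sigma}\big(\sqrt nA(\tilde\theta^*-\theta)\le t\big).$$ **Limiting quantities.** For $s\ge0$ let $\Delta_s(a,b)=P(|M-a|<b)$ with $M\sim N(0,s^2)$ ($M=0$ if $s=0$). For $\sigma>0$ let $\Phi_{\infty,p}$ be the cdf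 of $N(0,\sigma^2A[p]Q[p:p]^{-1}A[p]')$ on $\mathbb R^k$ ($0<p\le P$), and let $\Phi_{\infty,0}$ be the cdf of point-mass at $0$. For $1\le p\le P$ let $C_\infty^{(p)}=A[p]Q[p:p]^{-1}e_p$, where $e_p$ is the $p$-th standard basis vector, $\xi_{\infty,p}^2=(Q[p:p]^{-1})_{p,p}$, $b_{\infty,p}=C_\infty^{(p)\prime}(A[p]Q[p:p]^{-1}A[p]')^-$ and $\zeta^2_{\infty,p}=\xi^2_{\infty,p}-b_{\infty,p}C_\infty^{(p)}$ with $\xi_{\infty,p},\zeta_{\infty,p}\ge0$, where $S^-$ is an arbitrary generalized inverse of $S$ (that is, $SS^-S=S$). **Proposition 5.1.** Consider $\theta^{(n)}\in\mathbb R^P$ and $\sigma^{(n)}>0$ such that $\sqrt n\,\theta^{(n)}$ converges coordinatewise to $\psi\in[-\infty,\infty]^P$ and $\sigma^{(n)}\to\sigma\in(0,\infty)$ as $n\to\infty$. Let $p_*$ be the largest index $p$, $\mathcal O<p\le P$, with $|\psi_p|=\infty$, and let $p_*=\mathcal O$ if there is no such index. For $p_*\le p\le P$ let $$\delta^{(p)}=\begin{pmatrix}Q[p:p]^{-1}Q[p:\neg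 p]\\-I_{P-p}\end{pmatrix}\psi[\neg p]\in\mathbb R^P\qquad(\delta^{(P)}=0,\ \delta^{(0)}=-\psi),$$ which is finite. Then, for $p_*\le p\le P$, $\delta^{(p)}=\lim_{n\to\infty}\sqrt n\,(\eta_n(p)-\theta^{(n)})$, where $\eta_n(p)$ is taken at $\theta=\theta^{(n)}$. Moreover, $$\begin{aligned}&\Phi_{\infty,p_*}(t-A\delta^{(p_*)})\prod_{q=p_*+1}^P\Delta_{\sigma\xi_{\infty,q}}(\delta^{(q)}_q+\psi_q,\,c_q\sigma\xi_{\infty,q})\\&+\sum_{p=p_*+1}^P\int_{z\le t-A\delta^{(p)}}\Big(1-\Delta_{\sigma\zeta_{\infty,p}}(\delta^{(p)}_p+\psi_p+b_{\infty,p}z,\,c_p\sigma\xi_{\infty,p})\Big)\Phi_{\infty,p}(dz)\prod_{q=p+1}^P\Delta_{\sigma\xi_{\infty,q}}(\delta^{(q)}_q+\psi_q,\,c_q\sigma\xi_{\infty,q})\end{aligned}\tag{5.1}$$ is, as a function of $t\in\mathbb R^k$, the cdf of a probability measure on $\mathbb R^k$, and both $G^*_{n,\theta^{(n)},\sigma^{(n)}}$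 and $G_{n,\theta^{(n)},\sigma^{(n)}}$ converge weakly to it, that is, at each of its continuity points. Both converge to it in total variation in the case where $p_*>0$ and $A[p_*]$ has rank $k$, and in the case where $p_*<P$ and $\sqrt n\,A[\neg p_*]\theta^{(n)}[\neg p_*]$ is constant in $n$. -/

import Mathlib

open MeasureTheory ProbabilityTheory Filter Topology Matrix

namespace PostSel

noncomputable section

/-! ### Blocks and coordinates

Model orders `p` are natural numbers `0 ≤ p ≤ P`. The coordinates of `ℝ^P` are indexed by
`Fin P`, so that the `p`-th coordinate (counted from one) has index `p - 1`. The first `p`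
coordinates are the `j : Fin P` with `(j : ℕ) < p`, the last `P - p` ones those with
`¬ (j : ℕ) < p`. -/

/-- The matrix `D[p]` of the first `p` columns of `D`. -/
def headCols {m : Type*} {P : ℕ} (D : Matrix m (Fin P) ℝ) (p : ℕ) :
    Matrix m {j : Fin P // (j : ℕ) < p} ℝ :=
  D.submatrix id Subtype.val

/-- The matrix `D[¬p]` of the last `P - p` columns of `D`. -/
def tailCols {m : Type*} {P : ℕ} (D : Matrix m (Fin P) ℝ) (p : ℕ) :
    Matrix m {j : Fin P // ¬ (j : ℕ) < p} ℝ :=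
  D.submatrix id Subtype.val

/-- The vector `x[p]` of the first `p` coordinates of `x`. -/
def headVec {P : ℕ} (x : Fin P → ℝ) (p : ℕ) : {j : Fin P // (j : ℕ) < p} → ℝ :=
  fun j => x j.1

/-- The vector `x[¬p]` of the last `P - p` coordinates of `x`. -/
def tailVec {P : ℕ} (x : Fin P → ℝ) (p : ℕ) : {j : Fin P // ¬ (j : ℕ) < p} → ℝ :=
  fun j => x j.1

/-- The `P`-vector with given first `p` and last `P - p` coordinates. -/
def stack {P : ℕ} (p : ℕ) (u : {j : Fin P // (j : ℕ) < p} → ℝ)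
    (v : {j : Fin P // ¬ (j : ℕ) < p} → ℝ) : Fin P → ℝ :=
  fun j => if h : (j : ℕ) < p then u ⟨j, h⟩ else v ⟨j, h⟩

/-- The leading block `M[p:p]`. -/
def blockHH {P : ℕ} (M : Matrix (Fin P) (Fin P) ℝ) (p : ℕ) :
    Matrix {j : Fin P // (j : ℕ) < p} {j : Fin P // (j : ℕ) < p} ℝ :=
  M.submatrix Subtype.val Subtype.val

/-- The upper right block `M[p:¬p]`. -/
def blockHT {P : ℕ} (M : Matrix (Fin P) (Fin P) ℝ) (p : ℕ) :
    Matrix {j : Fin P // (j : ℕ) < p} {j : Fin P // ¬ (j : ℕ) < p} ℝ :=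
  M.submatrix Subtype.val Subtype.val

/-- The `p`-th coordinate `x_p` of `x`, counted from one (and `0` unless `1 ≤ p ≤ P`). -/
def coord {P : ℕ} (x : Fin P → ℝ) (p : ℕ) : ℝ :=
  if h : 0 < p ∧ p ≤ P then x ⟨p - 1, by omega⟩ else 0

/-- The `p`-th standard basis vector, restricted to the first `p` coordinates. -/
def lastBasis {P : ℕ} (p : ℕ) : {j : Fin P // (j : ℕ) < p} → ℝ :=
  fun j => if (j.1 : ℕ) + 1 = p then 1 else 0

/-! ### The regression model, the estimators and the selectors -/

/-- The law of `Y = X θ + u` with `u ∼ N(0, σ² I_n)`. -/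
def sampleLaw {n P : ℕ} (X : Matrix (Fin n) (Fin P) ℝ) (θ : Fin P → ℝ) (σ : ℝ) :
    Measure (Fin n → ℝ) :=
  (Measure.pi fun _ : Fin n => gaussianReal 0 (σ ^ 2).toNNReal).map (fun u => X *ᵥ θ + u)

/-- The restricted least-squares estimator `θ̃(p)`: its first `p` coordinates are
`(X[p]'X[p])⁻¹ X[p]'Y`, the others are zero. -/
def restrLS {n P : ℕ} (X : Matrix (Fin n) (Fin P) ℝ) (p : ℕ) (Y : Fin n → ℝ) : Fin P → ℝ :=
  stack p (((headCols X p)ᵀ * headCols X p)⁻¹ *ᵥ ((headCols X p)ᵀ *ᵥ Y)) 0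

/-- The mean `η_n(p)` of `θ̃(p)` under the parameter `θ`. -/
def meanLS {n P : ℕ} (X : Matrix (Fin n) (Fin P) ℝ) (p : ℕ) (θ : Fin P → ℝ) : Fin P → ℝ :=
  stack p (headVec θ p + (((headCols X p)ᵀ * headCols X p)⁻¹ *
    ((headCols X p)ᵀ * tailCols X p)) *ᵥ tailVec θ p) 0

/-- The usual unbiased variance estimator of the overall model, `σ̂²`. -/
def sigmaHatSq {n P : ℕ} (X : Matrix (Fin n) (Fin P) ℝ) (Y : Fin n → ℝ) : ℝ :=
  ((n : ℝ) - (P : ℝ))⁻¹ * ((Y - X *ᵥ restrLS X P Y) ⬝ᵥ (Y - X *ᵥ restrLS X P Y))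

/-- `ξ_p² = (M[p:p]⁻¹)_{p,p} = e_p' M[p:p]⁻¹ e_p`, used with `M = X'X/n` and with `M = Q`. -/
def xiSq {P : ℕ} (M : Matrix (Fin P) (Fin P) ℝ) (p : ℕ) : ℝ :=
  lastBasis p ⬝ᵥ ((blockHH M p)⁻¹ *ᵥ lastBasis p)

/-- `ξ_p`, the nonnegative square root of `ξ_p²`. -/
def xi {P : ℕ} (M : Matrix (Fin P) (Fin P) ℝ) (p : ℕ) : ℝ := √(xiSq M p)

/-- The scaled Gram matrix `X'X/n`. -/
def gram {n P : ℕ} (X : Matrix (Fin n) (Fin P) ℝ) : Matrix (Fin P) (Fin P) ℝ :=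
  (n : ℝ)⁻¹ • (Xᵀ * X)

/-- The statistic `√n θ̃_p(p) / (s ξ_{n,p})` for the scale `s`; it is `0` for `p = 0`. -/
def testStat {n P : ℕ} (X : Matrix (Fin n) (Fin P) ℝ) (s : ℝ) (p : ℕ) (Y : Fin n → ℝ) : ℝ :=
  √(n : ℝ) * coord (restrLS X p Y) p / (s * xi (gram X) p)

open Classical in
/-- The general-to-specific selector `max {p : |T_p| ≥ c_p, 0 ≤ p ≤ P}` where `T_p` uses the
scale `s`. -/
def selector {n P : ℕ} (X : Matrix (Fin n) (Fin P) ℝ) (c : ℕ → ℝ) (s : ℝ)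
    (Y : Fin n → ℝ) : ℕ :=
  Nat.findGreatest (fun p => c p ≤ |testStat X s p Y|) P

/-- The post-model-selection estimator `θ̃` (error variance estimated). -/
def pmsEst {n P : ℕ} (X : Matrix (Fin n) (Fin P) ℝ) (c : ℕ → ℝ) (Y : Fin n → ℝ) : Fin P → ℝ :=
  restrLS X (selector X c (√(sigmaHatSq X Y)) Y) Y

/-- The idealized post-model-selection estimator `θ̃*` (error variance `σ²` known). -/
def pmsEstStar {n P : ℕ} (X : Matrix (Fin n) (Fin P) ℝ) (c : ℕ → ℝ) (σ : ℝ)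
    (Y : Fin n → ℝ) : Fin P → ℝ :=
  restrLS X (selector X c σ Y) Y

/-- The law of `√n A (θ̃ - θ)` under `P_{n,θ,σ}`. -/
def pmsLaw {n P k : ℕ} (X : Matrix (Fin n) (Fin P) ℝ) (A : Matrix (Fin k) (Fin P) ℝ)
    (c : ℕ → ℝ) (θ : Fin P → ℝ) (σ : ℝ) : Measure (Fin k → ℝ) :=
  (sampleLaw X θ σ).map (fun Y => √(n : ℝ) • (A *ᵥ (pmsEst X c Y - θ)))

/-- The law of `√n A (θ̃* - θ)` under `P_{n,θ,σ}`. -/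
def pmsLawStar {n P k : ℕ} (X : Matrix (Fin n) (Fin P) ℝ) (A : Matrix (Fin k) (Fin P) ℝ)
    (c : ℕ → ℝ) (θ : Fin P → ℝ) (σ : ℝ) : Measure (Fin k → ℝ) :=
  (sampleLaw X θ σ).map (fun Y => √(n : ℝ) • (A *ᵥ (pmsEstStar X c σ Y - θ)))

/-! ### Cdfs on `ℝ^k`, weak convergence, total variation -/

/-- The cdf `t ↦ μ {z | z ≤ t}` (coordinatewise order) of a measure on `ℝ^k`. -/
def cdfOf {k : ℕ} (μ : Measure (Fin k → ℝ)) (t : Fin k → ℝ) : ℝ := μ.real (Set.Iic t)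

/-- Weak convergence of cdfs of probability measures: convergence at each continuity point of
the limit cdf. -/
def CdfTendsto {k : ℕ} (G : ℕ → (Fin k → ℝ) → ℝ) (F : (Fin k → ℝ) → ℝ) : Prop :=
  ∀ t, ContinuousAt F t → Tendsto (fun n => G n t) atTop (𝓝 (F t))

/-- The total variation distance `sup_B |μ(B) - ν(B)|` of two finite measures. -/
def tvDist {k : ℕ} (μ ν : Measure (Fin k → ℝ)) : ℝ :=
  ⨆ B : {B : Set (Fin k → ℝ) // MeasurableSet B}, |μ.real B.1 - ν.real B.1|

/-! ### The limiting quantities -/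

/-- `Δ_s(a, b) = P(|M - a| < b)` with `M ∼ N(0, s²)` (`M = 0` if `s = 0`). -/
def Delta (s a b : ℝ) : ℝ := (gaussianReal 0 (s ^ 2).toNNReal).real {m | |m - a| < b}

/-- `A[p] Q[p:p]⁻¹ A[p]'`. -/
def covMat {P k : ℕ} (Q : Matrix (Fin P) (Fin P) ℝ) (A : Matrix (Fin k) (Fin P) ℝ) (p : ℕ) :
    Matrix (Fin k) (Fin k) ℝ :=
  headCols A p * (blockHH Q p)⁻¹ * (headCols A p)ᵀ

/-- `S⁻` is a generalized inverse of `S`. -/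
def IsGenInv {k : ℕ} (S Sinv : Matrix (Fin k) (Fin k) ℝ) : Prop := S * Sinv * S = S

/-- The Gaussian law `N(0, σ² A[p] Q[p:p]⁻¹ A[p]')` on `ℝ^k`, with cdf `Φ_{∞,p}`. For `p = 0`
the covariance is the zero matrix and this is point-mass at zero. -/
def phiInf {P k : ℕ} (Q : Matrix (Fin P) (Fin P) ℝ) (A : Matrix (Fin k) (Fin P) ℝ) (σ : ℝ)
    (p : ℕ) : Measure (Fin k → ℝ) :=
  (multivariateGaussian 0 (σ ^ 2 • covMat Q A p)).map WithLp.ofLp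

/-- `C_∞^{(p)} = A[p] Q[p:p]⁻¹ e_p`. -/
def cInf {P k : ℕ} (Q : Matrix (Fin P) (Fin P) ℝ) (A : Matrix (Fin k) (Fin P) ℝ) (p : ℕ) :
    Fin k → ℝ :=
  headCols A p *ᵥ ((blockHH Q p)⁻¹ *ᵥ lastBasis p)

/-- The row vector `b_{∞,p} = C_∞^{(p)}' S⁻`, where `Sinv` is the chosen generalized inverse of
`A[p] Q[p:p]⁻¹ A[p]'`. -/
def bInf {P k : ℕ} (Q : Matrix (Fin P) (Fin P) ℝ) (A : Matrix (Fin k) (Fin P) ℝ)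
    (Sinv : Matrix (Fin k) (Fin k) ℝ) (p : ℕ) : Fin k → ℝ :=
  cInf Q A p ᵥ* Sinv

/-- `ζ_{∞,p}`, the nonnegative square root of `ξ_{∞,p}² - C' S⁻ C`. -/
def zetaInf {P k : ℕ} (Q : Matrix (Fin P) (Fin P) ℝ) (A : Matrix (Fin k) (Fin P) ℝ)
    (Sinv : Matrix (Fin k) (Fin k) ℝ) (p : ℕ) : ℝ :=
  √(xiSq Q p - bInf Q A Sinv p ⬝ᵥ cInf Q A p)

/-- The vector of real parts of `ψ ∈ [-∞,∞]^P`, infinite coordinates being replaced by `0`. It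
is used only through coordinates with index larger than `p_*`, which are finite. -/
def finPart {P : ℕ} (ψ : Fin P → EReal) : Fin P → ℝ := fun j => (ψ j).toReal

/-- `p_*`: the largest `p` with `O < p ≤ P` and `|ψ_p| = ∞`, and `O` if there is none. -/
def pStar {P : ℕ} (O : ℕ) (ψ : Fin P → EReal) : ℕ :=
  sSup (insert O {p : ℕ | O < p ∧ ∃ j : Fin P, (j : ℕ) + 1 = p ∧ (ψ j = ⊤ ∨ ψ j = ⊥)})

/-- The limiting bias `δ^{(p)}`: first part `Q[p:p]⁻¹ Q[p:¬p] ψ[¬p]`, second part `-ψ[¬p]`. -/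
def deltaInf {P : ℕ} (Q : Matrix (Fin P) (Fin P) ℝ) (ψ : Fin P → EReal) (p : ℕ) : Fin P → ℝ :=
  stack p (((blockHH Q p)⁻¹ * blockHT Q p) *ᵥ tailVec (finPart ψ) p) (-tailVec (finPart ψ) p)

/-- The limit of `√n η_{n,p}(p)`, i.e. `δ_p^{(p)} + ψ_p`. -/
def muInf {P : ℕ} (Q : Matrix (Fin P) (Fin P) ℝ) (ψ : Fin P → EReal) (p : ℕ) : ℝ :=
  coord (deltaInf Q ψ p) p + coord (finPart ψ) p

/-- `∏_{q=p+1}^P Δ_{σ ξ_{∞,q}}(δ_q^{(q)} + ψ_q, c_q σ ξ_{∞,q})`. -/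
def acceptProd {P : ℕ} (Q : Matrix (Fin P) (Fin P) ℝ) (c : ℕ → ℝ) (σ : ℝ) (ψ : Fin P → EReal)
    (p : ℕ) : ℝ :=
  ∏ q ∈ Finset.Icc (p + 1) P, Delta (σ * xi Q q) (muInf Q ψ q) (c q * σ * xi Q q)

/-- The limit cdf; `gi p` is the generalized inverse of `A[p] Q[p:p]⁻¹ A[p]'` that is used. -/
def limitCdf {P k : ℕ} (O : ℕ) (Q : Matrix (Fin P) (Fin P) ℝ) (A : Matrix (Fin k) (Fin P) ℝ)
    (c : ℕ → ℝ) (gi : ℕ → Matrix (Fin k) (Fin k) ℝ) (σ : ℝ) (ψ : Fin P → EReal)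
    (t : Fin k → ℝ) : ℝ :=
  cdfOf (phiInf Q A σ (pStar O ψ)) (t - A *ᵥ deltaInf Q ψ (pStar O ψ)) *
      acceptProd Q c σ ψ (pStar O ψ) +
    ∑ p ∈ Finset.Icc (pStar O ψ + 1) P,
      (∫ z in Set.Iic (t - A *ᵥ deltaInf Q ψ p),
        (1 - Delta (σ * zetaInf Q A (gi p) p) (muInf Q ψ p + bInf Q A (gi p) p ⬝ᵥ z)
          (c p * σ * xi Q p)) ∂(phiInf Q A σ p)) *
        acceptProd Q c σ ψ p

/-! ### Measurability of the estimators, so that the laws above are genuine image measures -/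

theorem measurable_restrLS {n P : ℕ} (X : Matrix (Fin n) (Fin P) ℝ) (p : ℕ) :
    Measurable (restrLS X p) := by
  refine Continuous.measurable (continuous_pi fun j => ?_)
  unfold restrLS stack
  by_cases h : (j : ℕ) < p
  · simp only [h, dite_true]
    exact (continuous_apply _).comp
      (continuous_const.matrix_mulVec (continuous_const.matrix_mulVec continuous_id))
  · simp only [h, dite_false]
    exact continuous_const

theorem measurable_coord {P : ℕ} (p : ℕ) : Measurable (fun x : Fin P → ℝ => coord x p) := by
  unfold coord
  split_ifs with h
  · exact measurable_pi_apply _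
  · exact measurable_const

theorem measurable_sigmaHatSq {n P : ℕ} (X : Matrix (Fin n) (Fin P) ℝ) :
    Measurable (sigmaHatSq X) := by
  have h : Measurable fun Y : Fin n → ℝ => Y - X *ᵥ restrLS X P Y :=
    measurable_id.sub ((continuous_const.matrix_mulVec continuous_id).measurable.comp
      (measurable_restrLS X P))
  have h' : Measurable fun v : Fin n → ℝ => v ⬝ᵥ v :=
    (continuous_id.dotProduct continuous_id).measurable
  exact (h'.comp h).const_mul _

theorem measurable_restrLS_selector {n P : ℕ} (X : Matrix (Fin n) (Fin P) ℝ) (c : ℕ → ℝ)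
    {s : (Fin n → ℝ) → ℝ} (hs : Measurable s) :
    Measurable fun Y => restrLS X (selector X c (s Y) Y) Y := by
  classical
  have hT : ∀ p, Measurable fun Y => testStat X (s Y) p Y := fun p =>
    (((measurable_coord p).comp (measurable_restrLS X p)).const_mul _).div (hs.mul_const _)
  have hsel : Measurable fun Y => selector X c (s Y) Y := by
    refine measurable_findGreatest fun p _ => ?_
    have := measurableSet_le (measurable_const (a := c p)) (measurable_norm.comp (hT p))
    simpa using this
  have hu : Measurable fun q : ℕ × (Fin n → ℝ) => restrLS X q.1 q.2 :=
    measurable_from_prod_countable_right fun p => measurable_restrLS X p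
  exact hu.comp (hsel.prodMk measurable_id)

instance {n P : ℕ} (X : Matrix (Fin n) (Fin P) ℝ) (θ : Fin P → ℝ) (σ : ℝ) :
    IsProbabilityMeasure (sampleLaw X θ σ) :=
  Measure.isProbabilityMeasure_map (measurable_const.add measurable_id).aemeasurable

theorem measurable_scaled {n P k : ℕ} (A : Matrix (Fin k) (Fin P) ℝ) (θ : Fin P → ℝ)
    {f : (Fin n → ℝ) → Fin P → ℝ} (hf : Measurable f) :
    Measurable fun Y => √(n : ℝ) • (A *ᵥ (f Y - θ)) :=
  ((continuous_const.matrix_mulVec continuous_id).const_smul (√(n : ℝ))).measurable.comp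
    (hf.sub_const θ)

instance {n P k : ℕ} (X : Matrix (Fin n) (Fin P) ℝ) (A : Matrix (Fin k) (Fin P) ℝ)
    (c : ℕ → ℝ) (θ : Fin P → ℝ) (σ : ℝ) : IsProbabilityMeasure (pmsLaw X A c θ σ) :=
  Measure.isProbabilityMeasure_map (measurable_scaled A θ
    (measurable_restrLS_selector X c (measurable_sigmaHatSq X).sqrt)).aemeasurable

instance {n P k : ℕ} (X : Matrix (Fin n) (Fin P) ℝ) (A : Matrix (Fin k) (Fin P) ℝ)
    (c : ℕ → ℝ) (θ : Fin P → ℝ) (σ : ℝ) : IsProbabilityMeasure (pmsLawStar X A c θ σ) :=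
  Measure.isProbabilityMeasure_map (measurable_scaled A θ
    (measurable_restrLS_selector X c measurable_const)).aemeasurable

end

end PostSel

open PostSel

/-!
The scaled estimation error and all test statistics depend on the data, apart from the variance
estimator, only through the score `S = n^{-1/2} X'u`, whose law is `N(0, σ² X'X/n)`: with
`K_p = E_p M[p:p]⁻¹ E_p'` for `M = X'X/n`, the estimator of order `p` has scaled error
`K_p S + bias_p`, and `T_p` is its `p`-th coordinate plus a deterministic shift, studentized
(`smul_mulVec_restrLS_sub`, `selector_eq`, `map_score`). The biases depend on `√n θ` only through
the coordinates beyond `p`, so that they converge for `p ≥ p_*`.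

*Limit experiment.* Let `S ∼ N(0, σ² Q)`. The test statistics of orders beyond `p` are independent
of one another and of the first `p` coordinates of `S`, and the estimator of order `p` depends on
those coordinates only; this gives the products in the limit cdf (`real_inter_acceptSet`). The
integrals come from the regression of the `p`-th statistic on the estimate of order `p`: the
residual is independent of the estimate, and any generalized inverse provides regression
coefficients, as the covariance of the two lies in the range of the covariance matrix of the
estimate (`covMat_mulVec_bInf`, `real_estimate_reject`). Hence the limit cdf is the cdf of the
estimation error in the limit experiment (`cdfOf_map_limError`).

*Known variance.* By Scheffé's lemma `N(0, σ_n² X'X/n)` converges to `N(0, σ² Q)` in total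
variation, so that the score may be given the limiting law throughout
(`LocalModel.tvTendsto_score`). For almost every fixed `S` the selected order is eventually the
one of the limit experiment, orders below `p_*` being excluded since `|T_{p_*}| → ∞`, or
`c_{p_*} = 0`. So the estimation error converges almost surely, which gives weak convergence
(`LocalModel.tendsto_cdf`).

*Total variation.* If the biases differ from their limits by `A[p] w_n` with `w_n → 0`, then the
error of order `p` at `S` is the limiting error at an affine image of `S`, by an affine map which
tends to the identity and moves the Gaussian law little in total variation
(`LocalModel.tvTendsto_selectedError`). The range condition holds if `A[p_*]` has rank `k`, and if
the contribution of the coordinates beyond `p_*` is constant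
(`LocalModel.bias_mem_range_of_rank`, `LocalModel.bias_mem_range_of_const`).

*Unknown variance.* The selected order is antitone in the scale used for studentization, and
`σ̂` is consistent by Chebyshev's inequality. Scales slightly below and above `σ` select the same
order with probability close to one, and so does `σ̂` (`LocalModel.tendsto_selector_ne`). Hence the
two laws differ by `o(1)` in total variation.
-/

/-! ### Convergence in total variation -/

/-- Convergence in total variation of measures, in the form "uniformly over measurable sets". -/
def TVTendsto {α : Type*} [MeasurableSpace α] (μ : ℕ → Measure α) (ν : Measure α) : Prop :=
  ∀ ε > 0, ∀ᶠ n in atTop, ∀ B, MeasurableSet B → |(μ n).real B - ν.real B| ≤ ε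

section Scheffe

variable {α : Type*} [MeasurableSpace α] {m : Measure α}

theorem integrable_of_withDensity_ofReal {f : α → ℝ} (hf : Measurable f) (hf0 : ∀ x, 0 ≤ f x)
    [IsFiniteMeasure (m.withDensity fun x => ENNReal.ofReal (f x))] : Integrable f m := by
  refine ⟨hf.aestronglyMeasurable, ?_⟩
  rw [hasFiniteIntegral_iff_ofReal (ae_of_all _ hf0)]
  have := measure_lt_top (m.withDensity fun x => ENNReal.ofReal (f x)) Set.univ
  rwa [withDensity_apply _ MeasurableSet.univ, Measure.restrict_univ] at this

theorem real_withDensity_ofReal {f : α → ℝ} (hf : Integrable f m) (hf0 : ∀ x, 0 ≤ f x)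
    {B : Set α} (hB : MeasurableSet B) :
    (m.withDensity fun x => ENNReal.ofReal (f x)).real B = ∫ x in B, f x ∂m := by
  rw [measureReal_def, withDensity_apply _ hB,
    integral_eq_lintegral_of_nonneg_ae (ae_of_all _ hf0) hf.1.restrict]

/-- **Scheffé's lemma**: pointwise convergence of probability densities implies convergence in
total variation of the corresponding laws. -/
theorem TVTendsto.of_density {μ : ℕ → Measure α} {ν : Measure α} {f : ℕ → α → ℝ} {g : α → ℝ}
    [∀ n, IsProbabilityMeasure (μ n)] [IsProbabilityMeasure ν]
    (hf : ∀ n, Measurable (f n)) (hf0 : ∀ n x, 0 ≤ f n x)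
    (hg : Measurable g) (hg0 : ∀ x, 0 ≤ g x)
    (hμ : ∀ᶠ n in atTop, μ n = m.withDensity fun x => ENNReal.ofReal (f n x))
    (hν : ν = m.withDensity fun x => ENNReal.ofReal (g x))
    (hlim : ∀ x, Tendsto (fun n => f n x) atTop (𝓝 (g x))) : TVTendsto μ ν := by
  have hgi : Integrable g m := by
    have : IsFiniteMeasure (m.withDensity fun x => ENNReal.ofReal (g x)) := hν ▸ inferInstance
    exact integrable_of_withDensity_ofReal hg hg0
  -- the positive part of `g - f n` is dominated by `g`
  have hD : Tendsto (fun n => ∫ x, max (g x - f n x) 0 ∂m) atTop (𝓝 0) := by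
    have := tendsto_integral_of_dominated_convergence (μ := m)
      (F := fun n x => max (g x - f n x) 0) (f := fun _ => 0) g
      (fun n => ((hg.sub (hf n)).max measurable_const).aestronglyMeasurable) hgi
      (fun n => ae_of_all _ fun x => by
        rw [Real.norm_of_nonneg (le_max_right _ _)]
        exact max_le (by linarith [hf0 n x]) (hg0 x))
      (ae_of_all _ fun x => by
        have := ((tendsto_const_nhds (x := g x)).sub (hlim x)).max (tendsto_const_nhds (x := 0))
        simpa using this)
    simpa using this
  intro ε hε
  filter_upwards [hμ, hD.eventually (gt_mem_nhds hε)] with n hn hDn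
  have hfi : Integrable (f n) m := by
    have : IsFiniteMeasure (m.withDensity fun x => ENNReal.ofReal (f n x)) := hn ▸ inferInstance
    exact integrable_of_withDensity_ofReal (hf n) (hf0 n)
  have hmax : Integrable (fun x => max (g x - f n x) 0) m := (hgi.sub hfi).pos_part
  have key : ∀ B, MeasurableSet B → ν.real B - (μ n).real B ≤ ε := by
    intro B hB
    rw [hν, hn, real_withDensity_ofReal hgi hg0 hB, real_withDensity_ofReal hfi (hf0 n) hB,
      ← integral_sub hgi.integrableOn hfi.integrableOn]
    calc ∫ x in B, (g x - f n x) ∂m ≤ ∫ x in B, max (g x - f n x) 0 ∂m :=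
          integral_mono (hgi.sub hfi).integrableOn hmax.integrableOn fun x => le_max_left _ _
      _ ≤ ∫ x, max (g x - f n x) 0 ∂m :=
          setIntegral_le_integral hmax (ae_of_all _ fun x => le_max_right _ _)
      _ ≤ ε := hDn.le
  intro B hB
  have h1 := key B hB
  have h2 := key Bᶜ hB.compl
  rw [probReal_compl_eq_one_sub hB, probReal_compl_eq_one_sub hB] at h2
  rw [abs_le]
  constructor <;> linarith

end Scheffe

/-! ### Centered Gaussian laws on `ℝ^ι` -/

section Gaussian

variable {ι κ : Type*} [Fintype ι] [DecidableEq ι] [Fintype κ] [DecidableEq κ]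

omit [DecidableEq ι] [DecidableEq κ] in
theorem measurable_mulVec (M : Matrix κ ι ℝ) : Measurable fun x : ι → ℝ => M *ᵥ x :=
  (continuous_const.matrix_mulVec continuous_id).measurable

/-- The centered Gaussian law on `ι → ℝ` with covariance matrix `S`, which is meaningful only for
positive semidefinite `S`. -/
noncomputable def gaussLaw (S : Matrix ι ι ℝ) : Measure (ι → ℝ) :=
  (multivariateGaussian 0 S).map WithLp.ofLp

instance (S : Matrix ι ι ℝ) : IsGaussian (gaussLaw S) := by
  have : gaussLaw S = (multivariateGaussian 0 S).map
      (EuclideanSpace.equiv ι ℝ : EuclideanSpace ℝ ι →L[ℝ] (ι → ℝ)) := rfl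
  rw [this]
  infer_instance

theorem gaussLaw_map_mulVec {S : Matrix ι ι ℝ} (hS : S.PosSemidef) (M : Matrix κ ι ℝ) :
    (gaussLaw S).map (fun x => M *ᵥ x) = gaussLaw (M * S * Mᵀ) := by
  have hM : (M * S * Mᵀ).PosSemidef := by
    have := hS.mul_mul_conjTranspose_same M
    rwa [conjTranspose_eq_transpose_of_trivial] at this
  let L : EuclideanSpace ℝ ι →L[ℝ] EuclideanSpace ℝ κ :=
    (Matrix.toLpLin 2 2 M).toContinuousLinearMap
  have key : (multivariateGaussian 0 S).map L = multivariateGaussian 0 (M * S * Mᵀ) := by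
    apply Measure.ext_of_charFun
    ext t
    rw [charFun_multivariateGaussian hM, charFun_apply, integral_map (by fun_prop) (by fun_prop)]
    have : ∀ x : EuclideanSpace ℝ ι,
        inner ℝ (L x) t = inner ℝ x (WithLp.toLp 2 (Mᵀ *ᵥ WithLp.ofLp t)) := by
      intro x
      simp only [L, LinearMap.coe_toContinuousLinearMap', EuclideanSpace.inner_eq_star_dotProduct,
        star_trivial, Matrix.toLpLin_apply]
      rw [Matrix.dotProduct_mulVec, Matrix.mulVec_transpose]
    simp_rw [this]
    rw [← charFun_apply, charFun_multivariateGaussian hS]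
    simp only [inner_zero_right]
    congr 3
    norm_cast
    simp only [Matrix.mul_assoc, ← Matrix.mulVec_mulVec]
    rw [Matrix.dotProduct_mulVec _ M, Matrix.mulVec_transpose]
  rw [gaussLaw, gaussLaw, ← key, Measure.map_map (by fun_prop) (by fun_prop),
    Measure.map_map (by fun_prop) (by fun_prop)]
  rfl

theorem covariance_gaussLaw {S : Matrix ι ι ℝ} (hS : S.PosSemidef) (a b : ι → ℝ) :
    cov[fun x => a ⬝ᵥ x, fun x => b ⬝ᵥ x; gaussLaw S] = a ⬝ᵥ S *ᵥ b := by
  have := covarianceBilin_multivariateGaussian (μ := 0) hS (WithLp.toLp 2 a) (WithLp.toLp 2 b)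
  rw [covarianceBilin_apply_eq_cov IsGaussian.memLp_two_id] at this
  simp only [EuclideanSpace.inner_eq_star_dotProduct, star_trivial] at this
  rw [gaussLaw, covariance_map (by fun_prop) (by fun_prop) (by fun_prop), ← this]
  simp only [Function.comp_def, dotProduct_comm]

theorem gaussLaw_map_dotProduct {S : Matrix ι ι ℝ} (hS : S.PosSemidef) (a : ι → ℝ) :
    (gaussLaw S).map (fun x => a ⬝ᵥ x) = gaussianReal 0 (a ⬝ᵥ S *ᵥ a).toNNReal := by
  have h0 : 0 ≤ a ⬝ᵥ S *ᵥ a := by simpa using hS.dotProduct_mulVec_nonneg a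
  rw [gaussLaw, Measure.map_map (by fun_prop) (by fun_prop)]
  apply Measure.ext_of_charFun
  ext t
  rw [charFun_gaussianReal, charFun_apply, integral_map (by fun_prop) (by fun_prop)]
  have : ∀ x : EuclideanSpace ℝ ι, inner ℝ (((fun x => a ⬝ᵥ x) ∘ WithLp.ofLp) x) t =
      inner ℝ x (WithLp.toLp 2 (t • a)) := by
    intro x
    simp [EuclideanSpace.inner_eq_star_dotProduct]
  simp_rw [this]
  rw [← charFun_apply, charFun_multivariateGaussian hS]
  simp only [inner_zero_right]
  rw [Real.coe_toNNReal _ h0]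
  congr 1
  simp [Matrix.mulVec_smul]
  ring

theorem pi_gaussianReal_eq_gaussLaw (s : ℝ) :
    Measure.pi (fun _ : ι => gaussianReal 0 (s ^ 2).toNNReal) =
      gaussLaw (s ^ 2 • (1 : Matrix ι ι ℝ)) := by
  have hS : (s ^ 2 • (1 : Matrix ι ι ℝ)).PosSemidef := PosSemidef.one.smul (sq_nonneg s)
  have key : (Measure.pi (fun _ : ι => gaussianReal 0 (s ^ 2).toNNReal)).map (WithLp.toLp 2) =
      multivariateGaussian 0 (s ^ 2 • (1 : Matrix ι ι ℝ)) := by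
    apply Measure.ext_of_charFun
    ext t
    rw [charFun_multivariateGaussian hS, charFun_pi]
    simp_rw [charFun_gaussianReal, ← Complex.exp_sum, Real.coe_toNNReal _ (sq_nonneg s)]
    congr 1
    simp [Matrix.smul_mulVec, dotProduct, Finset.sum_div, Finset.sum_neg_distrib]
    refine Finset.sum_congr rfl fun i _ => by ring
  rw [gaussLaw, ← key, Measure.map_map (by fun_prop) (by fun_prop)]
  exact Measure.map_id.symm

omit [DecidableEq κ] in
/-- For jointly Gaussian linear forms, independence follows from zero covariance. -/
theorem indepFun_gaussLaw {S : Matrix ι ι ℝ} (hS : S.PosSemidef) (a : ι → ℝ) (M : Matrix κ ι ℝ)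
    (h : M *ᵥ (S *ᵥ a) = 0) : IndepFun (fun x => a ⬝ᵥ x) (fun x => M *ᵥ x) (gaussLaw S) := by
  have hL : HasGaussianLaw (fun x : ι → ℝ => (fun _ : Unit => a ⬝ᵥ x, fun j => (M *ᵥ x) j))
      (gaussLaw S) := by
    let L : (ι → ℝ) →ₗ[ℝ] (Unit → ℝ) × (κ → ℝ) :=
      LinearMap.prod (LinearMap.pi fun _ => dotProductBilin ℝ ℝ a) (Matrix.mulVecLin M)
    exact (IsGaussian.hasGaussianLaw_id (μ := gaussLaw S)).map L.toContinuousLinearMap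
  have hI := hL.indepFun_of_covariance_eval (X := fun _ x => a ⬝ᵥ x) (Y := fun j x => (M *ᵥ x) j)
    fun i j => by
      have := covariance_gaussLaw hS a (M j)
      rw [covariance_comm] at this
      have h2 := covariance_gaussLaw hS (M j) a
      rw [covariance_comm] at h2
      exact h2.trans (congrFun h j)
  exact hI.comp (φ := fun f : Unit → ℝ => f ()) (ψ := id) (by fun_prop) measurable_id

/-! ### Densities of Gaussian laws -/

omit [DecidableEq ι] in
theorem pi_gaussianReal_one_eq_withDensity :
    Measure.pi (fun _ : ι => gaussianReal 0 1) =
      volume.withDensity fun x : ι → ℝ => ENNReal.ofReal (∏ i, gaussianPDFReal 0 1 (x i)) := by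
  have hint : Integrable (fun x : ι → ℝ => ∏ i, gaussianPDFReal 0 1 (x i)) :=
    Integrable.fintype_prod (f := fun _ : ι => gaussianPDFReal 0 1)
      fun _ => integrable_gaussianPDFReal 0 1
  refine Measure.pi_eq fun s hs => ?_
  rw [withDensity_apply _ (MeasurableSet.univ_pi hs), volume_pi, Measure.restrict_pi_pi]
  rw [← ofReal_integral_eq_lintegral_ofReal]
  · rw [integral_fintype_prod_eq_prod (f := fun _ : ι => gaussianPDFReal 0 1),
      ENNReal.ofReal_prod_of_nonneg]
    · refine Finset.prod_congr rfl fun i _ => ?_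
      rw [gaussianReal_apply_eq_integral _ one_ne_zero]
    · exact fun i _ => integral_nonneg fun x => gaussianPDFReal_nonneg _ _ _
  · rw [← Measure.restrict_pi_pi]
    exact hint.restrict
  · exact ae_of_all _ fun x => Finset.prod_nonneg fun i _ => gaussianPDFReal_nonneg _ _ _

/-- The density of the Gaussian law on `ι → ℝ` with mean `w` and covariance matrix `S`. -/
noncomputable def gaussDensity (S : Matrix ι ι ℝ) (w x : ι → ℝ) : ℝ :=
  ((√(2 * Real.pi))⁻¹) ^ Fintype.card ι * (√S.det)⁻¹ * Real.exp (-((x - w) ⬝ᵥ S⁻¹ *ᵥ (x - w)) / 2)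

theorem gaussDensity_nonneg (S : Matrix ι ι ℝ) (w x : ι → ℝ) : 0 ≤ gaussDensity S w x := by
  unfold gaussDensity; positivity

theorem measurable_gaussDensity (S : Matrix ι ι ℝ) (w : ι → ℝ) : Measurable (gaussDensity S w) := by
  unfold gaussDensity
  refine Continuous.measurable ?_
  have : Continuous fun x : ι → ℝ => (x - w) ⬝ᵥ S⁻¹ *ᵥ (x - w) :=
    (by fun_prop : Continuous fun x : ι → ℝ => x - w).dotProduct
      (continuous_const.matrix_mulVec (by fun_prop))
  fun_prop

theorem map_pi_gaussianReal_affine {R : Matrix ι ι ℝ} (hR : R.det ≠ 0) (w : ι → ℝ) :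
    (Measure.pi (fun _ : ι => gaussianReal 0 1)).map (fun x => R *ᵥ x + w) =
      volume.withDensity fun x => ENNReal.ofReal (gaussDensity (R * Rᵀ) w x) := by
  have hRu : IsUnit R.det := isUnit_iff_ne_zero.2 hR
  have hm : Measurable fun x : ι → ℝ => R *ᵥ x + w :=
    ((continuous_const.matrix_mulVec continuous_id).add continuous_const).measurable
  -- change of variables `y = R x + w` in Lebesgue measure
  have hvol : (volume : Measure (ι → ℝ)).map (fun x => R *ᵥ x + w) =
      ENNReal.ofReal |R.det⁻¹| • volume := by
    have h1 : (volume : Measure (ι → ℝ)).map (fun x => R *ᵥ x) =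
        ENNReal.ofReal |R.det⁻¹| • volume := by
      have := Real.map_matrix_volume_pi_eq_smul_volume_pi hR
      rwa [show (⇑(toLin' R) : (ι → ℝ) → ι → ℝ) = fun x => R *ᵥ x from rfl] at this
    rw [show (fun x : ι → ℝ => R *ᵥ x + w) = (fun x => x + w) ∘ fun x => R *ᵥ x from rfl,
      ← Measure.map_map (by fun_prop)
        (measurable_mulVec _), h1, Measure.map_smul,
      map_add_right_eq_self]
  have hdens : ∀ x : ι → ℝ, ∏ i, gaussianPDFReal 0 1 (x i) =
      |R.det| * gaussDensity (R * Rᵀ) w (R *ᵥ x + w) := by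
    intro x
    have h1 : √(R * Rᵀ).det = |R.det| := by
      rw [det_mul, det_transpose, Real.sqrt_mul_self_eq_abs]
    have h2 : (R *ᵥ x) ⬝ᵥ (R * Rᵀ)⁻¹ *ᵥ (R *ᵥ x) = x ⬝ᵥ x := by
      rw [Matrix.mul_inv_rev, ← Matrix.mulVec_mulVec, Matrix.mulVec_mulVec _ R⁻¹ R,
        Matrix.nonsing_inv_mul _ hRu, Matrix.one_mulVec, Matrix.dotProduct_mulVec,
        ← Matrix.transpose_nonsing_inv, Matrix.vecMul_transpose, Matrix.mulVec_mulVec,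
        Matrix.nonsing_inv_mul _ hRu, Matrix.one_mulVec]
    rw [gaussDensity, h1, add_sub_cancel_right, h2]
    simp only [gaussianPDFReal, Finset.prod_mul_distrib, ← Real.exp_sum, NNReal.coe_one, mul_one,
      sub_zero, Finset.prod_const, Finset.card_univ, dotProduct]
    have : |R.det| ≠ 0 := abs_ne_zero.2 hR
    rw [← Finset.sum_div, Finset.sum_neg_distrib]
    simp only [← pow_two]
    field_simp
  ext B hB
  rw [Measure.map_apply hm hB, pi_gaussianReal_one_eq_withDensity, withDensity_apply _ (hm hB),
    withDensity_apply _ hB, ← lintegral_indicator (hm hB), ← lintegral_indicator hB]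
  have hvol' : (volume : Measure (ι → ℝ)) =
      ENNReal.ofReal |R.det| • (volume : Measure (ι → ℝ)).map (fun x => R *ᵥ x + w) := by
    rw [hvol, smul_smul, ← ENNReal.ofReal_mul (abs_nonneg _), ← abs_mul, mul_inv_cancel₀ hR]
    simp
  conv_rhs => rw [hvol', lintegral_smul_measure]
  rw [lintegral_map (((measurable_gaussDensity _ _).ennreal_ofReal).indicator hB) hm, smul_eq_mul,
    ← lintegral_const_mul' _ _ ENNReal.ofReal_ne_top]
  refine lintegral_congr fun x => ?_
  by_cases hx : R *ᵥ x + w ∈ B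
  · rw [Set.indicator_of_mem hx, Set.indicator_of_mem (show x ∈ _ from hx), hdens,
      ENNReal.ofReal_mul (abs_nonneg _)]
  · rw [Set.indicator_of_notMem hx, Set.indicator_of_notMem (show x ∉ _ from hx), mul_zero]

/-- The density of a nondegenerate Gaussian law, from that of the standard Gaussian law by a square
root `S = R R'` of the covariance matrix. -/
theorem gaussLaw_map_add_eq_withDensity {S : Matrix ι ι ℝ} (hS : S.PosDef) (w : ι → ℝ) :
    (gaussLaw S).map (fun x => x + w) =
      volume.withDensity fun x => ENNReal.ofReal (gaussDensity S w x) := by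
  obtain ⟨R, hR⟩ : ∃ R : Matrix ι ι ℝ, S = R * Rᵀ := by
    open scoped MatrixOrder in
    obtain ⟨B, hB⟩ := CStarAlgebra.nonneg_iff_eq_star_mul_self.1 hS.posSemidef.nonneg
    refine ⟨Bᵀ, ?_⟩
    rw [hB, transpose_transpose, star_eq_conjTranspose, conjTranspose_eq_transpose_of_trivial]
  have hdet : R.det ≠ 0 := by
    intro h
    have := hS.det_pos
    rw [hR, det_mul, h, zero_mul] at this
    exact lt_irrefl _ this
  have h1 : gaussLaw (1 : Matrix ι ι ℝ) = Measure.pi (fun _ : ι => gaussianReal 0 1) := by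
    have := pi_gaussianReal_eq_gaussLaw (ι := ι) 1
    simpa using this.symm
  have h2 := gaussLaw_map_mulVec (PosSemidef.one (n := ι) (R := ℝ)) R
  rw [Matrix.mul_one, ← hR] at h2
  rw [← h2, Measure.map_map (by fun_prop) (measurable_mulVec _),
    h1, hR, ← map_pi_gaussianReal_affine hdet]
  rfl

omit [DecidableEq ι] [Fintype κ] [DecidableEq κ] in
theorem tendsto_mulVec {β : Type*} {l : Filter β} {M : β → Matrix κ ι ℝ} {M₀ : Matrix κ ι ℝ}
    (hM : Tendsto M l (𝓝 M₀)) {x : β → ι → ℝ} {x₀ : ι → ℝ} (hx : Tendsto x l (𝓝 x₀)) :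
    Tendsto (fun b => M b *ᵥ x b) l (𝓝 (M₀ *ᵥ x₀)) := by
  have hc : Continuous fun p : Matrix κ ι ℝ × (ι → ℝ) => p.1 *ᵥ p.2 :=
    continuous_fst.matrix_mulVec continuous_snd
  exact (hc.tendsto (M₀, x₀)).comp (hM.prodMk_nhds hx)

theorem tendsto_matrix_det {β : Type*} {l : Filter β} {M : β → Matrix ι ι ℝ} {M₀ : Matrix ι ι ℝ}
    (hM : Tendsto M l (𝓝 M₀)) : Tendsto (fun b => (M b).det) l (𝓝 M₀.det) := by
  have hc : Continuous fun M : Matrix ι ι ℝ => M.det := continuous_id.matrix_det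
  exact (hc.tendsto M₀).comp hM

theorem tendsto_matrix_inv {β : Type*} {l : Filter β} {M : β → Matrix ι ι ℝ} {M₀ : Matrix ι ι ℝ}
    (hM : Tendsto M l (𝓝 M₀)) (h₀ : M₀.det ≠ 0) : Tendsto (fun b => (M b)⁻¹) l (𝓝 M₀⁻¹) := by
  have hc : ContinuousAt (Inv.inv : Matrix ι ι ℝ → Matrix ι ι ℝ) M₀ :=
    continuousAt_matrix_inv M₀ (by
      rw [Ring.inverse_eq_inv']
      exact continuousAt_inv₀ h₀)
  exact Tendsto.comp hc hM

/-- Gaussian laws converge in total variation when their means and covariance matrices converge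
and the limiting covariance matrix is positive definite. -/
theorem tvTendsto_gaussLaw {S : ℕ → Matrix ι ι ℝ} {S₀ : Matrix ι ι ℝ} (hS₀ : S₀.PosDef)
    (hS : ∀ᶠ n in atTop, (S n).PosDef) (hlim : Tendsto S atTop (𝓝 S₀))
    {w : ℕ → ι → ℝ} {w₀ : ι → ℝ} (hw : Tendsto w atTop (𝓝 w₀)) :
    TVTendsto (fun n => (gaussLaw (S n)).map (fun x => x + w n))
      ((gaussLaw S₀).map (fun x => x + w₀)) := by
  have : ∀ n, IsProbabilityMeasure ((gaussLaw (S n)).map (fun x => x + w n)) := fun n =>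
    Measure.isProbabilityMeasure_map (by fun_prop)
  have : IsProbabilityMeasure ((gaussLaw S₀).map (fun x => x + w₀)) :=
    Measure.isProbabilityMeasure_map (by fun_prop)
  refine TVTendsto.of_density (m := volume) (f := fun n => gaussDensity (S n) (w n))
    (g := gaussDensity S₀ w₀)
    (fun n => measurable_gaussDensity _ _) (fun n => gaussDensity_nonneg _ _)
    (measurable_gaussDensity _ _) (gaussDensity_nonneg _ _)
    (hS.mono fun n hn => gaussLaw_map_add_eq_withDensity hn _)
    (gaussLaw_map_add_eq_withDensity hS₀ _) fun x => ?_
  have hdet := tendsto_matrix_det hlim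
  have hinv := tendsto_matrix_inv hlim hS₀.det_pos.ne'
  have hx : Tendsto (fun n => x - w n) atTop (𝓝 (x - w₀)) := tendsto_const_nhds.sub hw
  have hq : Tendsto (fun n => (x - w n) ⬝ᵥ (S n)⁻¹ *ᵥ (x - w n)) atTop
      (𝓝 ((x - w₀) ⬝ᵥ S₀⁻¹ *ᵥ (x - w₀))) := by
    have h := tendsto_mulVec hinv hx
    rw [tendsto_pi_nhds] at hx h
    exact tendsto_finsetSum _ fun i _ => (hx i).mul (h i)
  have h1 : Tendsto (fun n => (√(S n).det)⁻¹) atTop (𝓝 (√S₀.det)⁻¹) :=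
    (hdet.sqrt).inv₀ (Real.sqrt_pos.2 hS₀.det_pos).ne'
  have h2 := (Real.continuous_exp.tendsto _).comp (hq.neg.div_const 2)
  exact (tendsto_const_nhds.mul h1).mul h2

end Gaussian

/-! ### Blocks as matrix products, and the least-squares matrices -/

section Algebra

variable {P k : ℕ} {m : Type*}

/-- The matrix embedding the first `p` coordinates into `ℝ^P`. -/
def headIncl (P p : ℕ) : Matrix (Fin P) {j : Fin P // (j : ℕ) < p} ℝ := headCols 1 p

/-- The matrix embedding the last `P - p` coordinates into `ℝ^P`. -/
def tailIncl (P p : ℕ) : Matrix (Fin P) {j : Fin P // ¬ (j : ℕ) < p} ℝ := tailCols 1 p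

theorem headCols_eq (D : Matrix m (Fin P) ℝ) (p : ℕ) : headCols D p = D * headIncl P p := by
  ext i j
  simp [headCols, headIncl, Matrix.mul_apply, Matrix.one_apply]

theorem tailCols_eq (D : Matrix m (Fin P) ℝ) (p : ℕ) : tailCols D p = D * tailIncl P p := by
  ext i j
  simp [tailCols, tailIncl, Matrix.mul_apply, Matrix.one_apply]

theorem headVec_eq (x : Fin P → ℝ) (p : ℕ) : headVec x p = (headIncl P p)ᵀ *ᵥ x := by
  ext j
  simp [headVec, headIncl, headCols, Matrix.mulVec, dotProduct, Matrix.one_apply]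

theorem blockHH_eq (M : Matrix (Fin P) (Fin P) ℝ) (p : ℕ) :
    blockHH M p = (headIncl P p)ᵀ * M * headIncl P p := by
  ext i j
  simp [blockHH, headIncl, headCols, Matrix.mul_apply, Matrix.one_apply]

theorem blockHT_eq (M : Matrix (Fin P) (Fin P) ℝ) (p : ℕ) :
    blockHT M p = (headIncl P p)ᵀ * M * tailIncl P p := by
  ext i j
  simp [blockHT, headIncl, tailIncl, headCols, tailCols, Matrix.mul_apply, Matrix.one_apply]

theorem headIncl_mulVec_apply (p : ℕ) (u : {j : Fin P // (j : ℕ) < p} → ℝ) (i : Fin P) :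
    (headIncl P p *ᵥ u) i = if h : (i : ℕ) < p then u ⟨i, h⟩ else 0 := by
  have : ∀ j : {j : Fin P // (j : ℕ) < p}, headIncl P p i j * u j =
      if h : (i : ℕ) < p then (if j = ⟨i, h⟩ then u j else 0) else 0 := by
    intro j
    by_cases h : (i : ℕ) < p
    · simp only [h, dite_true, headIncl, headCols, submatrix_apply, id, Matrix.one_apply]
      by_cases hij : i = j.1
      · simp [hij]
      · have : j ≠ ⟨i, h⟩ := fun h' => hij (by rw [h'])
        simp [hij, this]
    · have : i ≠ j.1 := fun h' => h (h' ▸ j.2)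
      simp [h, headIncl, headCols, this]
  simp only [Matrix.mulVec, dotProduct, this]
  by_cases h : (i : ℕ) < p <;> simp [h]

theorem tailIncl_mulVec_apply (p : ℕ) (u : {j : Fin P // ¬ (j : ℕ) < p} → ℝ) (i : Fin P) :
    (tailIncl P p *ᵥ u) i = if h : (i : ℕ) < p then 0 else u ⟨i, h⟩ := by
  have : ∀ j : {j : Fin P // ¬ (j : ℕ) < p}, tailIncl P p i j * u j =
      if h : (i : ℕ) < p then 0 else (if j = ⟨i, h⟩ then u j else 0) := by
    intro j
    by_cases h : (i : ℕ) < p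
    · have : i ≠ j.1 := fun h' => j.2 (h' ▸ h)
      simp [h, tailIncl, tailCols, this]
    · simp only [h, dite_false, tailIncl, tailCols, submatrix_apply, id, Matrix.one_apply]
      by_cases hij : i = j.1
      · simp [hij]
      · have : j ≠ ⟨i, h⟩ := fun h' => hij (by rw [h'])
        simp [hij, this]
  simp only [Matrix.mulVec, dotProduct, this]
  by_cases h : (i : ℕ) < p <;> simp [h]

theorem stack_eq (p : ℕ) (u : {j : Fin P // (j : ℕ) < p} → ℝ)
    (v : {j : Fin P // ¬ (j : ℕ) < p} → ℝ) :
    stack p u v = headIncl P p *ᵥ u + tailIncl P p *ᵥ v := by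
  ext i
  simp only [stack, Pi.add_apply, headIncl_mulVec_apply, tailIncl_mulVec_apply]
  by_cases h : (i : ℕ) < p <;> simp [h]

theorem head_add_tail (p : ℕ) (x : Fin P → ℝ) :
    headIncl P p *ᵥ headVec x p + tailIncl P p *ᵥ tailVec x p = x := by
  rw [← stack_eq]
  ext i
  simp [stack, headVec, tailVec]

theorem headIncl_transpose_mul_self (p : ℕ) : (headIncl P p)ᵀ * headIncl P p = 1 := by
  ext i j
  simp [headIncl, headCols, Matrix.mul_apply, Matrix.one_apply, Subtype.ext_iff]

/-- The truncation `x ↦ (x_1, …, x_p, 0, …, 0)` as a matrix. -/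
def truncMat (P p : ℕ) : Matrix (Fin P) (Fin P) ℝ := headIncl P p * (headIncl P p)ᵀ

theorem truncMat_mulVec_apply (p : ℕ) (x : Fin P → ℝ) (i : Fin P) :
    (truncMat P p *ᵥ x) i = if (i : ℕ) < p then x i else 0 := by
  rw [truncMat, ← Matrix.mulVec_mulVec, ← headVec_eq, headIncl_mulVec_apply]
  simp [headVec]

theorem truncMat_mul_truncMat {p r : ℕ} (h : p ≤ r) :
    truncMat P p * truncMat P r = truncMat P p := by
  apply Matrix.toLin'.injective
  ext x i
  simp only [LinearMap.comp_apply, Matrix.toLin'_apply]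
  rw [← Matrix.mulVec_mulVec, truncMat_mulVec_apply, truncMat_mulVec_apply, truncMat_mulVec_apply]
  split_ifs <;> first | rfl | omega

theorem headIncl_transpose_mul_truncMat {p r : ℕ} (h : p ≤ r) :
    (headIncl P p)ᵀ * truncMat P r = (headIncl P p)ᵀ := by
  have h1 : (headIncl P p)ᵀ = (headIncl P p)ᵀ * truncMat P p := by
    rw [truncMat, ← Matrix.mul_assoc, headIncl_transpose_mul_self, Matrix.one_mul]
  rw [h1, Matrix.mul_assoc, truncMat_mul_truncMat h]

/-- The matrix `E_p M[p:p]⁻¹ E_p'` on `ℝ^P`, where `E_p` embeds the first `p` coordinates: it maps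
the score to the restricted least-squares estimator. -/
noncomputable def lsMat (M : Matrix (Fin P) (Fin P) ℝ) (p : ℕ) : Matrix (Fin P) (Fin P) ℝ :=
  headIncl P p * (blockHH M p)⁻¹ * (headIncl P p)ᵀ

theorem posDef_blockHH {M : Matrix (Fin P) (Fin P) ℝ} (hM : M.PosDef) (p : ℕ) :
    (blockHH M p).PosDef :=
  hM.submatrix Subtype.val_injective

theorem isUnit_det_blockHH {M : Matrix (Fin P) (Fin P) ℝ} (hM : M.PosDef) (p : ℕ) :
    IsUnit (blockHH M p).det :=
  isUnit_iff_ne_zero.2 (posDef_blockHH hM p).det_pos.ne'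

theorem lsMat_transpose {M : Matrix (Fin P) (Fin P) ℝ} (hM : M.PosDef) (p : ℕ) :
    (lsMat M p)ᵀ = lsMat M p := by
  have h : ((blockHH M p)⁻¹)ᵀ = (blockHH M p)⁻¹ := by
    have := (posDef_blockHH hM p).inv.isHermitian
    rwa [IsHermitian, conjTranspose_eq_transpose_of_trivial] at this
  rw [lsMat, transpose_mul, transpose_mul, transpose_transpose, h, Matrix.mul_assoc]

theorem truncMat_mul_mul_lsMat {M : Matrix (Fin P) (Fin P) ℝ} (hM : M.PosDef) (p : ℕ) :
    truncMat P p * M * lsMat M p = truncMat P p := by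
  calc truncMat P p * M * lsMat M p
      = headIncl P p * (((headIncl P p)ᵀ * M * headIncl P p) * (blockHH M p)⁻¹) *
          (headIncl P p)ᵀ := by simp only [truncMat, lsMat, Matrix.mul_assoc]
    _ = truncMat P p := by
        rw [← blockHH_eq, Matrix.mul_nonsing_inv _ (isUnit_det_blockHH hM p), Matrix.mul_one,
          truncMat]

theorem lsMat_mul_truncMat (M : Matrix (Fin P) (Fin P) ℝ) {p r : ℕ} (h : p ≤ r) :
    lsMat M p * truncMat P r = lsMat M p := by
  rw [lsMat, Matrix.mul_assoc, headIncl_transpose_mul_truncMat h]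

/-- If the score has covariance matrix `M`, then the estimate `K_p S` has covariance matrix
`K_p = lsMat M p`. -/
theorem lsMat_mul_mul_lsMat {M : Matrix (Fin P) (Fin P) ℝ} (hM : M.PosDef) (p : ℕ) :
    lsMat M p * M * lsMat M p = lsMat M p := by
  nth_rewrite 1 [← lsMat_mul_truncMat M le_rfl]
  rw [Matrix.mul_assoc, Matrix.mul_assoc, ← Matrix.mul_assoc _ M, truncMat_mul_mul_lsMat hM,
    lsMat_mul_truncMat M le_rfl]

theorem lsMat_mul_mul_headIncl {M : Matrix (Fin P) (Fin P) ℝ} (hM : M.PosDef) (p : ℕ) :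
    lsMat M p * M * headIncl P p = headIncl P p := by
  calc lsMat M p * M * headIncl P p
      = headIncl P p * ((blockHH M p)⁻¹ * ((headIncl P p)ᵀ * M * headIncl P p)) := by
        simp only [lsMat, Matrix.mul_assoc]
    _ = headIncl P p := by
        rw [← blockHH_eq, Matrix.nonsing_inv_mul _ (isUnit_det_blockHH hM p), Matrix.mul_one]

theorem truncMat_top : truncMat P P = 1 := by
  apply Matrix.toLin'.injective
  ext x i
  simp only [LinearMap.comp_apply, Matrix.toLin'_apply, truncMat_mulVec_apply, i.2, if_true,
    Matrix.one_mulVec]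

theorem lsMat_top {M : Matrix (Fin P) (Fin P) ℝ} (hM : M.PosDef) : lsMat M P = M⁻¹ := by
  have h := truncMat_mul_mul_lsMat hM P
  rw [truncMat_top, Matrix.one_mul] at h
  exact (Matrix.inv_eq_right_inv h).symm

theorem covMat_eq (M : Matrix (Fin P) (Fin P) ℝ) (A : Matrix (Fin k) (Fin P) ℝ) (p : ℕ) :
    covMat M A p = A * lsMat M p * Aᵀ := by
  simp only [covMat, lsMat, headCols_eq, transpose_mul, Matrix.mul_assoc]

/-- The standard basis vector `e_p` of `ℝ^P`, with `p` counted from one. -/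
def basisVec (P p : ℕ) : Fin P → ℝ := fun j => if (j : ℕ) + 1 = p then 1 else 0

theorem lastBasis_eq (p : ℕ) :
    (lastBasis p : {j : Fin P // (j : ℕ) < p} → ℝ) = (headIncl P p)ᵀ *ᵥ basisVec P p := by
  rw [← headVec_eq]; rfl

theorem coord_eq (x : Fin P → ℝ) (p : ℕ) : coord x p = basisVec P p ⬝ᵥ x := by
  unfold coord basisVec
  split_ifs with h
  · rw [dotProduct, Finset.sum_eq_single ⟨p - 1, by omega⟩]
    · simp [Nat.sub_add_cancel h.1]
    · intro j _ hj
      rw [if_neg, zero_mul]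
      intro h'
      exact hj (Fin.ext (by simp; omega))
    · simp
  · symm
    refine Finset.sum_eq_zero fun j _ => ?_
    have := j.2
    have hj : ¬ (j : ℕ) + 1 = p := by omega
    simp [hj]

theorem coord_add (x y : Fin P → ℝ) (p : ℕ) : coord (x + y) p = coord x p + coord y p := by
  simp [coord_eq]

theorem coord_smul (a : ℝ) (x : Fin P → ℝ) (p : ℕ) : coord (a • x) p = a * coord x p := by
  simp [coord_eq]

theorem xiSq_eq (M : Matrix (Fin P) (Fin P) ℝ) (p : ℕ) :
    xiSq M p = basisVec P p ⬝ᵥ lsMat M p *ᵥ basisVec P p := by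
  rw [xiSq, lastBasis_eq, lsMat, ← Matrix.mulVec_mulVec, ← Matrix.mulVec_mulVec,
    Matrix.dotProduct_mulVec _ (headIncl P p), Matrix.mulVec_transpose]

theorem cInf_eq (M : Matrix (Fin P) (Fin P) ℝ) (A : Matrix (Fin k) (Fin P) ℝ) (p : ℕ) :
    cInf M A p = A *ᵥ (lsMat M p *ᵥ basisVec P p) := by
  simp only [cInf, lastBasis_eq, lsMat, headCols_eq, Matrix.mulVec_mulVec, Matrix.mul_assoc]

theorem xiSq_pos {M : Matrix (Fin P) (Fin P) ℝ} (hM : M.PosDef) {p : ℕ} (h0 : 0 < p)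
    (hp : p ≤ P) : 0 < xiSq M p := by
  have hne : (lastBasis p : {j : Fin P // (j : ℕ) < p} → ℝ) ≠ 0 := by
    intro h
    have := congrFun h ⟨⟨p - 1, by omega⟩, by simp; omega⟩
    simp [lastBasis, Nat.sub_add_cancel h0] at this
  simpa [xiSq] using (posDef_blockHH hM p).inv.dotProduct_mulVec_pos hne

theorem xi_pos {M : Matrix (Fin P) (Fin P) ℝ} (hM : M.PosDef) {p : ℕ} (h0 : 0 < p)
    (hp : p ≤ P) : 0 < xi M p := Real.sqrt_pos.2 (xiSq_pos hM h0 hp)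

/-- `e_q' K_q` is uncorrelated, under covariance `M`, with every coordinate below `q`. -/
theorem truncMat_mulVec_mulVec_lsMat_basisVec {M : Matrix (Fin P) (Fin P) ℝ} (hM : M.PosDef)
    {r q : ℕ} (h : r < q) : truncMat P r *ᵥ (M *ᵥ (lsMat M q *ᵥ basisVec P q)) = 0 := by
  have h1 : truncMat P r * M * lsMat M q = truncMat P r := by
    rw [← truncMat_mul_truncMat h.le, Matrix.mul_assoc, Matrix.mul_assoc, ← Matrix.mul_assoc _ M,
      truncMat_mul_mul_lsMat hM]
  rw [Matrix.mulVec_mulVec, Matrix.mulVec_mulVec, h1]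
  ext i
  rw [truncMat_mulVec_apply]
  simp only [basisVec, Pi.zero_apply]
  split_ifs <;> first | rfl | omega

/-! ### Biases -/

/-- The scaled bias of the restricted estimator of order `p`, for the Gram matrix `M` and the
scaled parameter `x = √n θ`. It depends on `x` only through the coordinates beyond `p`. -/
noncomputable def biasVec (M : Matrix (Fin P) (Fin P) ℝ) (p : ℕ) (x : Fin P → ℝ) : Fin P → ℝ :=
  stack p (((blockHH M p)⁻¹ * blockHT M p) *ᵥ tailVec x p) (-tailVec x p)

theorem biasVec_eq {M : Matrix (Fin P) (Fin P) ℝ} (hM : M.PosDef) (p : ℕ) (x : Fin P → ℝ) :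
    biasVec M p x = lsMat M p *ᵥ (M *ᵥ x) - x := by
  have h1 : lsMat M p *ᵥ (M *ᵥ x) = headIncl P p *ᵥ headVec x p +
      headIncl P p *ᵥ (((blockHH M p)⁻¹ * blockHT M p) *ᵥ tailVec x p) := by
    conv_lhs => rw [← head_add_tail p x]
    rw [Matrix.mulVec_add, Matrix.mulVec_add, Matrix.mulVec_mulVec, Matrix.mulVec_mulVec,
      lsMat_mul_mul_headIncl hM]
    congr 1
    simp only [lsMat, blockHT_eq, Matrix.mulVec_mulVec, Matrix.mul_assoc]
  rw [h1, biasVec, stack_eq, Matrix.mulVec_neg]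
  have h2 := head_add_tail p x
  set a := headIncl P p *ᵥ headVec x p
  set b := tailIncl P p *ᵥ tailVec x p
  rw [add_comm a, add_sub_assoc, ← h2, sub_add_cancel_left]

theorem mulVec_biasVec (A : Matrix (Fin k) (Fin P) ℝ) (M : Matrix (Fin P) (Fin P) ℝ) (p : ℕ)
    (x : Fin P → ℝ) :
    A *ᵥ biasVec M p x = headCols A p *ᵥ (((blockHH M p)⁻¹ * blockHT M p) *ᵥ tailVec x p) -
      tailCols A p *ᵥ tailVec x p := by
  rw [biasVec, stack_eq, Matrix.mulVec_neg, Matrix.mulVec_add, Matrix.mulVec_neg, headCols_eq,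
    tailCols_eq, ← Matrix.mulVec_mulVec _ A (tailIncl P p),
    ← Matrix.mulVec_mulVec _ A (headIncl P p), sub_eq_add_neg]

/-! ### The regression model in terms of the score -/

variable {n : ℕ}

theorem transpose_mul_eq_smul_gram (hn : 0 < n) (X : Matrix (Fin n) (Fin P) ℝ) :
    Xᵀ * X = (n : ℝ) • gram X := by
  have : (n : ℝ) ≠ 0 := by positivity
  rw [PostSel.gram, smul_smul, mul_inv_cancel₀ this, one_smul]

theorem inv_smul_matrix {ι : Type*} [Fintype ι] [DecidableEq ι] {a : ℝ} (ha : a ≠ 0)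
    {M : Matrix ι ι ℝ} (hM : IsUnit M.det) : (a • M)⁻¹ = a⁻¹ • M⁻¹ := by
  apply Matrix.inv_eq_left_inv
  rw [Matrix.smul_mul, Matrix.mul_smul, smul_smul, inv_mul_cancel₀ ha, one_smul,
    Matrix.nonsing_inv_mul _ hM]

theorem headCols_gram_inv (hn : 0 < n) {X : Matrix (Fin n) (Fin P) ℝ} (hX : (gram X).PosDef)
    (p : ℕ) : ((headCols X p)ᵀ * headCols X p)⁻¹ = (n : ℝ)⁻¹ • (blockHH (gram X) p)⁻¹ := by
  have h : (headCols X p)ᵀ * headCols X p = (n : ℝ) • blockHH (gram X) p := by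
    rw [headCols_eq, transpose_mul, Matrix.mul_assoc, ← Matrix.mul_assoc Xᵀ,
      transpose_mul_eq_smul_gram hn, blockHH_eq, Matrix.smul_mul, Matrix.mul_smul, Matrix.mul_assoc]
  rw [h, inv_smul_matrix (by positivity) (isUnit_det_blockHH hX p)]

theorem restrLS_eq (hn : 0 < n) {X : Matrix (Fin n) (Fin P) ℝ} (hX : (gram X).PosDef) (p : ℕ)
    (Y : Fin n → ℝ) : restrLS X p Y = (n : ℝ)⁻¹ • lsMat (gram X) p *ᵥ (Xᵀ *ᵥ Y) := by
  rw [restrLS, stack_eq, Matrix.mulVec_zero, add_zero, headCols_gram_inv hn hX, headCols_eq,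
    transpose_mul, Matrix.smul_mulVec, Matrix.mulVec_smul]
  simp only [lsMat, Matrix.mulVec_mulVec, Matrix.mul_assoc]

/-- The scaled score `n^{-1/2} X'u`. -/
noncomputable def score (X : Matrix (Fin n) (Fin P) ℝ) (u : Fin n → ℝ) : Fin P → ℝ :=
  ((√(n : ℝ))⁻¹ • Xᵀ) *ᵥ u

theorem smul_meanLS_sub (hn : 0 < n) {X : Matrix (Fin n) (Fin P) ℝ} (hX : (gram X).PosDef)
    (p : ℕ) (θ : Fin P → ℝ) :
    √(n : ℝ) • (meanLS X p θ - θ) = biasVec (gram X) p (√(n : ℝ) • θ) := by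
  have hn' : (n : ℝ) ≠ 0 := by positivity
  have h : ((headCols X p)ᵀ * headCols X p)⁻¹ * ((headCols X p)ᵀ * tailCols X p) =
      (blockHH (gram X) p)⁻¹ * blockHT (gram X) p := by
    rw [headCols_gram_inv hn hX, headCols_eq, tailCols_eq, transpose_mul, Matrix.mul_assoc _ Xᵀ,
      ← Matrix.mul_assoc Xᵀ, transpose_mul_eq_smul_gram hn, blockHT_eq, Matrix.smul_mul,
      Matrix.smul_mul, Matrix.mul_smul, Matrix.mul_smul, smul_smul, inv_mul_cancel₀ hn', one_smul,
      Matrix.mul_assoc _ (gram X)]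
  rw [meanLS, h, biasVec]
  have h2 : tailVec (√(n : ℝ) • θ) p = √(n : ℝ) • tailVec θ p := rfl
  ext i
  rw [h2, Matrix.mulVec_smul]
  simp only [stack, Pi.smul_apply, Pi.sub_apply]
  by_cases hi : (i : ℕ) < p
  · simp [hi, headVec]
  · simp [hi, tailVec]

theorem smul_restrLS_sub (hn : 0 < n) {X : Matrix (Fin n) (Fin P) ℝ} (hX : (gram X).PosDef)
    (p : ℕ) (θ : Fin P → ℝ) (u : Fin n → ℝ) :
    √(n : ℝ) • (restrLS X p (X *ᵥ θ + u) - θ) =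
      lsMat (gram X) p *ᵥ score X u + biasVec (gram X) p (√(n : ℝ) • θ) := by
  have hn' : (n : ℝ) ≠ 0 := by positivity
  rw [restrLS_eq hn hX, biasVec_eq hX, Matrix.mulVec_add, Matrix.mulVec_mulVec _ Xᵀ X,
    transpose_mul_eq_smul_gram hn, score, Matrix.mulVec_add, smul_add, Matrix.smul_mulVec,
    Matrix.smul_mulVec, Matrix.mulVec_smul, Matrix.mulVec_smul, smul_smul, inv_mul_cancel₀ hn',
    one_smul, Matrix.mulVec_smul, Matrix.mulVec_smul, smul_sub, smul_add, smul_smul]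
  have : √(n : ℝ) * (n : ℝ)⁻¹ = (√(n : ℝ))⁻¹ := by
    rw [← div_eq_mul_inv, Real.sqrt_div_self]
  rw [this]
  abel

/-- The mean of the `q`-th test statistic before studentization, for the Gram matrix `M` and the
scaled parameter `x`. -/
noncomputable def statMean (M : Matrix (Fin P) (Fin P) ℝ) (x : Fin P → ℝ) (q : ℕ) : ℝ :=
  coord (biasVec M q x) q + coord x q

theorem testStat_eq (hn : 0 < n) {X : Matrix (Fin n) (Fin P) ℝ} (hX : (gram X).PosDef)
    (s : ℝ) (q : ℕ) (θ : Fin P → ℝ) (u : Fin n → ℝ) :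
    testStat X s q (X *ᵥ θ + u) = (coord (lsMat (gram X) q *ᵥ score X u) q +
      statMean (gram X) (√(n : ℝ) • θ) q) / (s * xi (gram X) q) := by
  have h := congrArg (fun v => coord v q) (smul_restrLS_sub hn hX q θ u)
  simp only [sub_eq_add_neg, coord_add, coord_smul] at h
  rw [← neg_one_smul ℝ θ, coord_smul] at h
  rw [testStat, statMean, coord_smul]
  congr 1
  linarith

open Classical in
/-- The model selector as a function of the score `S`, for the Gram matrix `M`, the scaled
parameter `x` and the scale `s`. -/
noncomputable def scoreSelector (c : ℕ → ℝ) (M : Matrix (Fin P) (Fin P) ℝ) (x : Fin P → ℝ)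
    (s : ℝ) (S : Fin P → ℝ) : ℕ :=
  Nat.findGreatest (fun q => c q ≤ |(coord (lsMat M q *ᵥ S) q + statMean M x q) / (s * xi M q)|) P

/-- The scaled estimation error as a function of the score, in the model of order `p`. -/
noncomputable def scoreError (A : Matrix (Fin k) (Fin P) ℝ) (M : Matrix (Fin P) (Fin P) ℝ)
    (x : Fin P → ℝ) (p : ℕ) (S : Fin P → ℝ) : Fin k → ℝ :=
  A *ᵥ (lsMat M p *ᵥ S + biasVec M p x)

theorem selector_eq (hn : 0 < n) {X : Matrix (Fin n) (Fin P) ℝ} (hX : (gram X).PosDef)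
    (c : ℕ → ℝ) (s : ℝ) (θ : Fin P → ℝ) (u : Fin n → ℝ) :
    selector X c s (X *ᵥ θ + u) =
      scoreSelector c (gram X) (√(n : ℝ) • θ) s (score X u) := by
  simp only [selector, scoreSelector, testStat_eq hn hX]

theorem smul_mulVec_restrLS_sub (hn : 0 < n) {X : Matrix (Fin n) (Fin P) ℝ}
    (hX : (gram X).PosDef) (A : Matrix (Fin k) (Fin P) ℝ) (p : ℕ) (θ : Fin P → ℝ)
    (u : Fin n → ℝ) :
    √(n : ℝ) • (A *ᵥ (restrLS X p (X *ᵥ θ + u) - θ)) =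
      scoreError A (gram X) (√(n : ℝ) • θ) p (score X u) := by
  rw [scoreError, ← smul_restrLS_sub hn hX, Matrix.mulVec_smul]

theorem map_score (X : Matrix (Fin n) (Fin P) ℝ) (s : ℝ) :
    (Measure.pi fun _ : Fin n => gaussianReal 0 (s ^ 2).toNNReal).map (score X) =
      gaussLaw (s ^ 2 • gram X) := by
  rw [pi_gaussianReal_eq_gaussLaw]
  have h := gaussLaw_map_mulVec ((PosSemidef.one (n := Fin n) (R := ℝ)).smul (sq_nonneg s))
    ((√(n : ℝ))⁻¹ • Xᵀ)
  refine h.trans ?_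
  congr 1
  have h1 : (√(n : ℝ))⁻¹ * (√(n : ℝ))⁻¹ = (n : ℝ)⁻¹ := by
    rw [← mul_inv, Real.mul_self_sqrt (Nat.cast_nonneg n)]
  simp only [PostSel.gram, transpose_smul, transpose_transpose, Matrix.mul_smul, Matrix.mul_one,
    Matrix.smul_mul, smul_smul, ← h1]
  congr 1
  ring

theorem gram_posSemidef (X : Matrix (Fin n) (Fin P) ℝ) : (gram X).PosSemidef := by
  have := (posSemidef_conjTranspose_mul_self X).smul (inv_nonneg.2 (Nat.cast_nonneg (α := ℝ) n))
  rwa [conjTranspose_eq_transpose_of_trivial] at this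

/-- The residual sum of squares in terms of the errors and the score. -/
theorem sigmaHatSq_eq (hn : 0 < n) {X : Matrix (Fin n) (Fin P) ℝ} (hX : (gram X).PosDef)
    (θ : Fin P → ℝ) (u : Fin n → ℝ) :
    sigmaHatSq X (X *ᵥ θ + u) = ((n : ℝ) - P)⁻¹ *
      (u ⬝ᵥ u - score X u ⬝ᵥ (gram X)⁻¹ *ᵥ score X u) := by
  have hs : √(n : ℝ) ≠ 0 := by positivity
  have hdet : IsUnit (gram X).det := isUnit_iff_ne_zero.2 hX.det_pos.ne'
  set g := (gram X)⁻¹ *ᵥ score X u with hg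
  -- the residual vector is `u - n^{-1/2} X (X'X/n)⁻¹ S`
  have h1 : restrLS X P (X *ᵥ θ + u) = θ + (√(n : ℝ))⁻¹ • g := by
    have h := smul_restrLS_sub hn hX P θ u
    rw [biasVec_eq hX, lsMat_top hX, Matrix.mulVec_mulVec _ (gram X)⁻¹ (gram X),
      Matrix.nonsing_inv_mul _ hdet, Matrix.one_mulVec, sub_self, add_zero, ← hg] at h
    rw [← h, smul_smul, inv_mul_cancel₀ hs, one_smul]
    abel
  have h2 : X *ᵥ θ + u - X *ᵥ restrLS X P (X *ᵥ θ + u) = u - (√(n : ℝ))⁻¹ • X *ᵥ g := by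
    rw [h1, Matrix.mulVec_add, Matrix.mulVec_smul]
    abel
  have h3 : (√(n : ℝ))⁻¹ * (u ⬝ᵥ X *ᵥ g) = score X u ⬝ᵥ g := by
    rw [score, Matrix.smul_mulVec, smul_dotProduct, smul_eq_mul, Matrix.dotProduct_mulVec,
      Matrix.mulVec_transpose]
  have h4 : (√(n : ℝ))⁻¹ * (√(n : ℝ))⁻¹ * ((X *ᵥ g) ⬝ᵥ (X *ᵥ g)) = score X u ⬝ᵥ g := by
    rw [← mul_inv, Real.mul_self_sqrt (Nat.cast_nonneg n), Matrix.dotProduct_mulVec,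
      ← Matrix.mulVec_transpose, Matrix.mulVec_mulVec, transpose_mul_eq_smul_gram hn,
      Matrix.smul_mulVec, hg, Matrix.mulVec_mulVec, Matrix.mul_nonsing_inv _ hdet,
      Matrix.one_mulVec, smul_dotProduct, smul_eq_mul, ← mul_assoc,
      inv_mul_cancel₀ (by positivity), one_mul]
  rw [sigmaHatSq, h2]
  congr 1
  rw [sub_dotProduct, dotProduct_sub, dotProduct_sub, smul_dotProduct, smul_dotProduct,
    dotProduct_smul, dotProduct_smul]
  simp only [smul_eq_mul]
  linear_combination (√(n : ℝ))⁻¹ * dotProduct_comm u (X *ᵥ g) - 2 * h3 + h4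

end Algebra

/-! ### The limit experiment and its cdf -/

section LimitLaw

variable {P k : ℕ} {Q : Matrix (Fin P) (Fin P) ℝ}

theorem mul_lsMat_mul_mul_lsMat {m : Type*} (hQ : Q.PosDef) (A : Matrix m (Fin P) ℝ) (p : ℕ) :
    A * lsMat Q p * Q * lsMat Q p = A * lsMat Q p := by
  rw [Matrix.mul_assoc, Matrix.mul_assoc, ← Matrix.mul_assoc _ Q, lsMat_mul_mul_lsMat hQ]

theorem coord_lsMat_mulVec (hQ : Q.PosDef) (q : ℕ) (S : Fin P → ℝ) :
    coord (lsMat Q q *ᵥ S) q = (lsMat Q q *ᵥ basisVec P q) ⬝ᵥ S := by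
  rw [coord_eq, Matrix.dotProduct_mulVec, ← Matrix.mulVec_transpose, lsMat_transpose hQ]

theorem basisVec_variance (hQ : Q.PosDef) (σ : ℝ) (q : ℕ) :
    (lsMat Q q *ᵥ basisVec P q) ⬝ᵥ (σ ^ 2 • Q) *ᵥ (lsMat Q q *ᵥ basisVec P q) =
      (σ * xi Q q) ^ 2 := by
  have h0 : 0 ≤ xiSq Q q := by
    simpa [xiSq] using (posDef_blockHH hQ q).inv.posSemidef.dotProduct_mulVec_nonneg
      (lastBasis q)
  rw [mul_pow, xi, Real.sq_sqrt h0, xiSq_eq, Matrix.smul_mulVec, dotProduct_smul, smul_eq_mul]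
  congr 1
  nth_rewrite 1 [← lsMat_transpose hQ]
  rw [Matrix.mulVec_transpose, ← Matrix.dotProduct_mulVec, Matrix.mulVec_mulVec,
    Matrix.mulVec_mulVec, lsMat_mul_mul_lsMat hQ]

theorem map_coord_lsMat (hQ : Q.PosDef) (σ : ℝ) (q : ℕ) :
    (gaussLaw (σ ^ 2 • Q)).map (fun S => coord (lsMat Q q *ᵥ S) q) =
      gaussianReal 0 ((σ * xi Q q) ^ 2).toNNReal := by
  simp_rw [coord_lsMat_mulVec hQ]
  rw [gaussLaw_map_dotProduct (hQ.posSemidef.smul (sq_nonneg σ)), basisVec_variance hQ]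

theorem gaussianReal_real_neg_preimage (v : NNReal) {B : Set ℝ} (hB : MeasurableSet B) :
    (gaussianReal 0 v).real {m | -m ∈ B} = (gaussianReal 0 v).real B := by
  have h := gaussianReal_map_neg (μ := 0) (v := v)
  rw [neg_zero] at h
  conv_rhs => rw [← h, map_measureReal_apply measurable_neg hB]
  rfl

theorem gaussianReal_real_abs_add_lt (s a b : ℝ) :
    (gaussianReal 0 (s ^ 2).toNNReal).real {m | |m + a| < b} = Delta s a b := by
  have hB : MeasurableSet {m : ℝ | |m - a| < b} :=
    (isOpen_lt (by fun_prop) continuous_const).measurableSet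
  rw [Delta, ← gaussianReal_real_neg_preimage _ hB]
  congr 1
  ext m
  simp only [Set.mem_ofPred_eq]
  rw [← abs_neg (-m - a)]
  congr! 2
  ring

theorem gaussianReal_real_le_abs_add (s a b : ℝ) :
    (gaussianReal 0 (s ^ 2).toNNReal).real {m | b ≤ |m + a|} = 1 - Delta s a b := by
  have hB : MeasurableSet {m : ℝ | |m + a| < b} :=
    (isOpen_lt (by fun_prop) continuous_const).measurableSet
  rw [← gaussianReal_real_abs_add_lt, ← probReal_compl_eq_one_sub hB]
  congr 1
  ext m
  simp

/-- The limiting test statistic, before studentization. -/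
noncomputable def limStat (Q : Matrix (Fin P) (Fin P) ℝ) (x : Fin P → ℝ) (q : ℕ)
    (S : Fin P → ℝ) : ℝ := coord (lsMat Q q *ᵥ S) q + statMean Q x q

theorem continuous_coord_lsMat (M : Matrix (Fin P) (Fin P) ℝ) (q : ℕ) :
    Continuous fun S : Fin P → ℝ => coord (lsMat M q *ᵥ S) q := by
  simp_rw [coord_eq]
  exact continuous_const.dotProduct (continuous_const.matrix_mulVec continuous_id)

theorem continuous_limStat (Q : Matrix (Fin P) (Fin P) ℝ) (x : Fin P → ℝ) (q : ℕ) :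
    Continuous (limStat Q x q) := (continuous_coord_lsMat Q q).add continuous_const

/-- The event that the hypotheses of orders `p + 1, …, r` are all accepted in the limit. -/
def acceptSet (Q : Matrix (Fin P) (Fin P) ℝ) (c : ℕ → ℝ) (x : Fin P → ℝ) (σ : ℝ) (p r : ℕ) :
    Set (Fin P → ℝ) :=
  {S | ∀ q ∈ Finset.Icc (p + 1) r, |limStat Q x q S| < c q * σ * xi Q q}

theorem measurableSet_acceptSet (Q : Matrix (Fin P) (Fin P) ℝ) (c : ℕ → ℝ) (x : Fin P → ℝ)
    (σ : ℝ) (p r : ℕ) : MeasurableSet (acceptSet Q c x σ p r) := by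
  have : acceptSet Q c x σ p r =
      ⋂ q ∈ Finset.Icc (p + 1) r, {S | |limStat Q x q S| < c q * σ * xi Q q} := by
    ext S; simp [acceptSet]
  rw [this]
  exact Finset.measurableSet_biInter _ fun q _ =>
    (isOpen_lt (continuous_limStat Q x q).abs continuous_const).measurableSet

theorem limStat_truncMat (Q : Matrix (Fin P) (Fin P) ℝ) (x : Fin P → ℝ) {q r : ℕ} (h : q ≤ r)
    (S : Fin P → ℝ) : limStat Q x q (truncMat P r *ᵥ S) = limStat Q x q S := by
  rw [limStat, Matrix.mulVec_mulVec, lsMat_mul_truncMat Q h, limStat]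

/-- The limiting test statistics of orders `p + 1, …, r` are independent of each other and of the
first `p` coordinates of the score. -/
theorem real_inter_acceptSet (hQ : Q.PosDef) (c : ℕ → ℝ) (x : Fin P → ℝ) (σ : ℝ) {p : ℕ}
    {D : Set (Fin P → ℝ)} (hD : MeasurableSet D) (hDp : ∀ S, truncMat P p *ᵥ S ∈ D ↔ S ∈ D)
    {r : ℕ} (hpr : p ≤ r) :
    (gaussLaw (σ ^ 2 • Q)).real (D ∩ acceptSet Q c x σ p r) =
      (gaussLaw (σ ^ 2 • Q)).real D *
        ∏ q ∈ Finset.Icc (p + 1) r, Delta (σ * xi Q q) (statMean Q x q) (c q * σ * xi Q q) := by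
  induction r, hpr using Nat.le_induction with
  | base =>
    have : acceptSet Q c x σ p p = Set.univ := by ext S; simp [acceptSet]
    simp [this]
  | succ r hpr ih =>
    -- the event splits into one about the statistic of order `r + 1` and one about the first `r`
    -- coordinates of the score
    have hset : D ∩ acceptSet Q c x σ p (r + 1) =
        (fun S => (lsMat Q (r + 1) *ᵥ basisVec P (r + 1)) ⬝ᵥ S) ⁻¹'
          {m | |m + statMean Q x (r + 1)| < c (r + 1) * σ * xi Q (r + 1)} ∩
        (fun S => truncMat P r *ᵥ S) ⁻¹' (D ∩ acceptSet Q c x σ p r) := by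
      ext S
      have h1 : truncMat P r *ᵥ S ∈ D ↔ S ∈ D := by
        rw [← hDp, Matrix.mulVec_mulVec, truncMat_mul_truncMat hpr, hDp]
      have h2 : truncMat P r *ᵥ S ∈ acceptSet Q c x σ p r ↔ S ∈ acceptSet Q c x σ p r := by
        simp only [acceptSet, Set.mem_ofPred_eq]
        refine forall₂_congr fun q hq => ?_
        rw [limStat_truncMat Q x (Finset.mem_Icc.1 hq).2]
      have h3 : S ∈ acceptSet Q c x σ p (r + 1) ↔
          |limStat Q x (r + 1) S| < c (r + 1) * σ * xi Q (r + 1) ∧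
            S ∈ acceptSet Q c x σ p r := by
        simp only [acceptSet, Set.mem_ofPred_eq]
        rw [← Finset.insert_Icc_right_eq_Icc_add_one (by omega), Finset.forall_mem_insert]
      simp only [Set.mem_inter_iff, Set.mem_preimage, h1, h2, h3, Set.mem_ofPred_eq, limStat,
        coord_lsMat_mulVec hQ]
      tauto
    have hind := indepFun_gaussLaw (hQ.posSemidef.smul (sq_nonneg σ))
      (lsMat Q (r + 1) *ᵥ basisVec P (r + 1)) (truncMat P r) (by
        rw [Matrix.smul_mulVec, Matrix.mulVec_smul,
          truncMat_mulVec_mulVec_lsMat_basisVec hQ (Nat.lt_succ_self r), smul_zero])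
    have hm : MeasurableSet {m : ℝ | |m + statMean Q x (r + 1)| < c (r + 1) * σ * xi Q (r + 1)} :=
      (isOpen_lt (by fun_prop) continuous_const).measurableSet
    have hmul := hind.measure_inter_preimage_eq_mul _ _ hm
      (hD.inter (measurableSet_acceptSet Q c x σ p r))
    have h4 : (fun S => truncMat P r *ᵥ S) ⁻¹' (D ∩ acceptSet Q c x σ p r) =
        D ∩ acceptSet Q c x σ p r := by
      ext S
      have h1 : truncMat P r *ᵥ S ∈ D ↔ S ∈ D := by
        rw [← hDp, Matrix.mulVec_mulVec, truncMat_mul_truncMat hpr, hDp]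
      have h2 : truncMat P r *ᵥ S ∈ acceptSet Q c x σ p r ↔ S ∈ acceptSet Q c x σ p r := by
        simp only [acceptSet, Set.mem_ofPred_eq]
        refine forall₂_congr fun q hq => ?_
        rw [limStat_truncMat Q x (Finset.mem_Icc.1 hq).2]
      simp only [Set.mem_inter_iff, Set.mem_preimage, h1, h2]
    have h5 : (gaussLaw (σ ^ 2 • Q)).real
        ((fun S => (lsMat Q (r + 1) *ᵥ basisVec P (r + 1)) ⬝ᵥ S) ⁻¹'
          {m | |m + statMean Q x (r + 1)| < c (r + 1) * σ * xi Q (r + 1)}) =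
        Delta (σ * xi Q (r + 1)) (statMean Q x (r + 1)) (c (r + 1) * σ * xi Q (r + 1)) := by
      have := map_coord_lsMat hQ σ (r + 1)
      simp_rw [coord_lsMat_mulVec hQ] at this
      rw [← gaussianReal_real_abs_add_lt, ← this, map_measureReal_apply (by fun_prop) hm]
    rw [hset, measureReal_def, hmul, ENNReal.toReal_mul, ← measureReal_def, ← measureReal_def, h5,
      h4, ih, Finset.prod_Icc_succ_top (by omega)]
    ring

theorem map_estimate (hQ : Q.PosDef) (A : Matrix (Fin k) (Fin P) ℝ) (σ : ℝ) (p : ℕ) :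
    (gaussLaw (σ ^ 2 • Q)).map (fun S => (A * lsMat Q p) *ᵥ S) = phiInf Q A σ p := by
  rw [gaussLaw_map_mulVec (hQ.posSemidef.smul (sq_nonneg σ))]
  have : A * lsMat Q p * σ ^ 2 • Q * (A * lsMat Q p)ᵀ = σ ^ 2 • covMat Q A p := by
    rw [covMat_eq, transpose_mul, lsMat_transpose hQ, Matrix.mul_smul, Matrix.smul_mul]
    congr 1
    rw [← Matrix.mul_assoc, mul_lsMat_mul_mul_lsMat hQ]
  rw [this]
  rfl

theorem lsMat_posSemidef (hQ : Q.PosDef) (p : ℕ) : (lsMat Q p).PosSemidef := by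
  have := (posDef_blockHH hQ p).inv.posSemidef.mul_mul_conjTranspose_same (headIncl P p)
  rwa [conjTranspose_eq_transpose_of_trivial] at this

theorem covMat_transpose (hQ : Q.PosDef) (A : Matrix (Fin k) (Fin P) ℝ) (p : ℕ) :
    (covMat Q A p)ᵀ = covMat Q A p := by
  rw [covMat_eq, transpose_mul, transpose_mul, transpose_transpose, lsMat_transpose hQ,
    Matrix.mul_assoc]

/-- Since `C_∞^{(p)}` lies in the column space of the covariance matrix, `b_∞` is a vector of
regression coefficients whichever generalized inverse is used. -/
theorem covMat_mulVec_bInf (hQ : Q.PosDef) (A : Matrix (Fin k) (Fin P) ℝ) (p : ℕ)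
    {G : Matrix (Fin k) (Fin k) ℝ} (hG : IsGenInv (covMat Q A p) G) :
    covMat Q A p *ᵥ bInf Q A G p = cInf Q A p := by
  have hker : ∀ v, covMat Q A p *ᵥ v = 0 → cInf Q A p ⬝ᵥ v = 0 := by
    intro v hv
    have h1 : (Aᵀ *ᵥ v) ⬝ᵥ lsMat Q p *ᵥ (Aᵀ *ᵥ v) = 0 := by
      have : v ⬝ᵥ covMat Q A p *ᵥ v = 0 := by rw [hv, dotProduct_zero]
      rwa [covMat_eq, ← Matrix.mulVec_mulVec, ← Matrix.mulVec_mulVec, Matrix.dotProduct_mulVec,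
        ← Matrix.mulVec_transpose] at this
    have h2 : lsMat Q p *ᵥ (Aᵀ *ᵥ v) = 0 :=
      ((lsMat_posSemidef hQ p).dotProduct_mulVec_zero_iff _).1 (by simpa using h1)
    rw [cInf_eq, dotProduct_comm, Matrix.dotProduct_mulVec, ← Matrix.mulVec_transpose,
      Matrix.dotProduct_mulVec, ← Matrix.mulVec_transpose, lsMat_transpose hQ, h2, zero_dotProduct]
  rw [← covMat_transpose hQ, Matrix.mulVec_transpose, bInf]
  refine dotProduct_eq _ _ fun y => ?_
  have h := hker (y - G *ᵥ (covMat Q A p *ᵥ y)) (by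
    rw [Matrix.mulVec_sub, Matrix.mulVec_mulVec, Matrix.mulVec_mulVec,
      show covMat Q A p * G * covMat Q A p = covMat Q A p from hG, sub_self])
  rw [dotProduct_sub, sub_eq_zero] at h
  rw [← Matrix.dotProduct_mulVec, ← Matrix.dotProduct_mulVec, ← h]

/-- The joint probability of an orthant for the estimate of order `p` and of the rejection of the
hypothesis of order `p`, obtained by conditioning on the estimate. -/
theorem real_estimate_reject (hQ : Q.PosDef) (A : Matrix (Fin k) (Fin P) ℝ) (σ : ℝ) (p : ℕ)
    {G : Matrix (Fin k) (Fin k) ℝ} (hG : IsGenInv (covMat Q A p) G) (t : Fin k → ℝ) (μ d : ℝ) :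
    (gaussLaw (σ ^ 2 • Q)).real
        {S | (A * lsMat Q p) *ᵥ S ≤ t ∧ d ≤ |coord (lsMat Q p *ᵥ S) p + μ|} =
      ∫ z in Set.Iic t, (1 - Delta (σ * zetaInf Q A G p) (μ + bInf Q A G p ⬝ᵥ z) d)
        ∂(phiInf Q A σ p) := by
  set a := lsMat Q p *ᵥ basisVec P p with ha
  set B := A * lsMat Q p with hB
  set b := bInf Q A G p with hb
  -- the residual of the regression of the test statistic on the estimate
  set e := a - Bᵀ *ᵥ b with he
  have hPS := hQ.posSemidef.smul (sq_nonneg σ)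
  have hBQa : B *ᵥ (Q *ᵥ a) = cInf Q A p := by
    rw [cInf_eq, ha, hB, Matrix.mulVec_mulVec, Matrix.mulVec_mulVec, Matrix.mulVec_mulVec,
      mul_lsMat_mul_mul_lsMat hQ]
  have hBQB : B *ᵥ (Q *ᵥ (Bᵀ *ᵥ b)) = cInf Q A p := by
    rw [← covMat_mulVec_bInf hQ A p hG, covMat_eq, hB, transpose_mul, lsMat_transpose hQ,
      Matrix.mulVec_mulVec, Matrix.mulVec_mulVec, ← hb]
    congr 1
    rw [← Matrix.mul_assoc, mul_lsMat_mul_mul_lsMat hQ]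
  have horth : B *ᵥ (Q *ᵥ e) = 0 := by
    rw [he, Matrix.mulVec_sub, Matrix.mulVec_sub, hBQa, hBQB, sub_self]
  have hind := indepFun_gaussLaw hPS e B (by
    rw [Matrix.smul_mulVec, Matrix.mulVec_smul, horth, smul_zero])
  have hvar : e ⬝ᵥ (σ ^ 2 • Q) *ᵥ e = (σ * zetaInf Q A G p) ^ 2 := by
    have h1 : e ⬝ᵥ Q *ᵥ e = xiSq Q p - b ⬝ᵥ cInf Q A p := by
      have h2 : e ⬝ᵥ Q *ᵥ e = a ⬝ᵥ Q *ᵥ e := by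
        rw [he, sub_dotProduct, ← he, Matrix.mulVec_transpose, ← Matrix.dotProduct_mulVec, horth,
          dotProduct_zero, sub_zero]
      have h3 : a ⬝ᵥ Q *ᵥ a = xiSq Q p := by
        have h4 := basisVec_variance hQ 1 p
        have h0 : 0 ≤ xiSq Q p := by
          simpa [xiSq] using (posDef_blockHH hQ p).inv.posSemidef.dotProduct_mulVec_nonneg
            (lastBasis p)
        rw [one_pow, one_smul, one_mul, xi, Real.sq_sqrt h0] at h4
        exact h4
      have hQt : Qᵀ = Q := by
        have := hQ.isHermitian
        rwa [IsHermitian, conjTranspose_eq_transpose_of_trivial] at this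
      rw [h2, he, Matrix.mulVec_sub, dotProduct_sub, h3, ← hBQa]
      congr 1
      rw [Matrix.dotProduct_mulVec, ← Matrix.mulVec_transpose, hQt, Matrix.dotProduct_mulVec,
        Matrix.vecMul_transpose, dotProduct_comm]
    have h0 : 0 ≤ e ⬝ᵥ Q *ᵥ e := by simpa using hQ.posSemidef.dotProduct_mulVec_nonneg e
    rw [Matrix.smul_mulVec, dotProduct_smul, smul_eq_mul, mul_pow, zetaInf,
      Real.sq_sqrt (h1 ▸ h0), h1]
  have hr := gaussLaw_map_dotProduct hPS e
  rw [hvar] at hr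
  have hZ := map_estimate hQ A σ p
  rw [← hB] at hZ
  have hprod := (indepFun_iff_map_prod_eq_prod_map_map
    (measurable_mulVec B).aemeasurable (by fun_prop)).1 hind.symm
  rw [hZ, hr] at hprod
  have hdecomp : ∀ S, coord (lsMat Q p *ᵥ S) p = e ⬝ᵥ S + b ⬝ᵥ B *ᵥ S := by
    intro S
    rw [coord_lsMat_mulVec hQ, he, sub_dotProduct, Matrix.mulVec_transpose,
      ← Matrix.dotProduct_mulVec, ← ha, sub_add_cancel]
  have hT : MeasurableSet {w : (Fin k → ℝ) × ℝ | w.1 ≤ t ∧ d ≤ |w.2 + b ⬝ᵥ w.1 + μ|} := by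
    have hc : Continuous fun w : (Fin k → ℝ) × ℝ => |w.2 + b ⬝ᵥ w.1 + μ| :=
      ((continuous_snd.add (continuous_const.dotProduct continuous_fst)).add continuous_const).abs
    exact (isClosed_le continuous_fst continuous_const).measurableSet.inter
      (isClosed_le continuous_const hc).measurableSet
  have : IsProbabilityMeasure (phiInf Q A σ p) := by
    rw [← hZ]
    exact Measure.isProbabilityMeasure_map (measurable_mulVec B).aemeasurable
  have hstart : {S | B *ᵥ S ≤ t ∧ d ≤ |coord (lsMat Q p *ᵥ S) p + μ|} =
      (fun S => (B *ᵥ S, e ⬝ᵥ S)) ⁻¹' {w | w.1 ≤ t ∧ d ≤ |w.2 + b ⬝ᵥ w.1 + μ|} := by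
    ext S
    simp only [hdecomp, Set.mem_ofPred_eq, Set.mem_preimage]
  rw [hstart, ← map_measureReal_apply ((measurable_mulVec B).prodMk (by fun_prop)) hT, hprod,
    measureReal_def, Measure.prod_apply hT, ← integral_toReal
      (measurable_measure_prodMk_left hT).aemeasurable (ae_of_all _ fun z => measure_lt_top _ _),
    ← integral_indicator measurableSet_Iic]
  refine integral_congr_ae (ae_of_all _ fun z => ?_)
  by_cases hz : z ∈ Set.Iic t
  · rw [Set.indicator_of_mem hz, ← gaussianReal_real_le_abs_add, measureReal_def]
    dsimp only
    congr 2
    ext y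
    simp only [Set.mem_preimage, Set.mem_ofPred_eq, Set.mem_Iic.1 hz, true_and]
    rw [add_assoc, add_comm (b ⬝ᵥ z)]
  · rw [Set.indicator_of_notMem hz]
    have : Prod.mk z ⁻¹' {w : (Fin k → ℝ) × ℝ | w.1 ≤ t ∧ d ≤ |w.2 + b ⬝ᵥ w.1 + μ|} = ∅ := by
      ext y
      simp only [Set.mem_preimage, Set.mem_ofPred_eq, Set.mem_empty_iff_false, iff_false]
      exact fun h => hz h.1
    simp [this]

open Classical in
/-- The model selector in the limit experiment. Orders below `p₀` are never selected. -/
noncomputable def limSelector (p₀ : ℕ) (c : ℕ → ℝ) (Q : Matrix (Fin P) (Fin P) ℝ) (x : Fin P → ℝ)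
    (σ : ℝ) (S : Fin P → ℝ) : ℕ :=
  Nat.findGreatest (fun q => q ≤ p₀ ∨ c q * σ * xi Q q ≤ |limStat Q x q S|) P

theorem limSelector_mem {p₀ : ℕ} (hp₀ : p₀ ≤ P) (c : ℕ → ℝ) (Q : Matrix (Fin P) (Fin P) ℝ)
    (x : Fin P → ℝ) (σ : ℝ) (S : Fin P → ℝ) :
    limSelector p₀ c Q x σ S ∈ Finset.Icc p₀ P :=
  Finset.mem_Icc.2 ⟨Nat.le_findGreatest hp₀ (Or.inl le_rfl), Nat.findGreatest_le P⟩

theorem limSelector_eq_iff {p₀ : ℕ} (c : ℕ → ℝ) (Q : Matrix (Fin P) (Fin P) ℝ)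
    (x : Fin P → ℝ) (σ : ℝ) (S : Fin P → ℝ) {p : ℕ} (hp : p₀ ≤ p) (hpP : p ≤ P) :
    limSelector p₀ c Q x σ S = p ↔
      (p = p₀ ∨ c p * σ * xi Q p ≤ |limStat Q x p S|) ∧ S ∈ acceptSet Q c x σ p P := by
  rw [limSelector, Nat.findGreatest_eq_iff]
  simp only [acceptSet, Set.mem_ofPred_eq, Finset.mem_Icc]
  constructor
  · rintro ⟨-, h1, h2⟩
    refine ⟨?_, fun q hq => ?_⟩
    · by_cases h0 : p = 0
      · left; omega
      · exact (h1 h0).imp (fun h => le_antisymm h hp) id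
    · have := h2 (Nat.lt_of_succ_le hq.1) hq.2
      push Not at this
      exact this.2
  · rintro ⟨h1, h2⟩
    refine ⟨hpP, fun _ => h1.imp (fun h => h.le) id, fun q hq hqP h => ?_⟩
    rcases h with h | h
    · omega
    · exact absurd (h2 q ⟨hq, hqP⟩) (not_lt.2 h)

theorem measurable_limSelector (p₀ : ℕ) (c : ℕ → ℝ) (Q : Matrix (Fin P) (Fin P) ℝ)
    (x : Fin P → ℝ) (σ : ℝ) : Measurable (limSelector p₀ c Q x σ) := by
  classical
  refine measurable_findGreatest fun q _ => ?_
  exact (MeasurableSet.const _).union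
    (isClosed_le continuous_const (continuous_limStat Q x q).abs).measurableSet

/-- The scaled estimation error in the limit experiment. -/
noncomputable def limError (p₀ : ℕ) (A : Matrix (Fin k) (Fin P) ℝ) (c : ℕ → ℝ)
    (Q : Matrix (Fin P) (Fin P) ℝ) (x : Fin P → ℝ) (σ : ℝ) (S : Fin P → ℝ) : Fin k → ℝ :=
  scoreError A Q x (limSelector p₀ c Q x σ S) S

theorem continuous_scoreError (A : Matrix (Fin k) (Fin P) ℝ) (M : Matrix (Fin P) (Fin P) ℝ)
    (x : Fin P → ℝ) (p : ℕ) : Continuous (scoreError A M x p) :=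
  continuous_const.matrix_mulVec
    ((continuous_const.matrix_mulVec continuous_id).add continuous_const)

theorem measurable_diag_of_countable {E G : Type*} [MeasurableSpace E] [MeasurableSpace G]
    (F : ℕ → E → G) (hF : ∀ p, Measurable (F p)) {f : E → ℕ} (hf : Measurable f) :
    Measurable fun S => F (f S) S := by
  have h : Measurable (Function.uncurry F) := measurable_from_prod_countable_right hF
  exact h.comp (hf.prodMk measurable_id)

theorem measurable_scoreError_comp (A : Matrix (Fin k) (Fin P) ℝ) (M : Matrix (Fin P) (Fin P) ℝ)
    (x : Fin P → ℝ) {f : (Fin P → ℝ) → ℕ} (hf : Measurable f) :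
    Measurable fun S => scoreError A M x (f S) S :=
  measurable_diag_of_countable (scoreError A M x)
    (fun p => (continuous_scoreError A M x p).measurable) hf

theorem measurable_limError (p₀ : ℕ) (A : Matrix (Fin k) (Fin P) ℝ) (c : ℕ → ℝ)
    (Q : Matrix (Fin P) (Fin P) ℝ) (x : Fin P → ℝ) (σ : ℝ) :
    Measurable (limError p₀ A c Q x σ) :=
  measurable_scoreError_comp A Q x (measurable_limSelector p₀ c Q x σ)

theorem scoreError_le_iff (A : Matrix (Fin k) (Fin P) ℝ) (M : Matrix (Fin P) (Fin P) ℝ)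
    (x : Fin P → ℝ) (p : ℕ) (S : Fin P → ℝ) (t : Fin k → ℝ) :
    scoreError A M x p S ≤ t ↔ (A * lsMat M p) *ᵥ S ≤ t - A *ᵥ biasVec M p x := by
  rw [scoreError, Matrix.mulVec_add, Matrix.mulVec_mulVec, le_sub_iff_add_le]

/-- The law of the estimation error in the limit experiment has the cdf `limitCdf`. -/
theorem cdfOf_map_limError (hQ : Q.PosDef) (A : Matrix (Fin k) (Fin P) ℝ) (c : ℕ → ℝ) (σ : ℝ)
    (O : ℕ) (ψ : Fin P → EReal) (hp₀ : pStar O ψ ≤ P) (gi : ℕ → Matrix (Fin k) (Fin k) ℝ)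
    (hgi : ∀ p, 0 < p → p ≤ P → IsGenInv (covMat Q A p) (gi p)) :
    cdfOf ((gaussLaw (σ ^ 2 • Q)).map (limError (pStar O ψ) A c Q (finPart ψ) σ)) =
      limitCdf O Q A c gi σ ψ := by
  ext t
  set p₀ := pStar O ψ with hp₀_def
  set x := finPart ψ
  have hsplit : limError p₀ A c Q x σ ⁻¹' Set.Iic t =
      ⋃ p ∈ Finset.Icc p₀ P, {S | limSelector p₀ c Q x σ S = p ∧ scoreError A Q x p S ≤ t} := by
    ext S
    simp only [Set.mem_preimage, Set.mem_Iic, Set.mem_iUnion, Set.mem_ofPred_eq, limError]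
    constructor
    · exact fun h => ⟨_, limSelector_mem hp₀ c Q x σ S, rfl, h⟩
    · rintro ⟨p, -, rfl, h⟩
      exact h
  have hmeas : ∀ p, MeasurableSet {S | limSelector p₀ c Q x σ S = p ∧ scoreError A Q x p S ≤ t} :=
    fun p => (measurable_limSelector p₀ c Q x σ (measurableSet_singleton p)).inter
      ((continuous_scoreError A Q x p).measurable measurableSet_Iic)
  have hclosed : ∀ p, MeasurableSet {S | (A * lsMat Q p) *ᵥ S ≤ t - A *ᵥ biasVec Q p x} :=
    fun p => (measurable_mulVec _) measurableSet_Iic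
  rw [cdfOf, map_measureReal_apply (measurable_limError p₀ A c Q x σ) measurableSet_Iic, hsplit,
    measureReal_biUnion_finset _ fun p _ => hmeas p]
  swap
  · intro p _ q _ hpq
    rw [Function.onFun, Set.disjoint_left]
    exact fun S h1 h2 => hpq (h1.1.symm.trans h2.1)
  have htr : ∀ p S, (A * lsMat Q p) *ᵥ (truncMat P p *ᵥ S) = (A * lsMat Q p) *ᵥ S := by
    intro p S
    rw [Matrix.mulVec_mulVec, Matrix.mul_assoc, lsMat_mul_truncMat Q le_rfl]
  rw [← Finset.add_sum_Ioc_eq_sum_Icc hp₀, limitCdf, ← hp₀_def]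
  congr 1
  · have hset : {S | limSelector p₀ c Q x σ S = p₀ ∧ scoreError A Q x p₀ S ≤ t} =
        {S | (A * lsMat Q p₀) *ᵥ S ≤ t - A *ᵥ biasVec Q p₀ x} ∩ acceptSet Q c x σ p₀ P := by
      ext S
      simp only [Set.mem_ofPred_eq, Set.mem_inter_iff, limSelector_eq_iff c Q x σ S le_rfl hp₀,
        scoreError_le_iff, true_or, true_and]
      tauto
    rw [hset, real_inter_acceptSet hQ c x σ (hclosed p₀)
      (fun S => by simp only [Set.mem_ofPred_eq, htr]) hp₀, cdfOf, ← map_estimate hQ,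
      map_measureReal_apply (measurable_mulVec _) measurableSet_Iic]
    rfl
  · refine Finset.sum_congr (by ext; simp) fun p hp => ?_
    rw [Finset.mem_Icc] at hp
    have hset : {S | limSelector p₀ c Q x σ S = p ∧ scoreError A Q x p S ≤ t} =
        {S | (A * lsMat Q p) *ᵥ S ≤ t - A *ᵥ biasVec Q p x ∧
          c p * σ * xi Q p ≤ |coord (lsMat Q p *ᵥ S) p + statMean Q x p|} ∩
          acceptSet Q c x σ p P := by
      ext S
      have : p ≠ p₀ := by omega
      simp only [Set.mem_ofPred_eq, Set.mem_inter_iff,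
        limSelector_eq_iff c Q x σ S (Nat.le_of_succ_le hp.1) hp.2, scoreError_le_iff, this,
        false_or, limStat]
      tauto
    rw [hset, real_inter_acceptSet hQ c x σ _ _ hp.2,
      real_estimate_reject hQ A σ p (hgi p (by omega) hp.2)]
    · rfl
    · exact (hclosed p).inter (isClosed_le continuous_const
        (continuous_limStat Q x p).abs).measurableSet
    · intro S
      simp only [Set.mem_ofPred_eq, htr, Matrix.mulVec_mulVec, lsMat_mul_truncMat Q le_rfl]

end LimitLaw

/-! ### Local asymptotics of the selected order -/

section Convergence

variable {P k : ℕ} {Q : Matrix (Fin P) (Fin P) ℝ}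

/-- The largest element of a set up to `N` depends only on the part of the set beyond any of its
elements. -/
theorem findGreatest_eq_of_iff {p q : ℕ → Prop} [DecidablePred p] [DecidablePred q] {p₀ N : ℕ}
    (h₀ : p₀ ≤ N) (hp : p p₀) (hq : q p₀) (h : ∀ r, p₀ < r → r ≤ N → (p r ↔ q r)) :
    Nat.findGreatest p N = Nat.findGreatest q N := by
  have hle : ∀ {p q : ℕ → Prop} [DecidablePred p] [DecidablePred q], p p₀ → q p₀ →
      (∀ r, p₀ < r → r ≤ N → (p r → q r)) → Nat.findGreatest p N ≤ Nat.findGreatest q N := by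
    intro p q _ _ hp hq h
    refine Nat.le_findGreatest (Nat.findGreatest_le N) ?_
    rcases (Nat.le_findGreatest h₀ hp).eq_or_lt with h1 | h1
    · rw [← h1]; exact hq
    · exact h _ h1 (Nat.findGreatest_le N) (Nat.findGreatest_spec h₀ hp)
  exact le_antisymm (hle hp hq fun r h1 h2 => (h r h1 h2).1)
    (hle hq hp fun r h1 h2 => (h r h1 h2).2)

theorem eventually_le_iff_of_tendsto {β : Type*} {l : Filter β} {f g : β → ℝ} {a b : ℝ}
    (hf : Tendsto f l (𝓝 a)) (hg : Tendsto g l (𝓝 b)) (hab : a ≠ b) :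
    ∀ᶠ w in l, f w ≤ g w ↔ a ≤ b := by
  rcases lt_or_gt_of_ne hab with h | h
  · filter_upwards [hf.eventually_lt hg h] with w hw
    exact iff_of_true hw.le h.le
  · filter_upwards [hg.eventually_lt hf h] with w hw
    exact iff_of_false (not_le.2 hw) (not_le.2 h)

theorem tendsto_matrix_iff {m n β : Type*} {l : Filter β} {M : β → Matrix m n ℝ}
    {M₀ : Matrix m n ℝ} :
    Tendsto M l (𝓝 M₀) ↔ ∀ i j, Tendsto (fun b => M b i j) l (𝓝 (M₀ i j)) :=
  Iff.trans tendsto_pi_nhds (forall_congr' fun _ => tendsto_pi_nhds)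

theorem tendsto_matrix_mul {m n o β : Type*} [Fintype n] {l : Filter β} {M : β → Matrix m n ℝ}
    {M₀ : Matrix m n ℝ} {N : β → Matrix n o ℝ} {N₀ : Matrix n o ℝ} (hM : Tendsto M l (𝓝 M₀))
    (hN : Tendsto N l (𝓝 N₀)) : Tendsto (fun b => M b * N b) l (𝓝 (M₀ * N₀)) := by
  rw [tendsto_matrix_iff] at *
  intro i j
  simp only [Matrix.mul_apply]
  exact tendsto_finsetSum _ fun r _ => (hM i r).mul (hN r j)

theorem tendsto_blockHH_inv {β : Type*} {l : Filter β} {G : β → Matrix (Fin P) (Fin P) ℝ}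
    (hQ : Q.PosDef) (hG : Tendsto G l (𝓝 Q)) (p : ℕ) :
    Tendsto (fun b => (blockHH (G b) p)⁻¹) l (𝓝 (blockHH Q p)⁻¹) := by
  refine tendsto_matrix_inv ?_ (posDef_blockHH hQ p).det_pos.ne'
  rw [tendsto_matrix_iff] at *
  exact fun i j => hG _ _

theorem tendsto_lsMat {β : Type*} {l : Filter β} {G : β → Matrix (Fin P) (Fin P) ℝ}
    (hQ : Q.PosDef) (hG : Tendsto G l (𝓝 Q)) (p : ℕ) :
    Tendsto (fun b => lsMat (G b) p) l (𝓝 (lsMat Q p)) :=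
  tendsto_matrix_mul (tendsto_matrix_mul tendsto_const_nhds (tendsto_blockHH_inv hQ hG p))
    tendsto_const_nhds

theorem tendsto_dotProduct_const {ι β : Type*} [Fintype ι] {l : Filter β} (a : ι → ℝ)
    {x : β → ι → ℝ} {x₀ : ι → ℝ} (hx : Tendsto x l (𝓝 x₀)) :
    Tendsto (fun b => a ⬝ᵥ x b) l (𝓝 (a ⬝ᵥ x₀)) := by
  rw [tendsto_pi_nhds] at hx
  exact tendsto_finsetSum _ fun i _ => tendsto_const_nhds.mul (hx i)

theorem tendsto_coord {β : Type*} {l : Filter β} {x : β → Fin P → ℝ} {x₀ : Fin P → ℝ}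
    (hx : Tendsto x l (𝓝 x₀)) (q : ℕ) : Tendsto (fun b => coord (x b) q) l (𝓝 (coord x₀ q)) := by
  simp only [coord_eq]
  exact tendsto_dotProduct_const _ hx

theorem tendsto_xi {β : Type*} {l : Filter β} {G : β → Matrix (Fin P) (Fin P) ℝ}
    (hQ : Q.PosDef) (hG : Tendsto G l (𝓝 Q)) (q : ℕ) :
    Tendsto (fun b => xi (G b) q) l (𝓝 (xi Q q)) := by
  refine Tendsto.sqrt ?_
  simp only [xiSq_eq]
  exact tendsto_dotProduct_const _ (tendsto_mulVec (tendsto_lsMat hQ hG q) tendsto_const_nhds)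

/-- Convergence of the first `p` coordinates of the bias. -/
theorem tendsto_biasVec_head {β : Type*} {l : Filter β} {G : β → Matrix (Fin P) (Fin P) ℝ}
    (hQ : Q.PosDef) (hG : Tendsto G l (𝓝 Q)) {p : ℕ} {x : β → Fin P → ℝ} {x₀ : Fin P → ℝ}
    (hx : Tendsto (fun b => tailVec (x b) p) l (𝓝 (tailVec x₀ p))) :
    Tendsto (fun b => ((blockHH (G b) p)⁻¹ * blockHT (G b) p) *ᵥ tailVec (x b) p) l
      (𝓝 (((blockHH Q p)⁻¹ * blockHT Q p) *ᵥ tailVec x₀ p)) := by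
  refine tendsto_mulVec (tendsto_matrix_mul (tendsto_blockHH_inv hQ hG p) ?_) hx
  rw [tendsto_matrix_iff] at *
  exact fun i j => hG _ _

theorem tendsto_biasVec {β : Type*} {l : Filter β} {G : β → Matrix (Fin P) (Fin P) ℝ}
    (hQ : Q.PosDef) (hG : Tendsto G l (𝓝 Q)) {p : ℕ} {x : β → Fin P → ℝ} {x₀ : Fin P → ℝ}
    (hx : Tendsto (fun b => tailVec (x b) p) l (𝓝 (tailVec x₀ p))) :
    Tendsto (fun b => biasVec (G b) p (x b)) l (𝓝 (biasVec Q p x₀)) := by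
  simp only [biasVec, stack_eq]
  exact (tendsto_mulVec tendsto_const_nhds (tendsto_biasVec_head hQ hG hx)).add
    (tendsto_mulVec tendsto_const_nhds hx.neg)

/-- A sequence of score experiments approaching a limit experiment: the Gram matrices `G n`
converge to `Q`, the coordinates of the scaled parameters `x n` beyond `p₀` converge to those of
`x₀`, and the test of order `p₀` rejects asymptotically. -/
structure LocalModel (P : ℕ) (p₀ : ℕ) (c : ℕ → ℝ) (Q : Matrix (Fin P) (Fin P) ℝ)
    (x₀ : Fin P → ℝ) (σ : ℝ) (G : ℕ → Matrix (Fin P) (Fin P) ℝ) (x : ℕ → Fin P → ℝ) : Prop where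
  le : p₀ ≤ P
  posDef : Q.PosDef
  posSemidef : ∀ n, (G n).PosSemidef
  tendsto_gram : Tendsto G atTop (𝓝 Q)
  pos : 0 < σ
  tendsto_coord : ∀ j : Fin P, p₀ ≤ j → Tendsto (fun n => x n j) atTop (𝓝 (x₀ j))
  reject : c p₀ = 0 ∨ 0 < p₀ ∧ Tendsto (fun n => |coord (x n) p₀|) atTop atTop

namespace LocalModel

variable {p₀ : ℕ} {c : ℕ → ℝ} {x₀ : Fin P → ℝ} {σ : ℝ} {G : ℕ → Matrix (Fin P) (Fin P) ℝ}
  {x : ℕ → Fin P → ℝ}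

theorem eventually_posDef (h : LocalModel P p₀ c Q x₀ σ G x) : ∀ᶠ n in atTop, (G n).PosDef := by
  have hdet := tendsto_matrix_det h.tendsto_gram
  filter_upwards [hdet.eventually_ne h.posDef.det_pos.ne'] with n hn
  exact (h.posSemidef n).posDef_iff_det_ne_zero.2 hn

theorem tendsto_tailVec (h : LocalModel P p₀ c Q x₀ σ G x) {p : ℕ} (hp : p₀ ≤ p) :
    Tendsto (fun n => tailVec (x n) p) atTop (𝓝 (tailVec x₀ p)) := by
  rw [tendsto_pi_nhds]
  intro j
  exact h.tendsto_coord j.1 (hp.trans (not_lt.1 j.2))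

theorem tendsto_bias (h : LocalModel P p₀ c Q x₀ σ G x) {p : ℕ} (hp : p₀ ≤ p) :
    Tendsto (fun n => biasVec (G n) p (x n)) atTop (𝓝 (biasVec Q p x₀)) :=
  tendsto_biasVec h.posDef h.tendsto_gram (h.tendsto_tailVec hp)

theorem tendsto_statMean (h : LocalModel P p₀ c Q x₀ σ G x) {q : ℕ} (hq : p₀ < q) (hqP : q ≤ P) :
    Tendsto (fun n => statMean (G n) (x n) q) atTop (𝓝 (statMean Q x₀ q)) := by
  refine (_root_.tendsto_coord (h.tendsto_bias hq.le) q).add ?_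
  have h1 : 0 < q ∧ q ≤ P := ⟨by omega, hqP⟩
  simp only [coord, h1, and_self, dite_true]
  exact h.tendsto_coord _ (by simp; omega)

/-- Off the boundary of the rejection regions, the selector is eventually that of the limit
experiment, uniformly over scales close to the limiting one. -/
theorem eventually_scoreSelector_eq (h : LocalModel P p₀ c Q x₀ σ G x) {S : Fin P → ℝ}
    (hS : ∀ q ∈ Finset.Icc (p₀ + 1) P, c q * σ * xi Q q ≠ |limStat Q x₀ q S|) :
    ∀ᶠ w in atTop ×ˢ 𝓝 σ,
      scoreSelector c (G w.1) (x w.1) w.2 S = limSelector p₀ c Q x₀ σ S := by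
  have hls : ∀ q, Tendsto (fun w : ℕ × ℝ => coord (lsMat (G w.1) q *ᵥ S) q) (atTop ×ˢ 𝓝 σ)
      (𝓝 (coord (lsMat Q q *ᵥ S) q)) := fun q =>
    _root_.tendsto_coord (tendsto_mulVec
      ((tendsto_lsMat h.posDef h.tendsto_gram q).comp tendsto_fst) tendsto_const_nhds) q
  have hden : ∀ q, Tendsto (fun w : ℕ × ℝ => w.2 * xi (G w.1) q) (atTop ×ˢ 𝓝 σ)
      (𝓝 (σ * xi Q q)) := fun q =>
    tendsto_snd.mul ((tendsto_xi h.posDef h.tendsto_gram q).comp tendsto_fst)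
  have h1 : ∀ q ∈ Finset.Icc (p₀ + 1) P, ∀ᶠ w in atTop ×ˢ 𝓝 σ,
      (c q ≤ |(coord (lsMat (G w.1) q *ᵥ S) q + statMean (G w.1) (x w.1) q) /
        (w.2 * xi (G w.1) q)| ↔ c q * σ * xi Q q ≤ |limStat Q x₀ q S|) := by
    intro q hq
    have hq' := Finset.mem_Icc.1 hq
    have hξ : 0 < σ * xi Q q := mul_pos h.pos (xi_pos h.posDef (by omega) hq'.2)
    have hT := (((hls q).add ((h.tendsto_statMean (q := q) (by omega) hq'.2).comp
      tendsto_fst)).div (hden q) hξ.ne').abs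
    have heq : ∀ y : ℝ, c q ≤ |y / (σ * xi Q q)| ↔ c q * σ * xi Q q ≤ |y| := by
      intro y
      rw [abs_div, abs_of_pos hξ, le_div_iff₀ hξ, mul_assoc]
    have hne : c q ≠ |limStat Q x₀ q S / (σ * xi Q q)| := by
      intro h'
      refine hS q hq ?_
      rw [mul_assoc, h', abs_div, abs_of_pos hξ, div_mul_cancel₀ _ hξ.ne']
    filter_upwards [eventually_le_iff_of_tendsto (tendsto_const_nhds (x := c q)) hT hne] with w hw
    rw [← heq]
    exact hw
  -- the test of order `p₀` rejects, either trivially or since its statistic tends to infinity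
  have h2 : ∀ᶠ w in atTop ×ˢ 𝓝 σ,
      c p₀ ≤ |(coord (lsMat (G w.1) p₀ *ᵥ S) p₀ + statMean (G w.1) (x w.1) p₀) /
        (w.2 * xi (G w.1) p₀)| := by
    rcases h.reject with h0 | ⟨hpos, hinf⟩
    · exact Eventually.of_forall fun w => h0 ▸ abs_nonneg _
    · have hξ : 0 < σ * xi Q p₀ := mul_pos h.pos (xi_pos h.posDef hpos h.le)
      have hb := ((hls p₀).add ((_root_.tendsto_coord (h.tendsto_bias le_rfl) p₀).comp
        tendsto_fst)).abs
      have hnum := (hb.neg).add_atTop (hinf.comp (tendsto_fst (g := 𝓝 σ)))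
      have hquot := hnum.atTop_mul_pos (inv_pos.2 hξ) ((hden p₀).inv₀ hξ.ne')
      filter_upwards [hquot.eventually_ge_atTop (c p₀), (hden p₀).eventually (lt_mem_nhds hξ)]
        with w hw hw2
      refine hw.trans ?_
      rw [abs_div, abs_of_pos hw2, div_eq_mul_inv]
      refine mul_le_mul_of_nonneg_right ?_ (inv_nonneg.2 hw2.le)
      simp only [Function.comp_apply, statMean]
      rw [← add_assoc]
      have := abs_sub_abs_le_abs_sub (coord (x w.1) p₀)
        (-(coord (lsMat (G w.1) p₀ *ᵥ S) p₀ + coord (biasVec (G w.1) p₀ (x w.1)) p₀))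
      rw [abs_neg, sub_neg_eq_add] at this
      rw [add_comm _ (coord (x w.1) p₀)]
      linarith
  filter_upwards [(Finset.eventually_all _).2 h1, h2] with w hw1 hw2
  classical
  refine findGreatest_eq_of_iff h.le hw2 (Or.inl le_rfl) fun r hr hrP => ?_
  rw [hw1 r (Finset.mem_Icc.2 ⟨hr, hrP⟩)]
  exact ⟨Or.inr, fun h' => h'.resolve_left (by omega)⟩

theorem eventually_limSelector_eq (h : LocalModel P p₀ c Q x₀ σ G x) {S : Fin P → ℝ}
    (hS : ∀ q ∈ Finset.Icc (p₀ + 1) P, c q * σ * xi Q q ≠ |limStat Q x₀ q S|)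
    {R : ℕ → Fin P → ℝ} (hR : Tendsto R atTop (𝓝 S)) :
    ∀ᶠ n in atTop, limSelector p₀ c Q x₀ σ (R n) = limSelector p₀ c Q x₀ σ S := by
  have h1 : ∀ q ∈ Finset.Icc (p₀ + 1) P, ∀ᶠ n in atTop,
      (c q * σ * xi Q q ≤ |limStat Q x₀ q (R n)| ↔ c q * σ * xi Q q ≤ |limStat Q x₀ q S|) :=
    fun q hq => eventually_le_iff_of_tendsto tendsto_const_nhds
      (((continuous_limStat Q x₀ q).tendsto S).comp hR).abs (hS q hq)
  filter_upwards [(Finset.eventually_all _).2 h1] with n hn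
  classical
  refine findGreatest_eq_of_iff h.le (Or.inl le_rfl) (Or.inl le_rfl) fun r hr hrP => ?_
  rw [hn r (Finset.mem_Icc.2 ⟨hr, hrP⟩)]

/-- The limiting test statistics have atomless laws. -/
theorem ae_ne_boundary (h : LocalModel P p₀ c Q x₀ σ G x) :
    ∀ᵐ S ∂(gaussLaw (σ ^ 2 • Q)),
      ∀ q ∈ Finset.Icc (p₀ + 1) P, c q * σ * xi Q q ≠ |limStat Q x₀ q S| := by
  rw [Finset.eventually_all]
  intro q hq
  have hq' := Finset.mem_Icc.1 hq
  have hξ : 0 < σ * xi Q q := mul_pos h.pos (xi_pos h.posDef (by omega) hq'.2)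
  have hlaw := map_coord_lsMat h.posDef σ q
  have hna : NullSingletonClass (gaussianReal 0 ((σ * xi Q q) ^ 2).toNNReal) :=
    nullSingletonClass_gaussianReal (by
      rw [ne_eq, Real.toNNReal_eq_zero, not_le]
      positivity)
  have hae : ∀ᵐ y ∂(gaussianReal 0 ((σ * xi Q q) ^ 2).toNNReal),
      c q * σ * xi Q q ≠ |y + statMean Q x₀ q| := by
    have hfin : ({c q * σ * xi Q q - statMean Q x₀ q,
        -(c q * σ * xi Q q) - statMean Q x₀ q} : Set ℝ).Finite := Set.toFinite _
    have := hfin.measure_zero (gaussianReal 0 ((σ * xi Q q) ^ 2).toNNReal)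
    filter_upwards [measure_eq_zero_iff_ae_notMem.1 this] with y hy h'
    refine hy ?_
    rcases abs_choice (y + statMean Q x₀ q) with h2 | h2
    · left; linarith
    · right; simp only [Set.mem_singleton_iff]; linarith
  rw [← hlaw] at hae
  exact ae_of_ae_map (continuous_coord_lsMat Q q).measurable.aemeasurable hae

end LocalModel

end Convergence

/-! ### Convergence of the law of the estimation error, known variance -/

section Laws

theorem abs_measureReal_sub_le_of_iff {α : Type*} [MeasurableSpace α] {μ : Measure α}
    [IsFiniteMeasure μ] {A B D : Set α} (h : ∀ ω, ω ∉ D → (ω ∈ A ↔ ω ∈ B)) :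
    |μ.real A - μ.real B| ≤ μ.real D := by
  have h1 : μ.real A ≤ μ.real B + μ.real D :=
    (measureReal_mono fun ω hω => by
      by_cases hD : ω ∈ D
      · exact Or.inr hD
      · exact Or.inl ((h ω hD).1 hω)).trans (measureReal_union_le B D)
  have h2 : μ.real B ≤ μ.real A + μ.real D :=
    (measureReal_mono fun ω hω => by
      by_cases hD : ω ∈ D
      · exact Or.inr hD
      · exact Or.inl ((h ω hD).2 hω)).trans (measureReal_union_le A D)
  rw [abs_le]
  constructor <;> linarith

theorem TVTendsto.tendsto_real {α : Type*} [MeasurableSpace α] {μ : ℕ → Measure α}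
    {ν : Measure α} (h : TVTendsto μ ν) {B : ℕ → Set α} (hB : ∀ n, MeasurableSet (B n)) {a : ℝ}
    (hν : Tendsto (fun n => ν.real (B n)) atTop (𝓝 a)) :
    Tendsto (fun n => (μ n).real (B n)) atTop (𝓝 a) := by
  have h0 : Tendsto (fun n => (μ n).real (B n) - ν.real (B n)) atTop (𝓝 0) := by
    rw [Metric.tendsto_nhds]
    intro ε hε
    filter_upwards [h (ε / 2) (by positivity)] with n hn
    rw [Real.dist_eq, sub_zero]
    linarith [hn (B n) (hB n)]
  simpa using h0.add hν

theorem tendsto_real_of_ae_iff {α β : Type*} [MeasurableSpace α] {μ : Measure α}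
    [IsFiniteMeasure μ] {l : Filter β} [l.IsCountablyGenerated] {A : β → Set α} {B : Set α}
    (hA : ∀ n, MeasurableSet (A n)) (hB : MeasurableSet B)
    (h : ∀ᵐ ω ∂μ, ∀ᶠ n in l, ω ∈ A n ↔ ω ∈ B) :
    Tendsto (fun n => μ.real (A n)) l (𝓝 (μ.real B)) :=
  (ENNReal.tendsto_toReal (measure_ne_top _ _)).comp
    (tendsto_measure_of_ae_tendsto_indicator_of_isFiniteMeasure l hB hA h)

/-- At a continuity point of the cdf, the boundary of the corresponding orthant has no mass. -/
theorem measure_Iic_diff_eq_zero {k : ℕ} {L : Measure (Fin k → ℝ)} [IsProbabilityMeasure L]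
    {t : Fin k → ℝ} (ht : ContinuousAt (cdfOf L) t) :
    L (Set.Iic t \ {y | ∀ i, y i < t i}) = 0 := by
  have hU : MeasurableSet {y : Fin k → ℝ | ∀ i, y i < t i} := by
    have : {y : Fin k → ℝ | ∀ i, y i < t i} = ⋂ i, {y | y i < t i} := by
      ext y; simp
    rw [this]
    exact MeasurableSet.iInter fun i => measurableSet_lt (measurable_pi_apply i) measurable_const
  have hsub : {y : Fin k → ℝ | ∀ i, y i < t i} ⊆ Set.Iic t := fun y hy i => (hy i).le
  have hseq : Tendsto (fun m : ℕ => t - fun _ => 1 / ((m : ℝ) + 1)) atTop (𝓝 t) := by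
    rw [tendsto_pi_nhds]
    intro i
    simpa using (tendsto_const_nhds (x := t i)).sub tendsto_one_div_add_atTop_nhds_zero_nat
  have hle : cdfOf L t ≤ L.real {y | ∀ i, y i < t i} := by
    refine le_of_tendsto (ht.tendsto.comp hseq) (Eventually.of_forall fun m => ?_)
    refine measureReal_mono fun y hy i => ?_
    have h1 := Set.mem_Iic.1 hy i
    have h2 : (0 : ℝ) < 1 / ((m : ℝ) + 1) := by positivity
    simp only [Pi.sub_apply] at h1
    linarith
  rw [← measureReal_eq_zero_iff, measureReal_sdiff hsub hU]
  have := measureReal_mono (μ := L) hsub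
  rw [cdfOf] at hle
  linarith

variable {P k : ℕ}

theorem measurable_scoreSelector (c : ℕ → ℝ) (M : Matrix (Fin P) (Fin P) ℝ) (x : Fin P → ℝ)
    (s : ℝ) : Measurable (scoreSelector c M x s) := by
  classical
  refine measurable_findGreatest fun q _ => ?_
  exact (isClosed_le continuous_const
    (((continuous_coord_lsMat M q).add continuous_const).div_const _).abs).measurableSet

/-- The scaled estimation error of the post-selection estimator with known variance, as a function
of the score. -/
noncomputable def selectedError (A : Matrix (Fin k) (Fin P) ℝ) (c : ℕ → ℝ)
    (M : Matrix (Fin P) (Fin P) ℝ) (x : Fin P → ℝ) (s : ℝ) (S : Fin P → ℝ) : Fin k → ℝ :=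
  scoreError A M x (scoreSelector c M x s S) S

theorem measurable_selectedError (A : Matrix (Fin k) (Fin P) ℝ) (c : ℕ → ℝ)
    (M : Matrix (Fin P) (Fin P) ℝ) (x : Fin P → ℝ) (s : ℝ) :
    Measurable (selectedError A c M x s) :=
  measurable_scoreError_comp A M x (measurable_scoreSelector c M x s)

namespace LocalModel

variable {Q : Matrix (Fin P) (Fin P) ℝ} {p₀ : ℕ} {c : ℕ → ℝ} {x₀ : Fin P → ℝ} {σ : ℝ}
  {G : ℕ → Matrix (Fin P) (Fin P) ℝ} {x : ℕ → Fin P → ℝ} {s : ℕ → ℝ}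

theorem posDef_smul (h : LocalModel P p₀ c Q x₀ σ G x) : (σ ^ 2 • Q).PosDef :=
  h.posDef.smul (pow_pos h.pos 2)

theorem tvTendsto_score (h : LocalModel P p₀ c Q x₀ σ G x) (hs : Tendsto s atTop (𝓝 σ)) :
    TVTendsto (fun n => gaussLaw (s n ^ 2 • G n)) (gaussLaw (σ ^ 2 • Q)) := by
  have h1 : ∀ᶠ n in atTop, (s n ^ 2 • G n).PosDef := by
    filter_upwards [h.eventually_posDef, hs.eventually (lt_mem_nhds h.pos)] with n hn hsn
    exact hn.smul (pow_pos hsn 2)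
  have h2 : Tendsto (fun n => s n ^ 2 • G n) atTop (𝓝 (σ ^ 2 • Q)) := by
    have hG := h.tendsto_gram
    rw [tendsto_matrix_iff] at *
    exact fun i j => (hs.pow 2).mul (hG i j)
  have h3 := tvTendsto_gaussLaw h.posDef_smul h1 h2 (tendsto_const_nhds (x := (0 : Fin P → ℝ)))
  simpa using h3

/-- The event that the selector with scale `t` differs from the limiting selector. -/
def badSet (p₀ : ℕ) (c : ℕ → ℝ) (Q : Matrix (Fin P) (Fin P) ℝ) (x₀ : Fin P → ℝ) (σ : ℝ)
    (M : Matrix (Fin P) (Fin P) ℝ) (y : Fin P → ℝ) (t : ℝ) : Set (Fin P → ℝ) :=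
  {S | scoreSelector c M y t S ≠ limSelector p₀ c Q x₀ σ S}

theorem measurableSet_badSet (M : Matrix (Fin P) (Fin P) ℝ) (y : Fin P → ℝ) (t : ℝ) :
    MeasurableSet (badSet p₀ c Q x₀ σ M y t) :=
  (measurableSet_eq_fun (measurable_scoreSelector c M y t)
    (measurable_limSelector p₀ c Q x₀ σ)).compl

theorem tendsto_badSet (h : LocalModel P p₀ c Q x₀ σ G x) :
    Tendsto (fun w : ℕ × ℝ => (gaussLaw (σ ^ 2 • Q)).real
      (badSet p₀ c Q x₀ σ (G w.1) (x w.1) w.2)) (atTop ×ˢ 𝓝 σ) (𝓝 0) := by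
  have := tendsto_real_of_ae_iff (μ := gaussLaw (σ ^ 2 • Q)) (l := (atTop : Filter ℕ) ×ˢ 𝓝 σ)
    (A := fun w => badSet p₀ c Q x₀ σ (G w.1) (x w.1) w.2) (B := ∅)
    (fun w => measurableSet_badSet _ _ _) MeasurableSet.empty (by
      filter_upwards [h.ae_ne_boundary] with S hS
      filter_upwards [h.eventually_scoreSelector_eq hS] with w hw
      simp [badSet, hw])
  simpa using this

theorem tendsto_badSet_seq (h : LocalModel P p₀ c Q x₀ σ G x) (hs : Tendsto s atTop (𝓝 σ)) :
    Tendsto (fun n => (gaussLaw (σ ^ 2 • Q)).real (badSet p₀ c Q x₀ σ (G n) (x n) (s n)))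
      atTop (𝓝 0) := by
  have h2 : Tendsto (fun n => (n, s n)) atTop (atTop ×ˢ 𝓝 σ) := tendsto_id.prodMk hs
  have h3 := h.tendsto_badSet.comp h2
  exact h3

theorem tendsto_scoreError (h : LocalModel P p₀ c Q x₀ σ G x) (A : Matrix (Fin k) (Fin P) ℝ)
    {p : ℕ} (hp : p₀ ≤ p) (S : Fin P → ℝ) :
    Tendsto (fun n => scoreError A (G n) (x n) p S) atTop (𝓝 (scoreError A Q x₀ p S)) :=
  tendsto_mulVec tendsto_const_nhds ((tendsto_mulVec
    (tendsto_lsMat h.posDef h.tendsto_gram p) tendsto_const_nhds).add (h.tendsto_bias hp))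

theorem ae_tendsto_selectedError (h : LocalModel P p₀ c Q x₀ σ G x)
    (hs : Tendsto s atTop (𝓝 σ)) (A : Matrix (Fin k) (Fin P) ℝ) :
    ∀ᵐ S ∂(gaussLaw (σ ^ 2 • Q)), Tendsto (fun n => selectedError A c (G n) (x n) (s n) S) atTop
      (𝓝 (limError p₀ A c Q x₀ σ S)) := by
  filter_upwards [h.ae_ne_boundary] with S hS
  have h1 : ∀ᶠ n in atTop, scoreSelector c (G n) (x n) (s n) S = limSelector p₀ c Q x₀ σ S :=
    (tendsto_id.prodMk hs).eventually (h.eventually_scoreSelector_eq hS)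
  refine (h.tendsto_scoreError A (p := limSelector p₀ c Q x₀ σ S)
    (Finset.mem_Icc.1 (limSelector_mem h.le c Q x₀ σ S)).1 S).congr' ?_
  filter_upwards [h1] with n hn
  rw [selectedError, hn]

/-- Weak convergence of the law of the estimation error, known variance. -/
theorem tendsto_cdf (h : LocalModel P p₀ c Q x₀ σ G x) (hs : Tendsto s atTop (𝓝 σ))
    (A : Matrix (Fin k) (Fin P) ℝ) {t : Fin k → ℝ}
    (ht : ContinuousAt (cdfOf ((gaussLaw (σ ^ 2 • Q)).map (limError p₀ A c Q x₀ σ))) t) :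
    Tendsto (fun n => cdfOf ((gaussLaw (s n ^ 2 • G n)).map
      (selectedError A c (G n) (x n) (s n))) t) atTop
      (𝓝 (cdfOf ((gaussLaw (σ ^ 2 • Q)).map (limError p₀ A c Q x₀ σ)) t)) := by
  have hm := measurable_limError p₀ A c Q x₀ σ
  have hmn := fun n => measurable_selectedError A c (G n) (x n) (s n)
  have : IsProbabilityMeasure ((gaussLaw (σ ^ 2 • Q)).map (limError p₀ A c Q x₀ σ)) :=
    Measure.isProbabilityMeasure_map hm.aemeasurable
  have hnull := measure_Iic_diff_eq_zero ht
  have hnull' := ae_of_ae_map hm.aemeasurable (measure_eq_zero_iff_ae_notMem.1 hnull)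
  simp only [cdfOf]
  rw [map_measureReal_apply hm measurableSet_Iic]
  simp_rw [fun n => map_measureReal_apply (μ := gaussLaw (s n ^ 2 • G n)) (hmn n)
    (measurableSet_Iic (a := t))]
  refine (h.tvTendsto_score hs).tendsto_real (fun n => hmn n measurableSet_Iic) ?_
  refine tendsto_real_of_ae_iff (fun n => hmn n measurableSet_Iic) (hm measurableSet_Iic) ?_
  filter_upwards [hnull', h.ae_tendsto_selectedError hs A] with S hS hlim
  simp only [Set.mem_preimage]
  by_cases hmem : limError p₀ A c Q x₀ σ S ∈ Set.Iic t
  · have hlt : ∀ i, limError p₀ A c Q x₀ σ S i < t i := by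
      by_contra hcon
      exact hS ⟨hmem, hcon⟩
    rw [tendsto_pi_nhds] at hlim
    filter_upwards [eventually_all.2 fun i => (hlim i).eventually (gt_mem_nhds (hlt i))] with n hn
    exact iff_of_true (fun i => (hn i).le) hmem
  · filter_upwards [hlim.eventually (isClosed_Iic.isOpen_compl.mem_nhds hmem)] with n hn
    exact iff_of_false hn hmem

/-- The linear part of the affine map which turns the estimation error of the `n`-th experiment
into that of the limit experiment. -/
noncomputable def transport (Q M : Matrix (Fin P) (Fin P) ℝ) (p : ℕ) : Matrix (Fin P) (Fin P) ℝ :=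
  1 + Q * (lsMat M p - lsMat Q p)

theorem lsMat_mul_transport (hQ : Q.PosDef) (M : Matrix (Fin P) (Fin P) ℝ) (p : ℕ) :
    lsMat Q p * transport Q M p = lsMat M p := by
  have h1 : lsMat Q p * Q * lsMat M p = lsMat M p := by
    rw [lsMat.eq_def M, ← Matrix.mul_assoc, ← Matrix.mul_assoc, lsMat_mul_mul_headIncl hQ]
  rw [transport, Matrix.mul_add, Matrix.mul_one, Matrix.mul_sub, Matrix.mul_sub,
    ← Matrix.mul_assoc, h1, ← Matrix.mul_assoc, lsMat_mul_mul_lsMat hQ]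
  abel

/-- If the biases differ by a vector in the column space of `A[p]`, then the estimation error is the
limiting one at an affine image of the score. -/
theorem scoreError_transport (hQ : Q.PosDef) (A : Matrix (Fin k) (Fin P) ℝ)
    (M : Matrix (Fin P) (Fin P) ℝ) (p : ℕ) (y x₀ : Fin P → ℝ)
    {w : {j : Fin P // (j : ℕ) < p} → ℝ}
    (hw : A *ᵥ biasVec M p y - A *ᵥ biasVec Q p x₀ = headCols A p *ᵥ w) (S : Fin P → ℝ) :
    scoreError A M y p S =
      scoreError A Q x₀ p (transport Q M p *ᵥ S + Q *ᵥ (headIncl P p *ᵥ w)) := by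
  rw [scoreError, scoreError, Matrix.mulVec_add, Matrix.mulVec_add, Matrix.mulVec_add (lsMat Q p),
    Matrix.mulVec_mulVec _ (lsMat Q p), lsMat_mul_transport hQ, Matrix.mulVec_mulVec _ (lsMat Q p),
    Matrix.mulVec_mulVec _ _ (headIncl P p), lsMat_mul_mul_headIncl hQ, Matrix.mulVec_add,
    Matrix.mulVec_mulVec _ A (headIncl P p), ← headCols_eq, ← hw]
  abel

theorem tendsto_transport (h : LocalModel P p₀ c Q x₀ σ G x) (p : ℕ) :
    Tendsto (fun n => transport Q (G n) p) atTop (𝓝 1) := by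
  have h1 : Tendsto (fun n => lsMat (G n) p - lsMat Q p) atTop (𝓝 0) := by
    have := tendsto_lsMat h.posDef h.tendsto_gram p
    rw [tendsto_matrix_iff] at *
    intro i j
    simpa using (this i j).sub_const (lsMat Q p i j)
  have h2 := tendsto_matrix_mul (tendsto_const_nhds (x := Q)) h1
  rw [Matrix.mul_zero] at h2
  rw [tendsto_matrix_iff] at *
  intro i j
  simpa [transport] using (h2 i j).const_add ((1 : Matrix (Fin P) (Fin P) ℝ) i j)

theorem tvTendsto_transport (h : LocalModel P p₀ c Q x₀ σ G x) (p : ℕ)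
    {r : ℕ → Fin P → ℝ} (hr : Tendsto r atTop (𝓝 0)) :
    TVTendsto (fun n => (gaussLaw (σ ^ 2 • Q)).map
      (fun S => transport Q (G n) p *ᵥ S + r n)) (gaussLaw (σ ^ 2 • Q)) := by
  have hR := h.tendsto_transport p
  have hRt : Tendsto (fun n => (transport Q (G n) p)ᵀ) atTop (𝓝 1) := by
    rw [tendsto_matrix_iff] at *
    intro i j
    have h1 := hR j i
    rwa [← Matrix.transpose_apply (1 : Matrix (Fin P) (Fin P) ℝ), Matrix.transpose_one] at h1
  have hcov := tendsto_matrix_mul (tendsto_matrix_mul hR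
    (tendsto_const_nhds (x := σ ^ 2 • Q))) hRt
  rw [Matrix.one_mul, Matrix.mul_one] at hcov
  have hpd : ∀ᶠ n in atTop,
      (transport Q (G n) p * (σ ^ 2 • Q) * (transport Q (G n) p)ᵀ).PosDef := by
    filter_upwards [(tendsto_matrix_det hcov).eventually_ne h.posDef_smul.det_pos.ne'] with n hn
    refine PosSemidef.posDef_iff_det_ne_zero ?_ |>.2 hn
    have := h.posDef_smul.posSemidef.mul_mul_conjTranspose_same (transport Q (G n) p)
    rwa [conjTranspose_eq_transpose_of_trivial] at this
  have htv := tvTendsto_gaussLaw h.posDef_smul hpd hcov hr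
  have heq : ∀ n, (gaussLaw (σ ^ 2 • Q)).map (fun S => transport Q (G n) p *ᵥ S + r n) =
      (gaussLaw (transport Q (G n) p * (σ ^ 2 • Q) * (transport Q (G n) p)ᵀ)).map
        (fun S => S + r n) := by
    intro n
    rw [← gaussLaw_map_mulVec h.posDef_smul.posSemidef, Measure.map_map (by fun_prop)
      (measurable_mulVec _)]
    rfl
  simp_rw [heq]
  simpa using htv

theorem measurable_affine (R : Matrix (Fin P) (Fin P) ℝ) (r : Fin P → ℝ) :
    Measurable fun S : Fin P → ℝ => R *ᵥ S + r :=
  (measurable_mulVec R).add_const r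

/-- Total variation convergence of the law of the estimation error, known variance: it is enough
that the biases differ from their limits by vectors in the column space of `A[p]`. -/
theorem tvTendsto_selectedError (h : LocalModel P p₀ c Q x₀ σ G x) (hs : Tendsto s atTop (𝓝 σ))
    (A : Matrix (Fin k) (Fin P) ℝ)
    (hA : ∀ p, p₀ ≤ p → p ≤ P → ∃ w : ℕ → {j : Fin P // (j : ℕ) < p} → ℝ,
      Tendsto w atTop (𝓝 0) ∧ ∀ᶠ n in atTop,
        A *ᵥ biasVec (G n) p (x n) - A *ᵥ biasVec Q p x₀ = headCols A p *ᵥ w n) :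
    TVTendsto (fun n => (gaussLaw (s n ^ 2 • G n)).map (selectedError A c (G n) (x n) (s n)))
      ((gaussLaw (σ ^ 2 • Q)).map (limError p₀ A c Q x₀ σ)) := by
  set ν := gaussLaw (σ ^ 2 • Q) with hν
  have hsel := measurable_limSelector p₀ c Q x₀ σ
  -- convergence of the part of the law on which the order `p` is selected
  have hpart : ∀ p, p₀ ≤ p → p ≤ P → ∀ ε > 0, ∀ᶠ n in atTop, ∀ B : Set (Fin k → ℝ),
      MeasurableSet B →
        |ν.real {S | limSelector p₀ c Q x₀ σ S = p ∧ scoreError A (G n) (x n) p S ∈ B} -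
          ν.real {S | limSelector p₀ c Q x₀ σ S = p ∧ scoreError A Q x₀ p S ∈ B}| ≤ ε := by
    intro p hp hpP ε hε
    obtain ⟨w, hw0, hw⟩ := hA p hp hpP
    set r : ℕ → Fin P → ℝ := fun n => Q *ᵥ (headIncl P p *ᵥ w n) with hr
    have hr0 : Tendsto r atTop (𝓝 0) := by
      have := tendsto_mulVec (tendsto_const_nhds (x := Q) (f := (atTop : Filter ℕ)))
        (tendsto_mulVec (tendsto_const_nhds (x := headIncl P p)) hw0)
      rw [Matrix.mulVec_zero, Matrix.mulVec_zero] at this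
      exact this
    set R : ℕ → (Fin P → ℝ) → Fin P → ℝ := fun n S => transport Q (G n) p *ᵥ S + r n with hRdef
    have hRm : ∀ n, Measurable (R n) := fun n => measurable_affine _ _
    have hRlim : ∀ S, Tendsto (fun n => R n S) atTop (𝓝 S) := by
      intro S
      have := (tendsto_mulVec (h.tendsto_transport p) (tendsto_const_nhds (x := S))).add hr0
      simpa using this
    have hDm : ∀ n, MeasurableSet {S | limSelector p₀ c Q x₀ σ (R n S) ≠
        limSelector p₀ c Q x₀ σ S} := fun n =>
      (measurableSet_eq_fun (hsel.comp (hRm n)) hsel).compl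
    have hD : Tendsto (fun n => ν.real {S | limSelector p₀ c Q x₀ σ (R n S) ≠
        limSelector p₀ c Q x₀ σ S}) atTop (𝓝 0) := by
      have := tendsto_real_of_ae_iff (μ := ν) (l := atTop) (B := ∅) hDm MeasurableSet.empty (by
        filter_upwards [h.ae_ne_boundary] with S hS
        filter_upwards [h.eventually_limSelector_eq hS (hRlim S)] with n hn
        simp [hn])
      simpa using this
    filter_upwards [hw, hD.eventually (gt_mem_nhds (half_pos hε)),
      h.tvTendsto_transport p hr0 (ε / 2) (half_pos hε)] with n hwn hDn hTV B hB
    have hE : MeasurableSet {S | limSelector p₀ c Q x₀ σ S = p ∧ scoreError A Q x₀ p S ∈ B} :=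
      (hsel (measurableSet_singleton p)).inter ((continuous_scoreError A Q x₀ p).measurable hB)
    have h1 := hTV _ hE
    rw [map_measureReal_apply (hRm n) hE] at h1
    have h2 : |ν.real {S | limSelector p₀ c Q x₀ σ S = p ∧ scoreError A (G n) (x n) p S ∈ B} -
        ν.real (R n ⁻¹' {S | limSelector p₀ c Q x₀ σ S = p ∧ scoreError A Q x₀ p S ∈ B})| ≤
          ν.real {S | limSelector p₀ c Q x₀ σ (R n S) ≠ limSelector p₀ c Q x₀ σ S} := by
      refine abs_measureReal_sub_le_of_iff fun S hS => ?_
      have hS' : limSelector p₀ c Q x₀ σ (R n S) = limSelector p₀ c Q x₀ σ S := not_not.1 hS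
      simp only [Set.mem_ofPred_eq, Set.mem_preimage, hS']
      rw [scoreError_transport h.posDef A (G n) p (x n) x₀ hwn S]
    have h3 := abs_sub_le
      (ν.real {S | limSelector p₀ c Q x₀ σ S = p ∧ scoreError A (G n) (x n) p S ∈ B})
      (ν.real (R n ⁻¹' {S | limSelector p₀ c Q x₀ σ S = p ∧ scoreError A Q x₀ p S ∈ B}))
      (ν.real {S | limSelector p₀ c Q x₀ σ S = p ∧ scoreError A Q x₀ p S ∈ B})
    linarith
  intro ε hε
  set N : ℝ := ((Finset.Icc p₀ P).card : ℝ) + 1 with hN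
  have hNpos : 0 < N := by positivity
  have hparts := (Finset.eventually_all (Finset.Icc p₀ P)).2 fun p hp =>
    hpart p (Finset.mem_Icc.1 hp).1 (Finset.mem_Icc.1 hp).2 (ε / 3 / N) (by positivity)
  filter_upwards [hparts, h.tvTendsto_score hs (ε / 3) (by positivity),
    (h.tendsto_badSet_seq hs).eventually (gt_mem_nhds (by positivity : 0 < ε / 3))]
    with n hn hTV hbad B hB
  have hmn := measurable_selectedError A c (G n) (x n) (s n)
  have hm := measurable_limError p₀ A c Q x₀ σ
  rw [map_measureReal_apply hmn hB, map_measureReal_apply hm hB]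
  have h1 := hTV _ (hmn hB)
  -- split a set according to the order selected in the limit experiment
  have hsplit : ∀ F : ℕ → (Fin P → ℝ) → Fin k → ℝ, (∀ p, Measurable (F p)) →
      ν.real {S | F (limSelector p₀ c Q x₀ σ S) S ∈ B} =
        ∑ p ∈ Finset.Icc p₀ P, ν.real {S | limSelector p₀ c Q x₀ σ S = p ∧ F p S ∈ B} := by
    intro F hF
    have : {S | F (limSelector p₀ c Q x₀ σ S) S ∈ B} =
        ⋃ p ∈ Finset.Icc p₀ P, {S | limSelector p₀ c Q x₀ σ S = p ∧ F p S ∈ B} := by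
      ext S
      simp only [Set.mem_ofPred_eq, Set.mem_iUnion]
      constructor
      · exact fun h' => ⟨_, limSelector_mem h.le c Q x₀ σ S, rfl, h'⟩
      · rintro ⟨p, -, rfl, h'⟩
        exact h'
    rw [this, measureReal_biUnion_finset]
    · intro p _ q _ hpq
      rw [Function.onFun, Set.disjoint_left]
      exact fun S h1 h2 => hpq (h1.1.symm.trans h2.1)
    · exact fun p _ => (hsel (measurableSet_singleton p)).inter (hF p hB)
  have h2 : |ν.real (selectedError A c (G n) (x n) (s n) ⁻¹' B) -
      ν.real {S | scoreError A (G n) (x n) (limSelector p₀ c Q x₀ σ S) S ∈ B}| ≤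
        ν.real (badSet p₀ c Q x₀ σ (G n) (x n) (s n)) := by
    refine abs_measureReal_sub_le_of_iff fun S hS => ?_
    have hS' : scoreSelector c (G n) (x n) (s n) S = limSelector p₀ c Q x₀ σ S := not_not.1 hS
    simp only [Set.mem_preimage, selectedError, hS', Set.mem_ofPred_eq]
  have h3 : |ν.real {S | scoreError A (G n) (x n) (limSelector p₀ c Q x₀ σ S) S ∈ B} -
      ν.real (limError p₀ A c Q x₀ σ ⁻¹' B)| ≤ ε / 3 := by
    have h4 : limError p₀ A c Q x₀ σ ⁻¹' B =
        {S | scoreError A Q x₀ (limSelector p₀ c Q x₀ σ S) S ∈ B} := rfl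
    rw [h4, hsplit _ fun p => (continuous_scoreError A (G n) (x n) p).measurable,
      hsplit _ fun p => (continuous_scoreError A Q x₀ p).measurable, ← Finset.sum_sub_distrib]
    calc _ ≤ ∑ p ∈ Finset.Icc p₀ P, ε / 3 / N :=
          (Finset.abs_sum_le_sum_abs _ _).trans (Finset.sum_le_sum fun p hp => hn p hp B hB)
      _ = ((Finset.Icc p₀ P).card : ℝ) * (ε / 3 / N) := by rw [Finset.sum_const, nsmul_eq_mul]
      _ ≤ N * (ε / 3 / N) := by
          refine mul_le_mul_of_nonneg_right ?_ (by positivity)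
          rw [hN]; linarith
      _ = ε / 3 := by field_simp
  rw [abs_le] at *
  constructor <;> linarith [h1.1, h1.2, h2.1, h2.2, h3.1, h3.2]

end LocalModel

end Laws

/-! ### Estimated variance -/

section VarianceEstimator

theorem memLp_sq_gaussianReal (m : ℝ) (v : NNReal) :
    MemLp (fun z : ℝ => z ^ 2) 2 (gaussianReal m v) := by
  have h := (memLp_id_gaussianReal (μ := m) (v := v) 4).integrable_norm_pow (by norm_num)
  refine (memLp_two_iff_integrable_sq (by fun_prop)).2 (h.congr (ae_of_all _ fun z => ?_))
  simp only [id, Real.norm_eq_abs, ← pow_mul]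
  exact (even_two_mul 2).pow_abs z

theorem integral_sq_gaussianReal (v : NNReal) : ∫ z, z ^ 2 ∂(gaussianReal 0 v) = v := by
  have := variance_of_integral_eq_zero (X := (id : ℝ → ℝ)) (μ := gaussianReal 0 v)
    aemeasurable_id (by simp)
  rw [variance_id_gaussianReal] at this
  simpa using this.symm

theorem variance_sq_gaussianReal (s : ℝ) :
    Var[fun z => z ^ 2; gaussianReal 0 (s ^ 2).toNNReal] =
      s ^ 4 * Var[fun z => z ^ 2; gaussianReal 0 1] := by
  have h := gaussianReal_map_const_mul (μ := 0) (v := 1) s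
  have h2 : gaussianReal 0 (s ^ 2).toNNReal = (gaussianReal 0 1).map (s * ·) := by
    rw [h, mul_zero, mul_one]
    congr 1
    exact Real.toNNReal_of_nonneg (sq_nonneg s)
  rw [h2, variance_map (by fun_prop) (by fun_prop)]
  have h3 : (fun z : ℝ => z ^ 2) ∘ (fun z => s * z) = fun z => s ^ 2 * z ^ 2 := by
    ext z; simp [mul_pow]
  rw [h3, variance_const_mul]
  ring

/-- Chebyshev's inequality for the sum of squares of `n` independent centered Gaussian errors. -/
theorem real_sum_sq_deviation_le (n : ℕ) (s : ℝ) {a : ℝ} (ha : 0 < a) :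
    (Measure.pi fun _ : Fin n => gaussianReal 0 (s ^ 2).toNNReal).real
        {u | a ≤ |u ⬝ᵥ u - n * s ^ 2|} ≤
      n * (s ^ 4 * Var[fun z => z ^ 2; gaussianReal 0 1]) / a ^ 2 := by
  set μ := Measure.pi fun _ : Fin n => gaussianReal 0 (s ^ 2).toNNReal with hμ
  have hLp : ∀ i : Fin n, MemLp (fun u : Fin n → ℝ => u i ^ 2) 2 μ := fun i =>
    (memLp_sq_gaussianReal 0 (s ^ 2).toNNReal).comp_measurePreserving (measurePreserving_eval _ i)
  have hsum : (fun u : Fin n → ℝ => u ⬝ᵥ u) = ∑ i, fun u : Fin n → ℝ => u i ^ 2 := by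
    ext u
    simp [dotProduct, pow_two]
  have hmean : μ[fun u : Fin n → ℝ => u ⬝ᵥ u] = n * s ^ 2 := by
    have h1 : (fun u : Fin n → ℝ => u ⬝ᵥ u) = fun u => ∑ i, u i ^ 2 := by
      ext u
      simp [dotProduct, pow_two]
    rw [h1, integral_finsetSum _ fun i _ => (hLp i).integrable (by norm_num)]
    have h2 : ∀ i : Fin n, ∫ u, u i ^ 2 ∂μ = s ^ 2 := by
      intro i
      have h3 := integral_comp_eval (X := fun _ : Fin n => ℝ)
        (μ := fun _ => gaussianReal 0 (s ^ 2).toNNReal) (i := i) (f := fun z : ℝ => z ^ 2)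
        (by fun_prop)
      rw [hμ, h3, integral_sq_gaussianReal, Real.coe_toNNReal _ (sq_nonneg s)]
    simp [h2]
  have hvar : Var[fun u : Fin n → ℝ => u ⬝ᵥ u; μ] =
      n * (s ^ 4 * Var[fun z => z ^ 2; gaussianReal 0 1]) := by
    rw [hsum, hμ, variance_sum_pi (X := fun _ z => z ^ 2) fun _ => memLp_sq_gaussianReal 0 _]
    simp [variance_sq_gaussianReal]
  have hX : MemLp (fun u : Fin n → ℝ => u ⬝ᵥ u) 2 μ := by
    rw [hsum]
    exact memLp_finsetSum' _ fun i _ => hLp i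
  have h := meas_ge_le_variance_div_sq hX ha
  rw [hmean, hvar] at h
  rw [measureReal_def]
  refine ENNReal.toReal_le_of_le_ofReal ?_ h
  have := variance_nonneg (fun z : ℝ => z ^ 2) (gaussianReal 0 1)
  positivity

namespace LocalModel

variable {P : ℕ} {Q : Matrix (Fin P) (Fin P) ℝ} {p₀ : ℕ} {c : ℕ → ℝ} {x₀ : Fin P → ℝ} {σ : ℝ}
  {X : ∀ n : ℕ, Matrix (Fin n) (Fin P) ℝ} {x : ℕ → Fin P → ℝ} {s : ℕ → ℝ}

theorem measurable_score {n : ℕ} (X : Matrix (Fin n) (Fin P) ℝ) : Measurable (score X) :=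
  measurable_mulVec _

/-- Consistency of the unbiased variance estimator. -/
theorem tendsto_sigmaHatSq (h : LocalModel P p₀ c Q x₀ σ (fun n => PostSel.gram (X n)) x)
    (hs : Tendsto s atTop (𝓝 σ)) (θ : ℕ → Fin P → ℝ) {η : ℝ} (hη : 0 < η) :
    Tendsto (fun n => (Measure.pi fun _ : Fin n => gaussianReal 0 (s n ^ 2).toNNReal).real
      {u | η ≤ |sigmaHatSq (X n) (X n *ᵥ θ n + u) - σ ^ 2|}) atTop (𝓝 0) := by
  have hcast : Tendsto (fun n : ℕ => (n : ℝ)) atTop atTop := tendsto_natCast_atTop_atTop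
  have hinv : Tendsto (fun n : ℕ => ((n : ℝ) - P)⁻¹) atTop (𝓝 0) :=
    (tendsto_atTop_add_const_right _ _ hcast).inv_tendsto_atTop
  have hratio : Tendsto (fun n : ℕ => (n : ℝ) * ((n : ℝ) - P)⁻¹) atTop (𝓝 1) := by
    have h1 : Tendsto (fun n : ℕ => 1 + (P : ℝ) * ((n : ℝ) - P)⁻¹) atTop (𝓝 1) := by
      simpa using (hinv.const_mul (P : ℝ)).const_add 1
    refine h1.congr' ?_
    filter_upwards [eventually_gt_atTop P] with n hn
    have : (n : ℝ) - P ≠ 0 := by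
      have : (P : ℝ) < n := by exact_mod_cast hn
      linarith
    field_simp
    ring
  set V := Var[fun z : ℝ => z ^ 2; gaussianReal 0 1]
  -- the fluctuations of the sum of squared errors
  have hA : Tendsto (fun n : ℕ => (n : ℝ) * (s n ^ 4 * V) / (((n : ℝ) - P) * (η / 3)) ^ 2) atTop
      (𝓝 0) := by
    have h1 : Tendsto (fun n : ℕ => ((n : ℝ) * ((n : ℝ) - P)⁻¹) * ((n : ℝ) - P)⁻¹ *
        (s n ^ 4 * V / (η / 3) ^ 2)) atTop (𝓝 (1 * 0 * (σ ^ 4 * V / (η / 3) ^ 2))) :=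
      (hratio.mul hinv).mul (((hs.pow 4).mul_const V).div_const _)
    rw [mul_zero, zero_mul] at h1
    refine h1.congr fun n => ?_
    generalize hr : (n : ℝ) - P = r
    rw [mul_pow]
    rcases eq_or_ne r 0 with rfl | hr0
    · simp
    · field_simp
  -- the explained sum of squares is of bounded order
  set B : ℕ → Set (Fin P → ℝ) := fun n =>
    {S | η / 3 ≤ |((n : ℝ) - P)⁻¹ * (S ⬝ᵥ (PostSel.gram (X n))⁻¹ *ᵥ S)|} with hB
  have hBm : ∀ n, MeasurableSet (B n) := by
    intro n
    have : Continuous fun S : Fin P → ℝ =>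
        |((n : ℝ) - P)⁻¹ * (S ⬝ᵥ (PostSel.gram (X n))⁻¹ *ᵥ S)| :=
      (continuous_const.mul
        (continuous_id.dotProduct (continuous_const.matrix_mulVec continuous_id))).abs
    exact (isClosed_le continuous_const this).measurableSet
  have hBν : Tendsto (fun n => (gaussLaw (σ ^ 2 • Q)).real (B n)) atTop (𝓝 0) := by
    have := tendsto_real_of_ae_iff (μ := gaussLaw (σ ^ 2 • Q)) (l := atTop) (B := ∅) hBm
      MeasurableSet.empty (ae_of_all _ fun S => by
        have h1 : Tendsto (fun n : ℕ => |((n : ℝ) - P)⁻¹ *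
            (S ⬝ᵥ (PostSel.gram (X n))⁻¹ *ᵥ S)|) atTop (𝓝 0) := by
          have h2 := tendsto_dotProduct_const S (tendsto_mulVec
            (tendsto_matrix_inv h.tendsto_gram h.posDef.det_pos.ne') (tendsto_const_nhds (x := S)))
          simpa using (hinv.mul h2).abs
        filter_upwards [h1.eventually (gt_mem_nhds (by positivity : 0 < η / 3))] with n hn
        simp only [hB, Set.mem_ofPred_eq, Set.mem_empty_iff_false, iff_false, not_le]
        exact hn)
    simpa using this
  have hBn := (h.tvTendsto_score hs).tendsto_real hBm hBν
  have hC : Tendsto (fun n : ℕ => (n : ℝ) * ((n : ℝ) - P)⁻¹ * s n ^ 2) atTop (𝓝 (σ ^ 2)) := by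
    simpa using hratio.mul (hs.pow 2)
  have hC' : ∀ᶠ n : ℕ in atTop, |(n : ℝ) * ((n : ℝ) - P)⁻¹ * s n ^ 2 - σ ^ 2| < η / 3 := by
    have := (Metric.tendsto_nhds.1 hC) (η / 3) (by positivity)
    simpa [Real.dist_eq] using this
  have hsum := hA.add hBn
  rw [add_zero] at hsum
  refine squeeze_zero' (Eventually.of_forall fun n => measureReal_nonneg) ?_ hsum
  filter_upwards [hC', h.eventually_posDef, eventually_gt_atTop P] with n hCn hGn hn
  have hn0 : 0 < n := by omega
  have hnP : 0 < (n : ℝ) - P := by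
    have : (P : ℝ) < n := by exact_mod_cast hn
    linarith
  set μ := Measure.pi fun _ : Fin n => gaussianReal 0 (s n ^ 2).toNNReal with hμ
  have hsub : {u | η ≤ |sigmaHatSq (X n) (X n *ᵥ θ n + u) - σ ^ 2|} ⊆
      {u | ((n : ℝ) - P) * (η / 3) ≤ |u ⬝ᵥ u - n * s n ^ 2|} ∪ score (X n) ⁻¹' B n := by
    intro u hu
    by_contra hcon
    rw [Set.mem_union, not_or] at hcon
    obtain ⟨h1, h2⟩ := hcon
    simp only [Set.mem_ofPred_eq, not_le] at h1
    simp only [hB, Set.mem_preimage, Set.mem_ofPred_eq, not_le] at h2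
    simp only [Set.mem_ofPred_eq, sigmaHatSq_eq hn0 hGn] at hu
    have h3 : |((n : ℝ) - P)⁻¹ * (u ⬝ᵥ u - n * s n ^ 2)| < η / 3 := by
      rw [abs_mul, abs_of_pos (inv_pos.2 hnP), inv_mul_lt_iff₀ hnP]
      exact h1
    have h4 : ((n : ℝ) - P)⁻¹ *
        (u ⬝ᵥ u - score (X n) u ⬝ᵥ (PostSel.gram (X n))⁻¹ *ᵥ score (X n) u) - σ ^ 2 =
        ((n : ℝ) - P)⁻¹ * (u ⬝ᵥ u - n * s n ^ 2) -
        ((n : ℝ) - P)⁻¹ * (score (X n) u ⬝ᵥ (PostSel.gram (X n))⁻¹ *ᵥ score (X n) u) +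
        ((n : ℝ) * ((n : ℝ) - P)⁻¹ * s n ^ 2 - σ ^ 2) := by ring
    rw [h4] at hu
    rw [abs_lt] at h2 h3 hCn
    have := abs_lt.2 (⟨by linarith, by linarith⟩ :
      -η < ((n : ℝ) - P)⁻¹ * (u ⬝ᵥ u - n * s n ^ 2) -
        ((n : ℝ) - P)⁻¹ * (score (X n) u ⬝ᵥ (PostSel.gram (X n))⁻¹ *ᵥ score (X n) u) +
        ((n : ℝ) * ((n : ℝ) - P)⁻¹ * s n ^ 2 - σ ^ 2) ∧ _ < η)
    exact absurd this (not_lt.2 hu)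
  calc μ.real {u | η ≤ |sigmaHatSq (X n) (X n *ᵥ θ n + u) - σ ^ 2|}
      ≤ μ.real {u | ((n : ℝ) - P) * (η / 3) ≤ |u ⬝ᵥ u - n * s n ^ 2|} +
        μ.real (score (X n) ⁻¹' B n) := (measureReal_mono hsub).trans (measureReal_union_le _ _)
    _ ≤ _ := by
        refine add_le_add (real_sum_sq_deviation_le n (s n) (by positivity)) (le_of_eq ?_)
        rw [← map_measureReal_apply (measurable_score _) (hBm n), hμ, map_score]

theorem tendsto_sqrt_sigmaHatSq
    (h : LocalModel P p₀ c Q x₀ σ (fun n => PostSel.gram (X n)) x)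
    (hs : Tendsto s atTop (𝓝 σ)) (θ : ℕ → Fin P → ℝ) {ε : ℝ} (hε : 0 < ε) :
    Tendsto (fun n => (Measure.pi fun _ : Fin n => gaussianReal 0 (s n ^ 2).toNNReal).real
      {u | ε ≤ |√(sigmaHatSq (X n) (X n *ᵥ θ n + u)) - σ|}) atTop (𝓝 0) := by
  have hc := Metric.continuousAt_iff.1 (Real.continuous_sqrt.continuousAt (x := σ ^ 2)) ε hε
  obtain ⟨η, hη, hη'⟩ := hc
  refine squeeze_zero (fun n => measureReal_nonneg) (fun n => measureReal_mono fun u hu => ?_)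
    (h.tendsto_sigmaHatSq hs θ hη)
  by_contra hcon
  simp only [Set.mem_ofPred_eq, not_le] at hu hcon
  have := hη' (x := sigmaHatSq (X n) (X n *ᵥ θ n + u)) (by rwa [Real.dist_eq])
  rw [Real.dist_eq, Real.sqrt_sq h.pos.le] at this
  exact absurd this (not_lt.2 hu)

/-- A smaller scale inflates all statistics, so that more hypotheses are rejected. -/
theorem scoreSelector_antitone (c : ℕ → ℝ) (M : Matrix (Fin P) (Fin P) ℝ) (y : Fin P → ℝ)
    (S : Fin P → ℝ) {s₁ s₂ : ℝ} (h₁ : 0 < s₁) (h₁₂ : s₁ ≤ s₂) :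
    scoreSelector c M y s₂ S ≤ scoreSelector c M y s₁ S := by
  classical
  refine Nat.findGreatest_mono_left (fun q hq => hq.trans ?_) P
  have hξ : 0 ≤ xi M q := Real.sqrt_nonneg _
  rw [abs_div, abs_div, abs_of_nonneg (mul_nonneg (h₁.le.trans h₁₂) hξ),
    abs_of_nonneg (mul_nonneg h₁.le hξ)]
  rcases hξ.eq_or_lt with h0 | h0
  · rw [← h0, mul_zero, mul_zero]
  · gcongr

/-- Estimating the variance does not affect the selected order asymptotically. The selector is
monotone in the scale, so that it is determined by its values at two scales bracketing the
estimated one. -/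
theorem tendsto_selector_ne (h : LocalModel P p₀ c Q x₀ σ (fun n => PostSel.gram (X n)) x)
    (hs : Tendsto s atTop (𝓝 σ)) (θ : ℕ → Fin P → ℝ) :
    Tendsto (fun n => (Measure.pi fun _ : Fin n => gaussianReal 0 (s n ^ 2).toNNReal).real
      {u | scoreSelector c (PostSel.gram (X n)) (x n) (√(sigmaHatSq (X n) (X n *ᵥ θ n + u)))
          (score (X n) u) ≠
        scoreSelector c (PostSel.gram (X n)) (x n) (s n) (score (X n) u)}) atTop (𝓝 0) := by
  rw [Metric.tendsto_nhds]
  intro ε hε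
  have hε8 : 0 < ε / 8 := by positivity
  obtain ⟨pa, hpa, pb, hpb, hp⟩ := eventually_prod_iff.1
    (h.tendsto_badSet.eventually (gt_mem_nhds hε8))
  obtain ⟨e₀, he₀, hball⟩ := Metric.eventually_nhds_iff.1 hpb
  set e := min (e₀ / 2) (σ / 2) with he
  have he_pos : 0 < e := lt_min (by positivity) (by linarith [h.pos])
  have he_lt : e < e₀ := (min_le_left _ _).trans_lt (by linarith)
  have he_σ : e < σ := (min_le_right _ _).trans_lt (by linarith [h.pos])
  have hb1 : pb (σ + e) := hball (by rw [Real.dist_eq]; simpa [abs_of_pos he_pos] using he_lt)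
  have hb2 : pb (σ - e) := hball (by rw [Real.dist_eq]; simpa [abs_of_pos he_pos] using he_lt)
  filter_upwards [hpa, (h.tendsto_badSet_seq hs).eventually (gt_mem_nhds hε8),
    h.tvTendsto_score hs (ε / 8) hε8,
    (h.tendsto_sqrt_sigmaHatSq hs θ he_pos).eventually (gt_mem_nhds hε8)] with n hna hn hTV hσn
  set μ := Measure.pi fun _ : Fin n => gaussianReal 0 (s n ^ 2).toNNReal with hμ
  set D := badSet p₀ c Q x₀ σ (PostSel.gram (X n)) (x n) with hD
  have hmeas : ∀ t, MeasurableSet (D t) := fun t => measurableSet_badSet _ _ t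
  have hle : ∀ t, (gaussLaw (σ ^ 2 • Q)).real (D t) < ε / 8 →
      μ.real (score (X n) ⁻¹' D t) ≤ ε / 4 := by
    intro t ht
    rw [← map_measureReal_apply (measurable_score _) (hmeas t), hμ, map_score]
    have := (abs_le.1 (hTV _ (hmeas t))).2
    linarith
  -- outside these events the order selected at `σ - e` and `σ + e` is the one selected at `s n`,
  -- and the estimated scale lies between them
  have hsub : {u | scoreSelector c (PostSel.gram (X n)) (x n)
        (√(sigmaHatSq (X n) (X n *ᵥ θ n + u))) (score (X n) u) ≠
      scoreSelector c (PostSel.gram (X n)) (x n) (s n) (score (X n) u)} ⊆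
      ({u | e ≤ |√(sigmaHatSq (X n) (X n *ᵥ θ n + u)) - σ|} ∪ score (X n) ⁻¹' D (s n)) ∪
        (score (X n) ⁻¹' D (σ + e) ∪ score (X n) ⁻¹' D (σ - e)) := by
    intro u hu
    by_contra hcon
    simp only [Set.mem_union, not_or, Set.mem_ofPred_eq, not_le, Set.mem_preimage, hD, badSet,
      not_not] at hcon
    obtain ⟨⟨h1, h2⟩, h3, h4⟩ := hcon
    rw [abs_lt] at h1
    refine hu ?_
    rw [h2]
    refine le_antisymm ?_ ?_
    · rw [← h4]
      exact scoreSelector_antitone c _ _ _ (by linarith) (by linarith)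
    · rw [← h3]
      exact scoreSelector_antitone c _ _ _ (by linarith) (by linarith)
  rw [Real.dist_eq, sub_zero, abs_of_nonneg measureReal_nonneg]
  have h1 := hle _ hn
  have h2 := hle _ (hp hna hb1)
  have h3 := hle _ (hp hna hb2)
  calc _ ≤ _ := measureReal_mono hsub
    _ ≤ (μ.real {u | e ≤ |√(sigmaHatSq (X n) (X n *ᵥ θ n + u)) - σ|} +
          μ.real (score (X n) ⁻¹' D (s n))) +
        (μ.real (score (X n) ⁻¹' D (σ + e)) + μ.real (score (X n) ⁻¹' D (σ - e))) :=
      (measureReal_union_le _ _).trans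
        (add_le_add (measureReal_union_le _ _) (measureReal_union_le _ _))
    _ < ε := by linarith

end LocalModel

end VarianceEstimator

/-! ### The order `p_*` -/

section PStar

variable {P O : ℕ} {ψ : Fin P → EReal}

theorem finite_pStar_set (O : ℕ) (ψ : Fin P → EReal) :
    (insert O {p : ℕ | O < p ∧ ∃ j : Fin P, (j : ℕ) + 1 = p ∧ (ψ j = ⊤ ∨ ψ j = ⊥)}).Finite := by
  refine Set.Finite.insert _ ((Set.finite_Iic P).subset ?_)
  rintro p ⟨-, j, rfl, -⟩
  exact Nat.succ_le_of_lt j.2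

theorem pStar_eq_or (O : ℕ) (ψ : Fin P → EReal) : pStar O ψ = O ∨
    O < pStar O ψ ∧ ∃ j : Fin P, (j : ℕ) + 1 = pStar O ψ ∧ (ψ j = ⊤ ∨ ψ j = ⊥) :=
  Nat.sSup_mem (Set.insert_nonempty _ _) (finite_pStar_set O ψ).bddAbove

theorem le_pStar (O : ℕ) (ψ : Fin P → EReal) : O ≤ pStar O ψ :=
  le_csSup (finite_pStar_set O ψ).bddAbove (Set.mem_insert _ _)

theorem pStar_le (hO : O ≤ P) (ψ : Fin P → EReal) : pStar O ψ ≤ P := by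
  rcases pStar_eq_or O ψ with h | ⟨-, j, hj, -⟩
  · omega
  · have := j.2
    omega

theorem ne_top_bot_of_pStar_le {j : Fin P} (hj : pStar O ψ ≤ j) : ψ j ≠ ⊤ ∧ ψ j ≠ ⊥ := by
  by_contra hcon
  have h : (j : ℕ) + 1 ≤ pStar O ψ := by
    refine le_csSup (finite_pStar_set O ψ).bddAbove (Or.inr ⟨?_, j, rfl, ?_⟩)
    · have := le_pStar O ψ
      omega
    · tauto
  omega

end PStar

/-! ### Biases in the column space of `A[p]` -/

section RangeCondition

variable {P k p₀ p : ℕ}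

theorem exists_rightInverse_of_rank_eq {m : Type*} [Fintype m] [DecidableEq m]
    {B : Matrix (Fin k) m ℝ} (hB : B.rank = k) : ∃ W : Matrix m (Fin k) ℝ, B * W = 1 := by
  refine Matrix.mulVec_surjective_iff_exists_right_inverse.1 ?_
  have h : LinearMap.range B.mulVecLin = ⊤ :=
    Submodule.eq_top_of_finrank_eq (by rw [← Matrix.rank, hB]; simp)
  exact LinearMap.range_eq_top.1 h

theorem truncMat_mul_headIncl (h : p₀ ≤ p) : truncMat P p * headIncl P p₀ = headIncl P p₀ := by
  have := congrArg Matrix.transpose (headIncl_transpose_mul_truncMat (P := P) h)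
  rwa [transpose_mul, transpose_transpose, truncMat, transpose_mul, transpose_transpose] at this

theorem tailIncl_mulVec_tailVec (x : Fin P → ℝ) (p : ℕ) :
    tailIncl P p *ᵥ tailVec x p = x - truncMat P p *ᵥ x := by
  rw [eq_sub_iff_add_eq, truncMat, ← Matrix.mulVec_mulVec, ← headVec_eq, add_comm, head_add_tail]

/-- Passing from order `p₀` to `p ≥ p₀` moves the coordinates `p₀ < j ≤ p` from the tail to the
head. -/
theorem tailCols_mulVec_tailVec (A : Matrix (Fin k) (Fin P) ℝ) (h : p₀ ≤ p) (x : Fin P → ℝ) :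
    tailCols A p *ᵥ tailVec x p = tailCols A p₀ *ᵥ tailVec x p₀ -
      headCols A p *ᵥ headVec (x - truncMat P p₀ *ᵥ x) p := by
  have h1 : x - truncMat P p *ᵥ x =
      (x - truncMat P p₀ *ᵥ x) - truncMat P p *ᵥ (x - truncMat P p₀ *ᵥ x) := by
    ext i
    simp only [Pi.sub_apply, truncMat_mulVec_apply]
    split_ifs <;> first | omega | simp
  rw [tailCols_eq, tailCols_eq, headCols_eq, headVec_eq, ← Matrix.mulVec_mulVec,
    ← Matrix.mulVec_mulVec, ← Matrix.mulVec_mulVec, tailIncl_mulVec_tailVec,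
    tailIncl_mulVec_tailVec, Matrix.mulVec_mulVec _ (headIncl P p), ← truncMat,
    ← Matrix.mulVec_sub, ← h1]

namespace LocalModel

variable {Q : Matrix (Fin P) (Fin P) ℝ} {c : ℕ → ℝ} {x₀ : Fin P → ℝ} {σ : ℝ}
  {G : ℕ → Matrix (Fin P) (Fin P) ℝ} {x : ℕ → Fin P → ℝ}

/-- If `A[p₀]` has full row rank, a right inverse of `A[p₀]` provides preimages of the bias
differences, continuously. -/
theorem bias_mem_range_of_rank (h : LocalModel P p₀ c Q x₀ σ G x) {A : Matrix (Fin k) (Fin P) ℝ}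
    (hA : (headCols A p₀).rank = k) (hp : p₀ ≤ p) :
    ∃ w : ℕ → {j : Fin P // (j : ℕ) < p} → ℝ, Tendsto w atTop (𝓝 0) ∧ ∀ᶠ n in atTop,
      A *ᵥ biasVec (G n) p (x n) - A *ᵥ biasVec Q p x₀ = headCols A p *ᵥ w n := by
  obtain ⟨W, hW⟩ := exists_rightInverse_of_rank_eq hA
  refine ⟨fun n => ((headIncl P p)ᵀ * headIncl P p₀ * W) *ᵥ
    (A *ᵥ biasVec (G n) p (x n) - A *ᵥ biasVec Q p x₀), ?_, Eventually.of_forall fun n => ?_⟩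
  · have h1 := (tendsto_mulVec (tendsto_const_nhds (x := A)) (h.tendsto_bias hp)).sub_const
      (A *ᵥ biasVec Q p x₀)
    rw [sub_self] at h1
    simpa using tendsto_mulVec
      (tendsto_const_nhds (x := (headIncl P p)ᵀ * headIncl P p₀ * W)) h1
  · have h2 : headCols A p * ((headIncl P p)ᵀ * headIncl P p₀ * W) = 1 := by
      rw [headCols_eq, Matrix.mul_assoc, ← Matrix.mul_assoc (headIncl P p),
        ← Matrix.mul_assoc (headIncl P p), ← truncMat, truncMat_mul_headIncl hp,
        ← Matrix.mul_assoc, ← headCols_eq, hW]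
    rw [Matrix.mulVec_mulVec, h2, Matrix.one_mulVec]

/-- If the coordinates beyond `p₀` contribute a constant to `A x`, then this constant cancels from
the bias differences and what is left lies in the column space of `A[p]`. -/
theorem bias_mem_range_of_const (h : LocalModel P p₀ c Q x₀ σ G x) {A : Matrix (Fin k) (Fin P) ℝ}
    {v : Fin k → ℝ} (hv : ∀ᶠ n in atTop, tailCols A p₀ *ᵥ tailVec (x n) p₀ = v) (hp : p₀ ≤ p) :
    ∃ w : ℕ → {j : Fin P // (j : ℕ) < p} → ℝ, Tendsto w atTop (𝓝 0) ∧ ∀ᶠ n in atTop,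
      A *ᵥ biasVec (G n) p (x n) - A *ᵥ biasVec Q p x₀ = headCols A p *ᵥ w n := by
  have hv₀ : tailCols A p₀ *ᵥ tailVec x₀ p₀ = v :=
    tendsto_nhds_unique (tendsto_mulVec (tendsto_const_nhds (x := tailCols A p₀))
      (h.tendsto_tailVec le_rfl)) (tendsto_const_nhds.congr' (hv.mono fun n hn => hn.symm))
  have h1 := tendsto_biasVec_head h.posDef h.tendsto_gram (h.tendsto_tailVec hp)
  have h2 : Tendsto (fun n => headVec (x n - truncMat P p₀ *ᵥ x n) p) atTop
      (𝓝 (headVec (x₀ - truncMat P p₀ *ᵥ x₀) p)) := by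
    rw [tendsto_pi_nhds]
    intro j
    simp only [headVec, Pi.sub_apply, truncMat_mulVec_apply]
    split_ifs with hj
    · simp
    · simpa using h.tendsto_coord j.1 (not_lt.1 hj)
  refine ⟨fun n => (((blockHH (G n) p)⁻¹ * blockHT (G n) p) *ᵥ tailVec (x n) p -
      ((blockHH Q p)⁻¹ * blockHT Q p) *ᵥ tailVec x₀ p) +
    (headVec (x n - truncMat P p₀ *ᵥ x n) p - headVec (x₀ - truncMat P p₀ *ᵥ x₀) p), ?_, ?_⟩
  · have h3 := (h1.sub_const (((blockHH Q p)⁻¹ * blockHT Q p) *ᵥ tailVec x₀ p)).add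
      (h2.sub_const (headVec (x₀ - truncMat P p₀ *ᵥ x₀) p))
    simpa using h3
  · filter_upwards [hv] with n hn
    rw [mulVec_biasVec, mulVec_biasVec, tailCols_mulVec_tailVec A hp (x n),
      tailCols_mulVec_tailVec A hp x₀, hn, hv₀, Matrix.mulVec_add, Matrix.mulVec_sub,
      Matrix.mulVec_sub]
    abel

end LocalModel

end RangeCondition

/-! ### The regression model as a local model -/

section Setting

variable {P k : ℕ}

theorem posDef_of_tendsto_gram {X : ∀ n : ℕ, Matrix (Fin n) (Fin P) ℝ}
    {Q : Matrix (Fin P) (Fin P) ℝ}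
    (hQ : Tendsto (fun n => PostSel.gram (X n)) atTop (𝓝 Q)) (hdet : IsUnit Q.det) :
    Q.PosDef := by
  have hsd : Q.PosSemidef := by
    refine PosSemidef.of_dotProduct_mulVec_nonneg ?_ fun v => ?_
    · refine Matrix.IsHermitian.ext fun i j => ?_
      refine tendsto_nhds_unique (tendsto_matrix_iff.1 hQ j i)
        ((tendsto_matrix_iff.1 hQ i j).congr fun n => ?_)
      exact (gram_posSemidef (X n)).isHermitian.apply j i
    · refine ge_of_tendsto (tendsto_dotProduct_const (star v)
        (tendsto_mulVec hQ (tendsto_const_nhds (x := v)))) (Eventually.of_forall fun n => ?_)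
      exact (gram_posSemidef (X n)).dotProduct_mulVec_nonneg v
  exact hsd.posDef_iff_det_ne_zero.2 hdet.ne_zero

theorem tendsto_toReal_of_tendsto_coe {β : Type*} {l : Filter β} {f : β → ℝ} {a : EReal}
    (hf : Tendsto (fun n => (f n : EReal)) l (𝓝 a)) (h₁ : a ≠ ⊤) (h₂ : a ≠ ⊥) :
    Tendsto f l (𝓝 a.toReal) := by
  rw [← EReal.coe_toReal h₁ h₂] at hf
  exact EReal.tendsto_coe.1 hf

theorem tendsto_abs_atTop_of_tendsto_coe {β : Type*} {l : Filter β} {f : β → ℝ} {a : EReal}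
    (hf : Tendsto (fun n => (f n : EReal)) l (𝓝 a)) (ha : a = ⊤ ∨ a = ⊥) :
    Tendsto (fun n => |f n|) l atTop := by
  rcases ha with rfl | rfl
  · exact tendsto_abs_atTop_atTop.comp (EReal.tendsto_coe_nhds_top_iff.1 hf)
  · exact tendsto_abs_atBot_atTop.comp (EReal.tendsto_coe_nhds_bot_iff.1 hf)

/-- The setting of the theorem is a local model with `p₀ = p_*` and local parameter `√n θ`. -/
theorem localModel_of_tendsto {O : ℕ} (hO : O < P) {X : ∀ n : ℕ, Matrix (Fin n) (Fin P) ℝ}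
    {Q : Matrix (Fin P) (Fin P) ℝ}
    (hQ : Tendsto (fun n => PostSel.gram (X n)) atTop (𝓝 Q)) (hQdet : IsUnit Q.det)
    {c : ℕ → ℝ} (hcO : c O = 0) {θ : ℕ → Fin P → ℝ} {ψ : Fin P → EReal}
    (hθ : ∀ j, Tendsto (fun n : ℕ => ((√(n : ℝ) * θ n j : ℝ) : EReal)) atTop (𝓝 (ψ j)))
    {σ : ℝ} (hσ : 0 < σ) :
    LocalModel P (pStar O ψ) c Q (finPart ψ) σ (fun n => PostSel.gram (X n))
      (fun n => √(n : ℝ) • θ n) where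
  le := pStar_le hO.le ψ
  posDef := posDef_of_tendsto_gram hQ hQdet
  posSemidef n := gram_posSemidef (X n)
  tendsto_gram := hQ
  pos := hσ
  tendsto_coord j hj := by
    obtain ⟨h1, h2⟩ := ne_top_bot_of_pStar_le hj
    exact tendsto_toReal_of_tendsto_coe (hθ j) h1 h2
  reject := by
    rcases pStar_eq_or O ψ with h | ⟨-, j, hj, hψ⟩
    · left
      rw [h, hcO]
    · right
      refine ⟨by omega, ?_⟩
      have h1 : ∀ y : Fin P → ℝ, coord y (pStar O ψ) = y j := by
        intro y
        have h2 : 0 < pStar O ψ ∧ pStar O ψ ≤ P := ⟨by omega, pStar_le hO.le ψ⟩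
        rw [coord, dif_pos h2]
        congr 1
        ext
        simp only
        omega
      simp only [h1]
      exact tendsto_abs_atTop_of_tendsto_coe (hθ j) hψ

theorem pmsLawStar_eq {n : ℕ} (hn : 0 < n) {X : Matrix (Fin n) (Fin P) ℝ}
    (hX : (PostSel.gram X).PosDef) (A : Matrix (Fin k) (Fin P) ℝ) (c : ℕ → ℝ) (θ : Fin P → ℝ)
    (s : ℝ) : pmsLawStar X A c θ s = (gaussLaw (s ^ 2 • PostSel.gram X)).map
      (selectedError A c (PostSel.gram X) (√(n : ℝ) • θ) s) := by
  have hm : Measurable fun Y => √(n : ℝ) • (A *ᵥ (pmsEstStar X c s Y - θ)) :=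
    measurable_scaled A θ (measurable_restrLS_selector X c measurable_const)
  have hadd : Measurable fun u : Fin n → ℝ => X *ᵥ θ + u := measurable_const.add measurable_id
  rw [pmsLawStar, sampleLaw, ← map_score X s, Measure.map_map hm hadd,
    Measure.map_map (measurable_selectedError _ _ _ _ _) (LocalModel.measurable_score X)]
  congr 1
  ext1 u
  simp only [Function.comp_apply, pmsEstStar, selectedError]
  rw [smul_mulVec_restrLS_sub hn hX, selector_eq hn hX]

/-- The laws with estimated and with known variance differ at most by the probability that the
selected orders differ. -/
theorem abs_pmsLaw_sub_pmsLawStar_le {n : ℕ} (hn : 0 < n) {X : Matrix (Fin n) (Fin P) ℝ}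
    (hX : (PostSel.gram X).PosDef) (A : Matrix (Fin k) (Fin P) ℝ) (c : ℕ → ℝ) (θ : Fin P → ℝ)
    (s : ℝ) {B : Set (Fin k → ℝ)} (hB : MeasurableSet B) :
    |(pmsLaw X A c θ s).real B - (pmsLawStar X A c θ s).real B| ≤
      (Measure.pi fun _ : Fin n => gaussianReal 0 (s ^ 2).toNNReal).real
        {u | scoreSelector c (PostSel.gram X) (√(n : ℝ) • θ) (√(sigmaHatSq X (X *ᵥ θ + u)))
            (score X u) ≠
          scoreSelector c (PostSel.gram X) (√(n : ℝ) • θ) s (score X u)} := by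
  have hm1 : Measurable fun Y => √(n : ℝ) • (A *ᵥ (pmsEst X c Y - θ)) :=
    measurable_scaled A θ (measurable_restrLS_selector X c (measurable_sigmaHatSq X).sqrt)
  have hm2 : Measurable fun Y => √(n : ℝ) • (A *ᵥ (pmsEstStar X c s Y - θ)) :=
    measurable_scaled A θ (measurable_restrLS_selector X c measurable_const)
  have hadd : Measurable fun u : Fin n → ℝ => X *ᵥ θ + u := measurable_const.add measurable_id
  rw [pmsLaw, pmsLawStar, sampleLaw, Measure.map_map hm1 hadd, Measure.map_map hm2 hadd,
    map_measureReal_apply (hm1.comp hadd) hB, map_measureReal_apply (hm2.comp hadd) hB]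
  refine abs_measureReal_sub_le_of_iff fun u hu => ?_
  simp only [Set.mem_ofPred_eq, not_not] at hu
  simp only [Set.mem_preimage, Function.comp_apply, pmsEst, pmsEstStar]
  rw [selector_eq hn hX, selector_eq hn hX, hu]

theorem TVTendsto.tendsto_tvDist {μ : ℕ → Measure (Fin k → ℝ)} {ν : Measure (Fin k → ℝ)}
    (h : TVTendsto μ ν) : Tendsto (fun n => tvDist (μ n) ν) atTop (𝓝 0) := by
  rw [Metric.tendsto_nhds]
  intro ε hε
  filter_upwards [h (ε / 2) (by positivity)] with n hn
  have h1 : tvDist (μ n) ν ≤ ε / 2 := by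
    have : Nonempty {B : Set (Fin k → ℝ) // MeasurableSet B} := ⟨⟨∅, MeasurableSet.empty⟩⟩
    exact ciSup_le fun B => hn B.1 B.2
  have h0 : 0 ≤ tvDist (μ n) ν := Real.iSup_nonneg fun B => abs_nonneg _
  rw [Real.dist_eq, sub_zero, abs_of_nonneg h0]
  linarith

theorem TVTendsto.of_abs_sub_le {α : Type*} [MeasurableSpace α] {μ μ' : ℕ → Measure α}
    {ν : Measure α} {e : ℕ → ℝ} (h : TVTendsto μ ν) (he : Tendsto e atTop (𝓝 0))
    (hle : ∀ᶠ n in atTop, ∀ B, MeasurableSet B → |(μ' n).real B - (μ n).real B| ≤ e n) :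
    TVTendsto μ' ν := by
  intro ε hε
  filter_upwards [h (ε / 2) (by positivity), he.eventually (gt_mem_nhds (half_pos hε)), hle]
    with n h1 h2 h3 B hB
  have := abs_sub_le ((μ' n).real B) ((μ n).real B) (ν.real B)
  linarith [h1 B hB, h3 B hB]

end Setting

theorem proposition5p1 (P O k : ℕ) (hO : O < P) (hk : 1 ≤ k)
    (X : ∀ n : ℕ, Matrix (Fin n) (Fin P) ℝ) (hX : ∀ n, P < n → (X n).rank = P)
    (Q : Matrix (Fin P) (Fin P) ℝ)
    (hQ : Tendsto (fun n => gram (X n)) atTop (𝓝 Q)) (hQdet : IsUnit Q.det)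
    (A : Matrix (Fin k) (Fin P) ℝ) (hA : A.rank = k)
    (c : ℕ → ℝ) (hcO : c O = 0) (hc : ∀ p, O < p → p ≤ P → 0 < c p)
    (θ : ℕ → Fin P → ℝ) (ψ : Fin P → EReal)
    (hθ : ∀ j, Tendsto (fun n : ℕ => ((√(n : ℝ) * θ n j : ℝ) : EReal)) atTop (𝓝 (ψ j)))
    (σ : ℕ → ℝ) (hσ : ∀ n, P < n → 0 < σ n)
    (σlim : ℝ) (hσlim : Tendsto σ atTop (𝓝 σlim)) (hσlim_pos : 0 < σlim)
    (gi : ℕ → Matrix (Fin k) (Fin k) ℝ)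
    (hgi : ∀ p, 0 < p → p ≤ P → IsGenInv (covMat Q A p) (gi p)) :
    -- the scaled biases converge to the (finite) vectors `δ^{(p)}`
    (∀ p, pStar O ψ ≤ p → p ≤ P →
      Tendsto (fun n : ℕ => √(n : ℝ) • (meanLS (X n) p (θ n) - θ n)) atTop
        (𝓝 (deltaInf Q ψ p))) ∧
    ∃ L : Measure (Fin k → ℝ), IsProbabilityMeasure L ∧
      cdfOf L = limitCdf O Q A c gi σlim ψ ∧
      CdfTendsto (fun n => cdfOf (pmsLawStar (X n) A c (θ n) (σ n)))
        (limitCdf O Q A c gi σlim ψ) ∧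
      CdfTendsto (fun n => cdfOf (pmsLaw (X n) A c (θ n) (σ n)))
        (limitCdf O Q A c gi σlim ψ) ∧
      ((0 < pStar O ψ ∧ (headCols A (pStar O ψ)).rank = k) ∨
        (pStar O ψ < P ∧ ∃ v : Fin k → ℝ, ∀ n : ℕ, P < n →
          √(n : ℝ) • (tailCols A (pStar O ψ) *ᵥ tailVec (θ n) (pStar O ψ)) = v) →
        Tendsto (fun n => tvDist (pmsLawStar (X n) A c (θ n) (σ n)) L) atTop (𝓝 0) ∧
        Tendsto (fun n => tvDist (pmsLaw (X n) A c (θ n) (σ n)) L) atTop (𝓝 0)) := by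
  have h := localModel_of_tendsto hO hQ hQdet hcO hθ hσlim_pos
  have hlarge : ∀ᶠ n : ℕ in atTop, 0 < n ∧ (PostSel.gram (X n)).PosDef :=
    (eventually_gt_atTop 0).and h.eventually_posDef
  set L := (gaussLaw (σlim ^ 2 • Q)).map (limError (pStar O ψ) A c Q (finPart ψ) σlim)
  have hLcdf : cdfOf L = limitCdf O Q A c gi σlim ψ :=
    cdfOf_map_limError h.posDef A c σlim O ψ h.le gi hgi
  have hstar : ∀ᶠ n in atTop, pmsLawStar (X n) A c (θ n) (σ n) =
      (gaussLaw (σ n ^ 2 • PostSel.gram (X n))).map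
        (selectedError A c (PostSel.gram (X n)) (√(n : ℝ) • θ n) (σ n)) := by
    filter_upwards [hlarge] with n hn
    exact pmsLawStar_eq hn.1 hn.2 A c (θ n) (σ n)
  obtain ⟨e, hzero, hdiff⟩ : ∃ e : ℕ → ℝ, Tendsto e atTop (𝓝 0) ∧
      ∀ᶠ n in atTop, ∀ B, MeasurableSet B →
        |(pmsLaw (X n) A c (θ n) (σ n)).real B - (pmsLawStar (X n) A c (θ n) (σ n)).real B| ≤
          e n := by
    refine ⟨_, h.tendsto_selector_ne hσlim θ, ?_⟩
    filter_upwards [hlarge] with n hn B hB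
    exact abs_pmsLaw_sub_pmsLawStar_le hn.1 hn.2 A c (θ n) (σ n) hB
  have hweak : CdfTendsto (fun n => cdfOf (pmsLawStar (X n) A c (θ n) (σ n)))
      (limitCdf O Q A c gi σlim ψ) := by
    intro t ht
    rw [← hLcdf] at ht ⊢
    refine (h.tendsto_cdf hσlim A ht).congr' ?_
    filter_upwards [hstar] with n hn
    rw [hn]
  refine ⟨fun p hp _ => ?_, L, ?_, hLcdf, hweak, fun t ht => ?_, fun hcase => ?_⟩
  · refine (h.tendsto_bias hp).congr' ?_
    filter_upwards [hlarge] with n hn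
    exact (smul_meanLS_sub hn.1 hn.2 p (θ n)).symm
  · exact Measure.isProbabilityMeasure_map (measurable_limError _ A c Q _ _).aemeasurable
  · have h0 : Tendsto (fun n => cdfOf (pmsLaw (X n) A c (θ n) (σ n)) t -
        cdfOf (pmsLawStar (X n) A c (θ n) (σ n)) t) atTop (𝓝 0) :=
      squeeze_zero_norm' (hdiff.mono fun n hn => hn _ measurableSet_Iic) hzero
    simpa using h0.add (hweak t ht)
  · have hTV : TVTendsto (fun n => pmsLawStar (X n) A c (θ n) (σ n)) L := by
      have h1 := h.tvTendsto_selectedError hσlim A fun p hp _ => by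
        rcases hcase with ⟨-, hrank⟩ | ⟨-, v, hv⟩
        · exact h.bias_mem_range_of_rank hrank hp
        · refine h.bias_mem_range_of_const (v := v) ?_ hp
          filter_upwards [eventually_gt_atTop P] with n hn
          rw [← hv n hn, ← Matrix.mulVec_smul]
          rfl
      intro ε hε
      filter_upwards [h1 ε hε, hstar] with n hn1 hn2
      rw [hn2]
      exact hn1
    exact ⟨hTV.tendsto_tvDist, (hTV.of_abs_sub_le hzero hdiff).tendsto_tvDist⟩
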